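/- Let $n\ge 2$ and let $\overline{\mathbb R}^n=\mathbb R^n\cup\{\infty\}$ be the Möbius space (the one-point compactification of $\mathbb R^n$). For a family $\Gamma$ of curves in $\overline{\mathbb R}^n$, let $$\mathsf M(\Gamma)=\inf_\rho\int_{\mathbb R^n}\rho^n\,dm ,$$ where the infimum is taken over all Borel functions $\rho:\mathbb R^n\to[0,+\infty]$ with $\int_\gamma\rho\,ds\ge 1$ for every rectifiable curve $\gamma\in\Gamma$ (curves through $\infty$ are not rectifiable and impose no condition), with $\mathsf M(\Gamma)=\infty$ if there is no such $\rho$. For $E,F,D\subset\overline{\mathbb R}^n$, let $\Delta(E,F;D)$ be the family of all curves $\gamma:[a,b]\to\overline{\mathbb R}^n$, $a<b$, with $\gamma(a)\in E$, $\gamma(b)\in F$ and $\gamma((a,b))\subset D$. Let $G\subset\overline{\mathbb R}^n$ be a domain (a nonempty connected open set) with $\partial G\neq\emptyset$. For $x,y\in G$ set $$\mu_G(x,y)=\inf_{C_{xy}}\mathsf M\bigl(\Delta(C_{xy},\partial G;G)\bigr),$$ where the infimum is taken over all curves $C_{xy}$ in $G$ joining $x$ and $y$. A point $x\in\partial G$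 satisfies the M-condition if, with $C=\overline{\mathbb R}^n\setminus G$, there is no continuum $K$ (compact connected set with at least two points) such that $x\in K\subset\{x\}\cup(\overline{\mathbb R}^n\setminus C)$ and $\mathsf M(\Delta(K,C;\overline{\mathbb R}^n\setminus C))<\infty$, i.e. if $C$ fails the continuum criterion at $x$. The domain $G$ is an M-domain if every point of $\partial G$ satisfies the M-condition. Then the following conditions are equivalent: (i) $(G,\mu_G)$ is a proper metric space, i.e. $\mu_G$ is a metric on $G$ and every closed ball $\{x\in G:\mu_G(x,a)\le r\}$, $a\in G$, $r>0$, is compact in the topology of $\mu_G$; (ii) $(G,\mu_G)$ is a complete metric space, i.e. $\mu_G$ is a metric on $G$ and every Cauchy sequence for $\mu_G$ converges; (iii) $G$ is an M-domain. -/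

import Mathlib

open scoped ENNReal unitInterval

noncomputable section

namespace ModulusMetric

/-- The Möbius space: the one-point compactification of Euclidean `n`-space. -/
abbrev MobiusSpace (n : ℕ) : Type := OnePoint (EuclideanSpace ℝ (Fin n))

/-- The integral of `ρ` with respect to arc length along a rectifiable curve `g` in Euclidean
space, computed in the arc-length parametrization of `g`. -/
def lineIntegral {n : ℕ} (ρ : EuclideanSpace ℝ (Fin n) → ℝ≥0∞)
    (g : I → EuclideanSpace ℝ (Fin n)) : ℝ≥0∞ :=
  ∫⁻ s in Set.Icc 0 (eVariationOn g Set.univ).toReal,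
    ρ (naturalParameterization g Set.univ 0 s)

/-- `ρ` is admissible for the curve family `Γ`: it is Borel and has integral at least `1` along
every rectifiable curve of `Γ`. A curve through `∞` is not rectifiable, so it imposes no
condition; for the other curves, `g` is the curve regarded as a curve in Euclidean space. -/
def Admissible {n : ℕ} (Γ : Set C(I, MobiusSpace n))
    (ρ : EuclideanSpace ℝ (Fin n) → ℝ≥0∞) : Prop :=
  Measurable ρ ∧ ∀ γ ∈ Γ, ∀ g : I → EuclideanSpace ℝ (Fin n),
    (∀ t, γ t = (g t : MobiusSpace n)) → eVariationOn g Set.univ ≠ ∞ → 1 ≤ lineIntegral ρ g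

/-- The conformal modulus of a curve family (it is `∞` if there is no admissible function). -/
def modulus {n : ℕ} (Γ : Set C(I, MobiusSpace n)) : ℝ≥0∞ :=
  ⨅ (ρ : EuclideanSpace ℝ (Fin n) → ℝ≥0∞) (_ : Admissible Γ ρ), ∫⁻ x, ρ x ^ n

/-- The family `Δ(A, B; D)` of all curves that join `A` and `B` in `D`. Only the interior of the
curve is required to lie in `D`. -/
def curvesJoining {n : ℕ} (A B D : Set (MobiusSpace n)) : Set C(I, MobiusSpace n) :=
  {γ | γ 0 ∈ A ∧ γ 1 ∈ B ∧ ∀ t ∈ Set.Ioo (0 : I) 1, γ t ∈ D}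

/-- The modulus metric `μ_G` (as an extended nonnegative number). -/
def modulusDist {n : ℕ} (G : Set (MobiusSpace n)) (x y : G) : ℝ≥0∞ :=
  ⨅ (c : C(I, MobiusSpace n)) (_ : c 0 = x ∧ c 1 = y ∧ ∀ t, c t ∈ G),
    modulus (curvesJoining (Set.range c) (frontier G) G)

/-- A continuum: a compact connected set with at least two points. -/
def IsContinuum {n : ℕ} (K : Set (MobiusSpace n)) : Prop :=
  IsCompact K ∧ IsConnected K ∧ K.Nontrivial

/-- The closed set `C` satisfies the continuum criterion at its point `x`. -/
def ContinuumCriterion {n : ℕ} (C : Set (MobiusSpace n)) (x : MobiusSpace n) : Prop :=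
  ∃ K : Set (MobiusSpace n), IsContinuum K ∧ x ∈ K ∧ K ⊆ {x} ∪ Cᶜ ∧
    modulus (curvesJoining K C Cᶜ) < ∞

/-- The boundary point `x` satisfies the M-condition relative to `G`. -/
def MCondition {n : ℕ} (G : Set (MobiusSpace n)) (x : MobiusSpace n) : Prop :=
  ¬ ContinuumCriterion Gᶜ x

/-- `G` is an M-domain. -/
def IsMDomain {n : ℕ} (G : Set (MobiusSpace n)) : Prop :=
  ∀ x ∈ frontier G, MCondition G x

/-- `d` is a (finite, point-separating) metric on `X`, and `(X, d)` is a proper metric space.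
The topology is the one of the metric `d`. -/
def IsProperMetric {X : Type*} (d : X → X → ℝ≥0∞) : Prop :=
  ∃ _ : MetricSpace X, (∀ x y : X, edist x y = d x y) ∧ ProperSpace X

/-- `d` is a (finite, point-separating) metric on `X`, and `(X, d)` is a complete metric space.
The uniformity is the one of the metric `d`. -/
def IsCompleteMetric {X : Type*} (d : X → X → ℝ≥0∞) : Prop :=
  ∃ _ : MetricSpace X, (∀ x y : X, edist x y = d x y) ∧ CompleteSpace X

end ModulusMetric

end

open scoped ENNReal unitInterval NNReal
open MeasureTheory Set Filter Topology

noncomputable section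

namespace ModulusMetric

section

/-! ### Change of variables along Lipschitz functions of one variable. -/

section Coarea

/-- A `1`-Lipschitz function on `[0, L]` pushes Lebesgue measure to a measure that dominates
Lebesgue measure between its end values. -/
theorem restrict_uIcc_le_map {u : ℝ → ℝ} (hu : LipschitzWith 1 u) {L : ℝ} (hL : 0 ≤ L) :
    (volume.restrict (uIcc (u 0) (u L))) ≤ (volume.restrict (Icc 0 L)).map u := by
  have hm : Measurable u := hu.continuous.measurable
  refine Measure.le_iff.2 fun B hB => ?_
  rw [Measure.map_apply hm hB, Measure.restrict_apply hB, Measure.restrict_apply (hm hB)]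
  have hsub : B ∩ uIcc (u 0) (u L) ⊆ u '' (u ⁻¹' B ∩ Icc 0 L) := by
    rintro y ⟨hyB, hy⟩
    obtain ⟨s, hs, rfl⟩ := intermediate_value_uIcc (hu.continuous.continuousOn) hy
    rw [uIcc_of_le hL] at hs
    exact ⟨s, ⟨hyB, hs⟩, rfl⟩
  refine (measure_mono hsub).trans ?_
  have := hu.hausdorffMeasure_image_le (d := 1) zero_le_one (u ⁻¹' B ∩ Icc 0 L)
  simpa [hausdorffMeasure_real] using this

/-- Serves twice: with `u` the arc length along a curve, to compare parametrizations, and with `u`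
the distance to a center, to bound below the length of a curve that crosses a ring. -/
theorem setLIntegral_uIcc_le {u : ℝ → ℝ} (hu : LipschitzWith 1 u) {L : ℝ} (hL : 0 ≤ L)
    {f : ℝ → ℝ≥0∞} (hf : Measurable f) :
    ∫⁻ v in uIcc (u 0) (u L), f v ≤ ∫⁻ s in Icc 0 L, f (u s) := by
  rw [← lintegral_map hf hu.continuous.measurable]
  exact lintegral_mono' (restrict_uIcc_le_map hu hL) le_rfl

end Coarea

/-! ### The weighted distance of a density. -/

section WeightedDist

variable {E : Type*} [NormedAddCommGroup E]

/-- The infimum of the `ρ`-lengths of the Lipschitz curves from `p` to `q`. -/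
def weightedDist (ρ : E → ℝ≥0∞) (p q : E) : ℝ≥0∞ :=
  ⨅ (L : ℝ) (c : ℝ → E) (_ : 0 ≤ L ∧ LipschitzWith 1 c ∧ c 0 = p ∧ c L = q),
    ∫⁻ s in Icc 0 L, ρ (c s)

variable {ρ ρ' : E → ℝ≥0∞} {p q z : E} {ε : ℝ≥0∞}

theorem le_weightedDist_iff {a : ℝ≥0∞} : a ≤ weightedDist ρ p q ↔
    ∀ (L : ℝ) (c : ℝ → E), 0 ≤ L → LipschitzWith 1 c → c 0 = p → c L = q →
      a ≤ ∫⁻ s in Icc 0 L, ρ (c s) := by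
  simp only [weightedDist, le_iInf_iff, and_imp]

theorem weightedDist_le {L : ℝ} {c : ℝ → E} (hL : 0 ≤ L) (hc : LipschitzWith 1 c) :
    weightedDist ρ (c 0) (c L) ≤ ∫⁻ s in Icc 0 L, ρ (c s) :=
  le_weightedDist_iff.1 le_rfl L c hL hc rfl rfl

theorem weightedDist_lt_iff : weightedDist ρ p q < ε ↔
    ∃ (L : ℝ) (c : ℝ → E), 0 ≤ L ∧ LipschitzWith 1 c ∧ c 0 = p ∧ c L = q ∧
      ∫⁻ s in Icc 0 L, ρ (c s) < ε := by
  simp only [weightedDist, iInf_lt_iff, exists_prop, and_assoc]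

theorem weightedDist_mono (h : ρ ≤ ρ') (p q : E) : weightedDist ρ p q ≤ weightedDist ρ' p q :=
  le_weightedDist_iff.2 fun L c hL hc h0 h1 => by
    subst h0 h1
    exact (weightedDist_le hL hc).trans (lintegral_mono fun s => h _)

@[simp] theorem weightedDist_self (ρ : E → ℝ≥0∞) (p : E) : weightedDist ρ p p = 0 := by
  have := weightedDist_le (ρ := ρ) (L := 0) (c := fun _ => p) le_rfl (LipschitzWith.const' p)
  simpa using this

theorem weightedDist_comm (ρ : E → ℝ≥0∞) (p q : E) :
    weightedDist ρ p q = weightedDist ρ q p := by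
  suffices H : ∀ p q, weightedDist ρ p q ≤ weightedDist ρ q p from le_antisymm (H _ _) (H _ _)
  intro p q
  refine le_weightedDist_iff.2 fun L c hL hc h0 h1 => ?_
  have hc' : LipschitzWith 1 fun s => c (L - s) := by
    have h2 : LipschitzWith 1 fun s : ℝ => L - s := LipschitzWith.of_dist_le_mul fun x y => by
      rw [dist_sub_left]; simp
    simpa [Function.comp_def] using hc.comp h2
  have := weightedDist_le (ρ := ρ) hL hc'
  simp only [sub_zero, sub_self, h0, h1] at this
  refine this.trans_eq ?_
  have hmp : MeasurePreserving (fun s : ℝ => L - s) volume volume :=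
    Measure.measurePreserving_sub_left volume L
  have h3 := hmp.setLIntegral_comp_preimage_emb (MeasurableEquiv.subLeft L).measurableEmbedding
    (fun s => ρ (c s)) (Icc 0 L)
  simpa using h3

theorem weightedDist_triangle (ρ : E → ℝ≥0∞) (p q z : E) :
    weightedDist ρ p z ≤ weightedDist ρ p q + weightedDist ρ q z := by
  refine ENNReal.le_of_forall_pos_le_add fun ε hε hfin => ?_
  have hε2 : (0 : ℝ≥0∞) < (ε : ℝ≥0∞) / 2 := by simpa using hε.ne'
  obtain ⟨h1, h2⟩ := ENNReal.add_lt_top.1 hfin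
  obtain ⟨L₁, c₁, hL₁, hc₁, h10, h11, hi₁⟩ :=
    weightedDist_lt_iff.1 (ENNReal.lt_add_right h1.ne hε2.ne')
  obtain ⟨L₂, c₂, hL₂, hc₂, h20, h21, hi₂⟩ :=
    weightedDist_lt_iff.1 (ENNReal.lt_add_right h2.ne hε2.ne')
  -- Concatenation by a single formula. It is 1-Lipschitz because the increments of `min s L₁` and
  -- `max (s - L₁) 0` add up to that of `s`.
  set c : ℝ → E := fun s => c₁ (min s L₁) + c₂ (max (s - L₁) 0) - q with hcdef
  have hc : LipschitzWith 1 c := LipschitzWith.of_dist_le_mul fun x y => by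
    have e1 := hc₁.dist_le_mul (min x L₁) (min y L₁)
    have e2 := hc₂.dist_le_mul (max (x - L₁) 0) (max (y - L₁) 0)
    have e3 : dist (c x) (c y) ≤ dist (c₁ (min x L₁)) (c₁ (min y L₁)) +
        dist (c₂ (max (x - L₁) 0)) (c₂ (max (y - L₁) 0)) := by
      simp only [hcdef, dist_sub_right]
      exact dist_add_add_le _ _ _ _
    refine e3.trans ((add_le_add e1 e2).trans ?_)
    simp only [NNReal.coe_one, one_mul, Real.dist_eq]
    rcases le_total x y with h | h <;> rcases le_total x L₁ with h' | h' <;>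
      rcases le_total y L₁ with h'' | h'' <;>
      simp [h', h'', abs_of_nonneg, abs_of_nonpos, h] <;> grind
  have hl : ∀ s ∈ Icc 0 L₁, c s = c₁ s := fun s hs => by
    simp [hcdef, min_eq_left hs.2, max_eq_right (sub_nonpos.2 hs.2), h20]
  have hr : ∀ s ∈ Icc L₁ (L₁ + L₂), c s = c₂ (s - L₁) := fun s hs => by
    simp [hcdef, min_eq_right hs.1, max_eq_left (sub_nonneg.2 hs.1), h11]
  have key := weightedDist_le (ρ := ρ) (L := L₁ + L₂) (add_nonneg hL₁ hL₂) hc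
  rw [hl 0 ⟨le_rfl, hL₁⟩, hr (L₁ + L₂) ⟨by linarith, le_rfl⟩, h10, add_sub_cancel_left, h21] at key
  refine key.trans ?_
  have hsplit : Icc 0 (L₁ + L₂) = Icc 0 L₁ ∪ Icc L₁ (L₁ + L₂) :=
    (Icc_union_Icc_eq_Icc hL₁ (by linarith)).symm
  have ha : ∫⁻ s in Icc 0 L₁, ρ (c s) = ∫⁻ s in Icc 0 L₁, ρ (c₁ s) :=
    setLIntegral_congr_fun measurableSet_Icc fun s hs => by simp only [hl s hs]
  have hb : ∫⁻ s in Icc L₁ (L₁ + L₂), ρ (c s) = ∫⁻ s in Icc 0 L₂, ρ (c₂ s) := by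
    rw [setLIntegral_congr_fun (g := fun s => ρ (c₂ (s - L₁))) measurableSet_Icc
      fun s hs => by simp only [hr s hs]]
    have h3 := (measurePreserving_sub_right volume L₁).setLIntegral_comp_preimage_emb
      (MeasurableEquiv.subRight L₁).measurableEmbedding (fun s => ρ (c₂ s)) (Icc 0 L₂)
    simpa [add_comm L₂] using h3
  calc ∫⁻ s in Icc 0 (L₁ + L₂), ρ (c s)
      ≤ (∫⁻ s in Icc 0 L₁, ρ (c s)) + ∫⁻ s in Icc L₁ (L₁ + L₂), ρ (c s) := by
        rw [hsplit]; exact lintegral_union_le _ _ _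
    _ ≤ (weightedDist ρ p q + ε / 2) + (weightedDist ρ q z + ε / 2) := by
        rw [ha, hb]; exact add_le_add hi₁.le hi₂.le
    _ = _ := by rw [add_add_add_comm, ENNReal.add_halves]

/-- A curve that is Lipschitz only on `[a, b]` becomes a competitor after a shift and a constant
extension beyond the end points. -/
theorem weightedDist_le_setLIntegral {c : ℝ → E} {a b : ℝ} (hab : a ≤ b)
    (hc : LipschitzOnWith 1 c (Icc a b)) :
    weightedDist ρ (c a) (c b) ≤ ∫⁻ s in Icc a b, ρ (c s) := by
  have h1 : LipschitzWith 1 fun s : ℝ => a + s := LipschitzWith.of_dist_le_mul fun x y => by simp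
  have h2 : LipschitzWith 1 fun s : ℝ => IccExtend hab ((Icc a b).domRestrict c) (a + s) := by
    have := (hc.to_restrict.comp (LipschitzWith.projIcc hab)).comp h1
    simpa [Function.comp_def, IccExtend] using this
  have key := weightedDist_le (ρ := ρ) (L := b - a) (sub_nonneg.2 hab) h2
  simp only [add_zero, add_sub_cancel, IccExtend_left, IccExtend_right, domRestrict_apply] at key
  refine key.trans_eq ?_
  have h3 := (measurePreserving_add_left volume a).setLIntegral_comp_preimage_emb
    (MeasurableEquiv.addLeft a).measurableEmbedding
    (fun s => ρ (IccExtend hab ((Icc a b).domRestrict c) s)) (Icc a b)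
  rw [preimage_const_add_Icc, sub_self] at h3
  rw [h3]
  refine setLIntegral_congr_fun measurableSet_Icc fun s hs => ?_
  simp [IccExtend_of_mem hab _ hs]

theorem weightedDist_triangle_right (ρ : E → ℝ≥0∞) (p q z : E) :
    weightedDist ρ p q ≤ weightedDist ρ p z + weightedDist ρ q z := by
  rw [weightedDist_comm ρ q z]; exact weightedDist_triangle _ _ _ _

theorem weightedDist_triangle_left (ρ : E → ℝ≥0∞) (p q z : E) :
    weightedDist ρ p q ≤ weightedDist ρ z p + weightedDist ρ z q := by
  rw [weightedDist_comm ρ z p]; exact weightedDist_triangle _ _ _ _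

theorem joinedIn_of_weightedDist_lt (h : weightedDist ρ p q < ε) :
    JoinedIn {z | weightedDist ρ p z < ε} p q := by
  obtain ⟨L, c, hL, hc, rfl, rfl, hi⟩ := weightedDist_lt_iff.1 h
  refine JoinedIn.ofLine (f := fun t : ℝ => c (t * L)) ?_ (by simp) (by simp) ?_
  · exact (hc.continuous.comp (by fun_prop)).continuousOn
  · rintro _ ⟨t, ht, rfl⟩
    have h0 : 0 ≤ t * L := mul_nonneg ht.1 hL
    have h1 : t * L ≤ L := mul_le_of_le_one_left hL ht.2
    exact ((weightedDist_le h0 hc).trans (lintegral_mono_set (Icc_subset_Icc_right h1))).trans_lt hi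

/-- Only the values of the weight near `p` matter for points that are close to `p`. -/
theorem weightedDist_lt_of_le_on (hle : ∀ z, weightedDist ρ' p z < ε → ρ z ≤ ρ' z)
    (h : weightedDist ρ' p q < ε) : weightedDist ρ p q < ε := by
  obtain ⟨L, c, hL, hc, rfl, rfl, hi⟩ := weightedDist_lt_iff.1 h
  refine (weightedDist_le hL hc).trans_lt (lt_of_le_of_lt ?_ hi)
  refine setLIntegral_mono' measurableSet_Icc fun s hs => hle _ ?_
  exact ((weightedDist_le hs.1 hc).trans
    (lintegral_mono_set (Icc_subset_Icc_right hs.2))).trans_lt hi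

theorem setLIntegral_Icc_mul {K L : ℝ} (hK : 0 < K) (f : ℝ → ℝ≥0∞) :
    ∫⁻ s in Icc 0 (K * L), f s = ENNReal.ofReal K * ∫⁻ s in Icc 0 L, f (K * s) := by
  have hemb := (MeasurableEquiv.mulLeft₀ K hK.ne').measurableEmbedding
  have h := Real.smul_map_volume_mul_left hK.ne'
  conv_lhs => rw [← h]
  rw [Measure.restrict_smul, lintegral_smul_measure, abs_of_pos hK, smul_eq_mul]
  congr 1
  have h2 := hemb.restrict_map volume (Icc 0 (K * L))
  simp only [MeasurableEquiv.coe_mulLeft₀] at h2 hemb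
  rw [h2, hemb.lintegral_map]
  congr 2
  ext s
  simp only [mem_preimage, mem_Icc]
  constructor
  · rintro ⟨h1, h2⟩
    exact ⟨nonneg_of_mul_nonneg_right h1 hK, le_of_mul_le_mul_left h2 hK⟩
  · rintro ⟨h1, h2⟩
    exact ⟨by positivity, by gcongr⟩

/-- Transport of the weighted distance along a map that scales distances by at most `r`. -/
theorem weightedDist_comp_le {F : Type*} [NormedAddCommGroup F] {φ : F → E} {r : ℝ} (hr : 0 < r)
    (hφ : ∀ x y, dist (φ x) (φ y) ≤ r * dist x y) (x y : F) :
    weightedDist ρ (φ x) (φ y) ≤ weightedDist (fun w => ENNReal.ofReal r * ρ (φ w)) x y := by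
  refine le_weightedDist_iff.2 fun L c hL hc h0 h1 => ?_
  have hc' : LipschitzWith 1 fun s : ℝ => φ (c (r⁻¹ * s)) := by
    refine LipschitzWith.of_dist_le_mul fun a b => ?_
    have e1 := hφ (c (r⁻¹ * a)) (c (r⁻¹ * b))
    have e2 := hc.dist_le_mul (r⁻¹ * a) (r⁻¹ * b)
    have e3 : dist (r⁻¹ * a) (r⁻¹ * b) = r⁻¹ * dist a b := by
      rw [Real.dist_eq, ← mul_sub, abs_mul, abs_of_pos (inv_pos.2 hr), Real.dist_eq]
    rw [e3] at e2
    simp only [NNReal.coe_one, one_mul] at e2 ⊢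
    calc _ ≤ r * (r⁻¹ * dist a b) := e1.trans (by gcongr)
      _ = dist a b := by field_simp
  have key := weightedDist_le (ρ := ρ) (L := r * L) (by positivity) hc'
  rw [setLIntegral_Icc_mul hr] at key
  simp only [mul_zero, inv_mul_cancel_left₀ hr.ne', h0, h1] at key
  exact key.trans (lintegral_const_mul_le _ _)

/-- The weighted distance is at most the `ρ`-length of the segment. -/
theorem weightedDist_segment_le [NormedSpace ℝ E] {r : ℝ} (hr : 0 < r) (h : ‖q - p‖ ≤ r) :
    weightedDist ρ p q ≤ ENNReal.ofReal r * ∫⁻ t in Icc (0 : ℝ) 1, ρ (p + t • (q - p)) := by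
  have hφ : ∀ a b : ℝ, dist (p + a • (q - p)) (p + b • (q - p)) ≤ r * dist a b := fun a b => by
    rw [dist_add_left, dist_eq_norm, ← sub_smul, norm_smul, mul_comm, dist_eq_norm a b]
    gcongr
  have h1 := weightedDist_comp_le (ρ := ρ) (φ := fun t : ℝ => p + t • (q - p)) hr hφ 0 1
  simp only [zero_smul, add_zero, one_smul, add_sub_cancel] at h1
  refine h1.trans ?_
  have := weightedDist_le (ρ := fun w : ℝ => ENNReal.ofReal r * ρ (p + w • (q - p)))
    (L := 1) (c := id) zero_le_one LipschitzWith.id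
  simp only [id] at this
  refine this.trans_eq ?_
  rw [lintegral_const_mul' _ _ ENNReal.ofReal_ne_top]

theorem weightedDist_const_mul {a : ℝ≥0∞} (ha : a ≠ ∞) :
    a * weightedDist ρ p q ≤ weightedDist (fun z => a * ρ z) p q := by
  refine le_weightedDist_iff.2 fun L c hL hc h0 h1 => ?_
  subst h0 h1
  rw [lintegral_const_mul' _ _ ha]
  gcongr
  exact weightedDist_le hL hc

end WeightedDist

end

/-! ### Arc length, and the modulus as a capacity for the weighted distance. -/

section

section ArcLength

variable {E : Type*} [NormedAddCommGroup E] {g : I → E}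

theorem variationOnFromTo_eq (hg : eVariationOn g univ ≠ ∞) {s t : I} (hst : s ≤ t) :
    variationOnFromTo g univ 0 t - variationOnFromTo g univ 0 s =
      (eVariationOn g (Icc s t)).toReal := by
  have h : LocallyBoundedVariationOn g univ := BoundedVariationOn.locallyBoundedVariationOn hg
  rw [← variationOnFromTo.add h (mem_univ 0) (mem_univ s) (mem_univ t), add_sub_cancel_left,
    variationOnFromTo.eq_of_le g univ hst, univ_inter]

theorem variationOnFromTo_zero_one :
    variationOnFromTo g univ 0 1 = (eVariationOn g univ).toReal := by
  rw [variationOnFromTo.eq_of_le g univ zero_le_one, univ_inter]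
  congr 2
  ext t
  simp [unitInterval.le_one']

theorem monotone_variationOnFromTo (hg : eVariationOn g univ ≠ ∞) :
    Monotone (variationOnFromTo g univ 0) := fun s t hst => by
  have := variationOnFromTo_eq hg hst
  linarith [ENNReal.toReal_nonneg (a := eVariationOn g (Icc s t))]

theorem continuous_variationOnFromTo (hgc : Continuous g) (hg : eVariationOn g univ ≠ ∞) :
    Continuous (variationOnFromTo g univ 0) := by
  have hbv : BoundedVariationOn g univ := hg
  refine continuous_iff_continuousAt.2 fun x => ?_
  have hr : ContinuousWithinAt (variationOnFromTo g univ 0) (Ici x) x :=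
    hbv.continuousWithinAt_variationOnFromTo_Ici hgc.continuousWithinAt
  have hl : ContinuousWithinAt (variationOnFromTo g univ 0) (Iic x) x := by
    have h1 := hbv.tendsto_eVariationOn_Icc_zero_left (x := x) hgc.continuousWithinAt
    have h2 : Tendsto (fun y => variationOnFromTo g univ 0 x -
        (eVariationOn g (univ ∩ Icc y x)).toReal) (𝓝[Iic x] x)
        (𝓝 (variationOnFromTo g univ 0 x - (0 : ℝ≥0∞).toReal)) := by
      refine tendsto_const_nhds.sub ?_
      exact (ENNReal.tendsto_toReal ENNReal.zero_ne_top).comp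
        (h1.mono_left (nhdsWithin_mono _ (subset_univ _)))
    simp only [ENNReal.toReal_zero, sub_zero] at h2
    refine h2.congr' ?_
    filter_upwards [self_mem_nhdsWithin] with y hy
    rw [univ_inter, ← variationOnFromTo_eq hg hy]
    ring
  exact continuousAt_iff_continuous_left_right.2 ⟨hl, hr⟩

theorem image_variationOnFromTo (hgc : Continuous g) (hg : eVariationOn g univ ≠ ∞) :
    variationOnFromTo g univ 0 '' univ = Icc 0 (eVariationOn g univ).toReal := by
  have h0 : variationOnFromTo g univ 0 0 = 0 := variationOnFromTo.self _ _ _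
  have hm := monotone_variationOnFromTo hg
  apply Subset.antisymm
  · rintro _ ⟨t, -, rfl⟩
    exact ⟨h0 ▸ hm t.2.1, variationOnFromTo_zero_one (g := g) ▸ hm t.2.2⟩
  · intro y hy
    rw [← variationOnFromTo_zero_one, ← h0] at hy
    obtain ⟨t, -, ht⟩ := intermediate_value_Icc (zero_le_one (α := I))
      (continuous_variationOnFromTo hgc hg).continuousOn hy
    exact ⟨t, mem_univ _, ht⟩

theorem lipschitzOnWith_naturalParameterization (hgc : Continuous g)
    (hg : eVariationOn g univ ≠ ∞) :
    LipschitzOnWith 1 (naturalParameterization g univ 0)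
      (Icc 0 (eVariationOn g univ).toReal) := by
  have h : LocallyBoundedVariationOn g univ := BoundedVariationOn.locallyBoundedVariationOn hg
  have hu := has_unit_speed_naturalParameterization g h (mem_univ 0)
  rw [image_variationOnFromTo hgc hg] at hu
  have key : ∀ x ∈ Icc 0 (eVariationOn g univ).toReal, ∀ y ∈ Icc 0 (eVariationOn g univ).toReal,
      x ≤ y → edist (naturalParameterization g univ 0 x) (naturalParameterization g univ 0 y) ≤
        edist x y := fun x hx y hy hxy => by
    have e := hu hx hy
    rw [edist_dist x y, Real.dist_eq, abs_sub_comm, abs_of_nonneg (sub_nonneg.2 hxy)]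
    simp only [NNReal.coe_one, one_mul] at e
    rw [← e]
    exact eVariationOn.edist_le _ ⟨hx, le_rfl, hxy⟩ ⟨hy, hxy, le_rfl⟩
  intro x hx y hy
  rw [ENNReal.coe_one, one_mul]
  rcases le_total x y with hxy | hxy
  · exact key x hx y hy hxy
  · rw [edist_comm, edist_comm x]; exact key y hy x hx hxy

theorem naturalParameterization_variationOnFromTo (hg : eVariationOn g univ ≠ ∞) (t : I) :
    naturalParameterization g univ 0 (variationOnFromTo g univ 0 t) = g t :=
  edist_eq_zero.1 <| edist_naturalParameterization_eq_zero
    (BoundedVariationOn.locallyBoundedVariationOn hg) (mem_univ 0) (mem_univ t)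

end ArcLength

variable {n : ℕ} {ρ : EuclideanSpace ℝ (Fin n) → ℝ≥0∞} {g : I → EuclideanSpace ℝ (Fin n)}

/-- The arc-length parametrization is 1-Lipschitz, so its restriction to the piece between the two
parameters competes in the infimum. -/
theorem weightedDist_le_lineIntegral (hgc : Continuous g) (hg : eVariationOn g univ ≠ ∞)
    (s t : I) : weightedDist ρ (g s) (g t) ≤ lineIntegral ρ g := by
  wlog hst : s ≤ t generalizing s t
  · rw [weightedDist_comm]; exact this t s (le_of_not_ge hst)
  have hm := monotone_variationOnFromTo hg
  have hsub : Icc (variationOnFromTo g univ 0 s) (variationOnFromTo g univ 0 t) ⊆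
      Icc 0 (eVariationOn g univ).toReal := by
    have h1 := (image_variationOnFromTo hgc hg).subset ⟨s, mem_univ _, rfl⟩
    have h2 := (image_variationOnFromTo hgc hg).subset ⟨t, mem_univ _, rfl⟩
    exact Icc_subset_Icc h1.1 h2.2
  have := weightedDist_le_setLIntegral (ρ := ρ) (hm hst)
    ((lipschitzOnWith_naturalParameterization hgc hg).mono hsub)
  rw [naturalParameterization_variationOnFromTo hg, naturalParameterization_variationOnFromTo hg]
    at this
  exact this.trans (lintegral_mono_set hsub)

theorem eVariationOn_comp_mul_le {E : Type*} [NormedAddCommGroup E] {c : ℝ → E}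
    (hc : LipschitzWith 1 c) {L : ℝ} (hL : 0 ≤ L) (s t : I) (hst : s ≤ t) :
    eVariationOn (fun t : I => c (t * L)) (Icc s t) ≤ ENNReal.ofReal ((t - s) * L) := by
  have h1 : eVariationOn (c ∘ fun t : I => (t * L : ℝ)) (Icc s t) ≤
      (1 : ℝ≥0) * eVariationOn (fun t : I => (t * L : ℝ)) (Icc s t) :=
    (hc.lipschitzOnWith (s := univ)).comp_eVariationOn_le (mapsTo_univ _ _)
  have hmono : MonotoneOn (fun t : I => (t * L : ℝ)) (Icc s t) := fun a _ b _ hab =>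
    mul_le_mul_of_nonneg_right hab hL
  have h2 := (hmono.eVariationOn_eq (left_mem_Icc.2 hst) (right_mem_Icc.2 hst)).le
  rw [inter_self] at h2
  refine h1.trans ?_
  rw [ENNReal.coe_one, one_mul, sub_mul]
  exact h2

theorem eVariationOn_univ_comp_mul_le {E : Type*} [NormedAddCommGroup E] {c : ℝ → E}
    (hc : LipschitzWith 1 c) {L : ℝ} (hL : 0 ≤ L) :
    eVariationOn (fun t : I => c (t * L)) univ ≤ ENNReal.ofReal L := by
  have := eVariationOn_comp_mul_le hc hL 0 1 zero_le_one
  have h : (univ : Set I) = Icc 0 1 := by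
    ext t; simp [unitInterval.le_one']
  rw [h]
  simpa using this

/-- A 1-Lipschitz curve has speed at most 1, so its arc length `v` is a 1-Lipschitz function of the
parameter; moreover `c = N ∘ v` with `N` the arc-length parametrization. Changing variables along
`v` can only lose length. `N` is extended by constants to make it continuous on the line, hence the
integrand measurable. -/
theorem lineIntegral_comp_mul_le (hρ : Measurable ρ) {c : ℝ → EuclideanSpace ℝ (Fin n)}
    (hc : LipschitzWith 1 c) {L : ℝ} (hL : 0 ≤ L) :
    lineIntegral ρ (fun t : I => c (t * L)) ≤ ∫⁻ s in Icc 0 L, ρ (c s) := by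
  set g : I → EuclideanSpace ℝ (Fin n) := fun t => c (t * L) with hgdef
  have hvar := eVariationOn_univ_comp_mul_le hc hL
  have hg : eVariationOn g univ ≠ ∞ := (hvar.trans_lt ENNReal.ofReal_lt_top).ne
  have hgc : Continuous g := hc.continuous.comp (by fun_prop)
  rcases hL.eq_or_lt with rfl | hLpos
  · have : eVariationOn g univ = 0 := by simpa [hgdef] using hvar
    simp [lineIntegral, this]
  set v : ℝ → ℝ := fun s => variationOnFromTo g univ 0 (projIcc 0 1 zero_le_one (s / L))
  have hv : LipschitzWith 1 v := by
    have key : ∀ x y, x ≤ y → dist (v x) (v y) ≤ dist x y := fun x y hxy => by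
      have hp : projIcc (0 : ℝ) 1 zero_le_one (x / L) ≤ projIcc 0 1 zero_le_one (y / L) :=
        monotone_projIcc _ (by gcongr)
      have e := variationOnFromTo_eq hg hp
      rw [dist_comm, Real.dist_eq, e, abs_of_nonneg ENNReal.toReal_nonneg]
      have e2 := eVariationOn_comp_mul_le hc hL _ _ hp
      refine ENNReal.toReal_le_of_le_ofReal dist_nonneg (e2.trans (ENNReal.ofReal_le_ofReal ?_))
      have e3 := (LipschitzWith.projIcc (zero_le_one (α := ℝ))).dist_le_mul (y / L) (x / L)
      rw [Subtype.dist_eq, Real.dist_eq, Real.dist_eq, ← sub_div, abs_div, abs_of_pos hLpos] at e3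
      have e4 := (le_abs_self _).trans e3
      rw [dist_comm, Real.dist_eq]
      calc _ ≤ (((1 : ℝ≥0) : ℝ) * (|y - x| / L)) * L := by gcongr
        _ = |y - x| := by rw [NNReal.coe_one]; field_simp
    refine LipschitzWith.of_dist_le_mul fun x y => ?_
    rw [NNReal.coe_one, one_mul]
    rcases le_total x y with h | h
    · exact key x y h
    · rw [dist_comm, dist_comm x]; exact key y x h
  have hV0 : 0 ≤ (eVariationOn g univ).toReal := ENNReal.toReal_nonneg
  set N : ℝ → EuclideanSpace ℝ (Fin n) := IccExtend hV0
    ((Icc 0 (eVariationOn g univ).toReal).domRestrict (naturalParameterization g univ 0))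
  have hN : Continuous N :=
    (lipschitzOnWith_naturalParameterization hgc hg).continuousOn.domRestrict.Icc_extend'
  have h := setLIntegral_uIcc_le hv hL (f := fun s => ρ (N s)) (hρ.comp hN.measurable)
  have hv0 : v 0 = 0 := by
    simp only [v, zero_div, projIcc_left]
    exact variationOnFromTo.self _ _ _
  have hvL : v L = (eVariationOn g univ).toReal := by
    simp only [v, div_self hLpos.ne', projIcc_right]
    exact variationOnFromTo_zero_one
  rw [hv0, hvL, uIcc_of_le hV0] at h
  calc lineIntegral ρ g = ∫⁻ s in Icc 0 (eVariationOn g univ).toReal, ρ (N s) := by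
        refine setLIntegral_congr_fun measurableSet_Icc fun s hs => ?_
        simp [N, IccExtend_of_mem hV0 _ hs]
    _ ≤ _ := h
    _ = _ := by
        refine setLIntegral_congr_fun measurableSet_Icc fun s hs => ?_
        have hsL : s / L ∈ Icc (0 : ℝ) 1 := ⟨by have := hs.1; positivity,
          (div_le_one hLpos).2 hs.2⟩
        have hmem := (image_variationOnFromTo hgc hg).subset
          ⟨projIcc 0 1 zero_le_one (s / L), mem_univ _, rfl⟩
        have : N (v s) = c s := by
          simp only [N, v, IccExtend_of_mem hV0 _ hmem, domRestrict_apply]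
          rw [naturalParameterization_variationOnFromTo hg, hgdef]
          simp [projIcc_of_mem zero_le_one hsL, div_mul_cancel₀ _ hLpos.ne']
        simp [this]

/-- Every curve from `A` to `C` has `ρ`-length at least `1`. -/
def Separates (ρ : EuclideanSpace ℝ (Fin n) → ℝ≥0∞) (A C : Set (EuclideanSpace ℝ (Fin n))) :
    Prop := ∀ p ∈ A, ∀ q ∈ C, 1 ≤ weightedDist ρ p q

/-- The modulus of the family of all curves from `A` to `C`. -/
def capacity (A C : Set (EuclideanSpace ℝ (Fin n))) : ℝ≥0∞ :=
  ⨅ (ρ : EuclideanSpace ℝ (Fin n) → ℝ≥0∞) (_ : Measurable ρ ∧ Separates ρ A C), ∫⁻ x, ρ x ^ n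

/-- The Euclidean part of a subset of the Möbius space. -/
abbrev finitePart (A : Set (MobiusSpace n)) : Set (EuclideanSpace ℝ (Fin n)) :=
  ((↑) : EuclideanSpace ℝ (Fin n) → MobiusSpace n) ⁻¹' A

theorem continuous_of_coe_eq {γ : C(I, MobiusSpace n)} (h : ∀ t, γ t = (g t : MobiusSpace n)) :
    Continuous g := by
  rw [OnePoint.isOpenEmbedding_coe.isInducing.continuous_iff]
  exact γ.continuous.congr h

theorem exists_first_exit {G : Set (MobiusSpace n)} (hG : IsOpen G)
    {c : ℝ → EuclideanSpace ℝ (Fin n)} (hc : Continuous c) {L : ℝ} (hL : 0 ≤ L)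
    (h0 : (c 0 : MobiusSpace n) ∈ G) (h1 : (c L : MobiusSpace n) ∉ G) :
    ∃ s ∈ Ioc 0 L, (c s : MobiusSpace n) ∈ frontier G ∧ ∀ t ∈ Ico 0 s, (c t : MobiusSpace n) ∈ G := by
  have hcc : Continuous fun s => (c s : MobiusSpace n) := OnePoint.continuous_coe.comp hc
  set S : Set ℝ := Icc 0 L ∩ {s | (c s : MobiusSpace n) ∉ G}
  have hS : IsCompact S := isCompact_Icc.inter_right (hG.isClosed_compl.preimage hcc)
  have hmem := hS.sInf_mem ⟨L, ⟨hL, le_rfl⟩, h1⟩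
  set s := sInf S
  have hlt : ∀ t ∈ Ico 0 s, (c t : MobiusSpace n) ∈ G := fun t ht => by
    by_contra h
    exact absurd (csInf_le hS.bddBelow ⟨⟨ht.1, ht.2.le.trans hmem.1.2⟩, h⟩) (not_le.2 ht.2)
  have hpos : 0 < s := lt_of_le_of_ne hmem.1.1 fun h => hmem.2 (h ▸ h0)
  refine ⟨s, ⟨hpos, hmem.1.2⟩, ⟨?_, by rw [hG.interior_eq]; exact hmem.2⟩, hlt⟩
  have h2 : s ∈ closure (Ico 0 s) := by
    rw [closure_Ico hpos.ne]; exact right_mem_Icc.2 hpos.le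
  exact closure_mono (image_subset_iff.2 hlt) (image_closure_subset_closure_image hcc ⟨s, h2, rfl⟩)

/-- A curve from `A` to any point outside `G` can be stopped at its first exit, which lies on the
boundary; so it makes no difference which target between `frontier G` and `Gᶜ` is used. This covers
both the family in the metric (target `frontier G`) and the one in the continuum criterion (target
`Gᶜ`). -/
theorem admissible_curvesJoining_iff {G A B : Set (MobiusSpace n)} (hG : IsOpen G) (hA : A ⊆ G)
    (hB : frontier G ⊆ B) (hB' : B ⊆ Gᶜ) :
    Admissible (curvesJoining A B G) ρ ↔
      Measurable ρ ∧ Separates ρ (finitePart A) (finitePart Gᶜ) := by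
  refine and_congr_right fun hρ => ⟨fun h p hp q hq => ?_, fun h γ hγ g hg hvar => ?_⟩
  · refine le_weightedDist_iff.2 fun L c hL hc h0 h1 => ?_
    subst h0 h1
    obtain ⟨s, hs, hfr, hlt⟩ := exists_first_exit hG hc.continuous hL (hA hp) hq
    have hcont : Continuous fun t : I => c (t * s) := hc.continuous.comp (by fun_prop)
    set γ : C(I, MobiusSpace n) := ⟨fun t => (c (t * s) : MobiusSpace n),
      OnePoint.continuous_coe.comp hcont⟩
    have hγ : γ ∈ curvesJoining A B G := by
      refine ⟨by simpa [γ] using hp, by simpa [γ] using hB hfr, fun t ht => hlt _ ⟨?_, ?_⟩⟩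
      · have := t.2.1; have := hs.1; positivity
      · have h1 : (t : ℝ) < 1 := ht.2
        have := hs.1
        nlinarith
    refine (h γ hγ (fun t : I => c (t * s)) (fun t => rfl) ?_).trans ?_
    · exact ((eVariationOn_univ_comp_mul_le hc hs.1.le).trans_lt ENNReal.ofReal_lt_top).ne
    · exact (lineIntegral_comp_mul_le hρ hc hs.1.le).trans
        (lintegral_mono_set (Icc_subset_Icc_right hs.2))
  · refine le_trans ?_ (weightedDist_le_lineIntegral (continuous_of_coe_eq hg) hvar 0 1)
    refine h _ ?_ _ ?_
    · rw [mem_preimage, ← hg]; exact hγ.1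
    · rw [mem_preimage, ← hg]; exact hB' hγ.2.1

theorem modulus_curvesJoining {G A B : Set (MobiusSpace n)} (hG : IsOpen G) (hA : A ⊆ G)
    (hB : frontier G ⊆ B) (hB' : B ⊆ Gᶜ) :
    modulus (curvesJoining A B G) = capacity (finitePart A) (finitePart Gᶜ) := by
  simp only [modulus, capacity, admissible_curvesJoining_iff hG hA hB hB']

theorem frontier_subset_compl {X : Type*} [TopologicalSpace X] {G : Set X} (hG : IsOpen G) :
    frontier G ⊆ Gᶜ := fun x hx h => hx.2 (by rwa [hG.interior_eq])

section Capacity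

variable {A A' C : Set (EuclideanSpace ℝ (Fin n))}

theorem capacity_le (hρ : Measurable ρ) (h : Separates ρ A C) : capacity A C ≤ ∫⁻ x, ρ x ^ n :=
  iInf₂_le_of_le ρ ⟨hρ, h⟩ le_rfl

theorem exists_of_capacity_lt {a : ℝ≥0∞} (h : capacity A C < a) :
    ∃ ρ : EuclideanSpace ℝ (Fin n) → ℝ≥0∞,
      Measurable ρ ∧ Separates ρ A C ∧ ∫⁻ x, ρ x ^ n < a := by
  simpa only [capacity, iInf_lt_iff, exists_prop, and_assoc] using h

theorem capacity_mono (h : A ⊆ A') : capacity A C ≤ capacity A' C :=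
  le_iInf₂ fun _ hρ => capacity_le hρ.1 fun p hp => hρ.2 p (h hp)

theorem lintegral_max_pow_le {f g : EuclideanSpace ℝ (Fin n) → ℝ≥0∞} (hf : Measurable f) :
    ∫⁻ x, (max (f x) (g x)) ^ n ≤ (∫⁻ x, f x ^ n) + ∫⁻ x, g x ^ n := by
  rw [← lintegral_add_left (hf.pow_const n)]
  refine lintegral_mono fun x => ?_
  rcases le_total (f x) (g x) with h | h
  · rw [max_eq_right h]; exact le_add_self
  · rw [max_eq_left h]; exact le_self_add

/-- The maximum of two admissible densities is admissible for the union, with energy at most the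
sum. This is the source of the triangle inequality for the modulus metric. -/
theorem capacity_union_le : capacity (A ∪ A') C ≤ capacity A C + capacity A' C := by
  refine ENNReal.le_of_forall_pos_le_add fun ε hε hfin => ?_
  have hε2 : (ε : ℝ≥0∞) / 2 ≠ 0 := by simpa using hε.ne'
  obtain ⟨h1, h2⟩ := ENNReal.add_lt_top.1 hfin
  obtain ⟨ρ₁, hm₁, hs₁, hi₁⟩ := exists_of_capacity_lt (ENNReal.lt_add_right h1.ne hε2)
  obtain ⟨ρ₂, hm₂, hs₂, hi₂⟩ := exists_of_capacity_lt (ENNReal.lt_add_right h2.ne hε2)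
  refine (capacity_le (hm₁.max hm₂) ?_).trans ((lintegral_max_pow_le hm₁).trans ?_)
  · rintro p (hp | hp) q hq
    · exact (hs₁ p hp q hq).trans (weightedDist_mono (fun x => le_max_left _ _) _ _)
    · exact (hs₂ p hp q hq).trans (weightedDist_mono (fun x => le_max_right _ _) _ _)
  · refine (add_le_add hi₁.le hi₂.le).trans_eq ?_
    rw [add_add_add_comm, ENNReal.add_halves]

/-- A weight at distance at least `1 / 2` becomes admissible after doubling. -/
theorem separates_two_mul (h : ∀ p ∈ A, ∀ q ∈ C, 1 / 2 ≤ weightedDist ρ p q) :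
    Separates (fun z => 2 * ρ z) A C := fun p hp q hq => by
  refine le_trans ?_ (weightedDist_const_mul ENNReal.ofNat_ne_top)
  calc (1 : ℝ≥0∞) = 2 * (1 / 2) := by rw [one_div, ENNReal.mul_inv_cancel] <;> simp
    _ ≤ _ := by gcongr; exact h p hp q hq

/-- A point that is close to `A` is far from `C`. -/
theorem half_le_weightedDist (h : Separates ρ A C) {p z q : EuclideanSpace ℝ (Fin n)} (hp : p ∈ A)
    (hz : weightedDist ρ p z ≤ 1 / 2) (hq : q ∈ C) : 1 / 2 ≤ weightedDist ρ z q := by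
  by_contra! hlt
  have h1 := (h p hp q hq).trans (weightedDist_triangle ρ p z q)
  have h2 : weightedDist ρ p z + weightedDist ρ z q < 1 / 2 + 1 / 2 :=
    ENNReal.add_lt_add_of_le_of_lt (hz.trans_lt (by simp)).ne hz hlt
  rw [ENNReal.add_halves] at h2
  exact absurd h1 (not_le.2 h2)

theorem notMem_of_half_le {z : EuclideanSpace ℝ (Fin n)}
    (h : ∀ q ∈ C, 1 / 2 ≤ weightedDist ρ z q) : z ∉ C := fun hz => by
  simpa using h z hz

end Capacity

end

/-! ### The maximum norm, and cheap densities on thick rings. -/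

section

variable {n : ℕ}

/-- The maximum norm on Euclidean space. -/
def boxNorm (z : EuclideanSpace ℝ (Fin n)) : ℝ := ‖WithLp.ofLp z‖

theorem boxNorm_nonneg (z : EuclideanSpace ℝ (Fin n)) : 0 ≤ boxNorm z := norm_nonneg _

theorem boxNorm_add_le (z w : EuclideanSpace ℝ (Fin n)) :
    boxNorm (z + w) ≤ boxNorm z + boxNorm w := norm_add_le _ _

theorem boxNorm_smul (r : ℝ) (z : EuclideanSpace ℝ (Fin n)) :
    boxNorm (r • z) = |r| * boxNorm z := by
  simp [boxNorm, norm_smul]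

theorem abs_apply_le_boxNorm (z : EuclideanSpace ℝ (Fin n)) (i : Fin n) : |z i| ≤ boxNorm z :=
  norm_le_pi_norm (WithLp.ofLp z) i

theorem boxNorm_le_iff {z : EuclideanSpace ℝ (Fin n)} {r : ℝ} (hr : 0 ≤ r) :
    boxNorm z ≤ r ↔ ∀ i, |z i| ≤ r := by
  simpa [boxNorm] using pi_norm_le_iff_of_nonneg (x := WithLp.ofLp z) hr

theorem boxNorm_le_norm (z : EuclideanSpace ℝ (Fin n)) : boxNorm z ≤ ‖z‖ :=
  (boxNorm_le_iff (norm_nonneg _)).2 fun i => PiLp.norm_apply_le z i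

theorem norm_le_mul_boxNorm (z : EuclideanSpace ℝ (Fin n)) : ‖z‖ ≤ n * boxNorm z := by
  have h := boxNorm_nonneg z
  rw [EuclideanSpace.norm_eq]
  refine Real.sqrt_le_iff.2 ⟨by positivity, ?_⟩
  calc ∑ i, ‖z i‖ ^ 2 ≤ ∑ _i : Fin n, boxNorm z ^ 2 := by
        gcongr with i
        exact abs_apply_le_boxNorm z i
    _ = n * boxNorm z ^ 2 := by simp
    _ ≤ (n * boxNorm z) ^ 2 := by
        rw [mul_pow]
        have : (n : ℝ) ≤ (n : ℝ) ^ 2 := by exact_mod_cast Nat.le_self_pow two_ne_zero n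
        gcongr

theorem exists_abs_apply_eq_boxNorm (hn : 0 < n) (z : EuclideanSpace ℝ (Fin n)) :
    ∃ i, |z i| = boxNorm z := by
  have : Nonempty (Fin n) := ⟨⟨0, hn⟩⟩
  obtain ⟨i, hi⟩ := Finite.exists_max fun i => |z i|
  exact ⟨i, le_antisymm (abs_apply_le_boxNorm z i) ((boxNorm_le_iff (abs_nonneg _)).2 hi)⟩

theorem lipschitzWith_boxNorm_sub (c : EuclideanSpace ℝ (Fin n)) :
    LipschitzWith 1 fun z : EuclideanSpace ℝ (Fin n) => boxNorm (z - c) := by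
  refine LipschitzWith.of_dist_le_mul fun x y => ?_
  rw [NNReal.coe_one, one_mul, Real.dist_eq, dist_eq_norm]
  refine le_trans ?_ (boxNorm_le_norm (x - y))
  have := abs_norm_sub_norm_le (WithLp.ofLp (x - c)) (WithLp.ofLp (y - c))
  simpa [boxNorm] using this

theorem continuous_boxNorm_sub (c : EuclideanSpace ℝ (Fin n)) :
    Continuous fun z : EuclideanSpace ℝ (Fin n) => boxNorm (z - c) :=
  (lipschitzWith_boxNorm_sub c).continuous

theorem volume_boxNorm_sub_le (c : EuclideanSpace ℝ (Fin n)) {r : ℝ} (hr : 0 ≤ r) :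
    volume {z : EuclideanSpace ℝ (Fin n) | boxNorm (z - c) ≤ r} = ENNReal.ofReal (2 * r) ^ n := by
  have h : {z : EuclideanSpace ℝ (Fin n) | boxNorm (z - c) ≤ r} =
      WithLp.ofLp ⁻¹' Metric.closedBall (WithLp.ofLp c) r := by
    ext z; simp [boxNorm, dist_eq_norm]
  rw [h, (PiLp.volume_preserving_ofLp (Fin n)).measure_preimage
    measurableSet_closedBall.nullMeasurableSet, Real.volume_pi_closedBall _ hr,
    ENNReal.ofReal_pow (by positivity)]
  simp

/-- The radial profile of a weight that makes it long to cross `N` dyadic rings. -/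
def ringProfile (N : ℕ) (r : ℝ) (v : ℝ) : ℝ≥0∞ :=
  ∑ k ∈ Finset.range N, (Ioc (2 ^ k * r) (2 ^ (k + 1) * r)).indicator
    (fun _ => ENNReal.ofReal ((N * (2 ^ k * r))⁻¹)) v

theorem measurable_ringProfile (N : ℕ) (r : ℝ) : Measurable (ringProfile N r) :=
  Finset.measurable_sum _ fun _ _ => measurable_const.indicator measurableSet_Ioc

/-- Each dyadic ring has width `2 ^ k * r` and density `1 / (N * 2 ^ k * r)`, so it contributes
exactly `1 / N`. -/
theorem one_le_lintegral_ringProfile {N : ℕ} (hN : N ≠ 0) {r a b : ℝ} (hr : 0 < r) (ha : a ≤ r)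
    (hb : 2 ^ N * r ≤ b) : 1 ≤ ∫⁻ v in uIcc a b, ringProfile N r v := by
  have hN' : (0 : ℝ) < N := by positivity
  have hsub : ∀ k ∈ Finset.range N, Ioc (2 ^ k * r) (2 ^ (k + 1) * r) ⊆ uIcc a b := fun k hk => by
    have h1 : (1 : ℝ) ≤ 2 ^ k := one_le_pow₀ one_le_two
    have h2 : (2 : ℝ) ^ (k + 1) ≤ 2 ^ N :=
      pow_le_pow_right₀ one_le_two (Finset.mem_range.1 hk)
    refine subset_trans ?_ Icc_subset_uIcc
    refine Ioc_subset_Icc_self.trans (Icc_subset_Icc ?_ ?_)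
    · nlinarith
    · nlinarith
  simp only [ringProfile]
  rw [lintegral_finsetSum _ fun _ _ => measurable_const.indicator measurableSet_Ioc]
  have : ∀ k ∈ Finset.range N, ∫⁻ v in uIcc a b, (Ioc (2 ^ k * r) (2 ^ (k + 1) * r)).indicator
      (fun _ => ENNReal.ofReal ((N * (2 ^ k * r))⁻¹)) v = ENNReal.ofReal ((N : ℝ)⁻¹) := by
    intro k hk
    rw [lintegral_indicator measurableSet_Ioc, Measure.restrict_restrict measurableSet_Ioc,
      inter_eq_left.2 (hsub k hk), setLIntegral_const, Real.volume_Ioc, ← ENNReal.ofReal_mul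
      (by positivity)]
    congr 1
    field_simp
    ring
  rw [Finset.sum_congr rfl this, Finset.sum_const, Finset.card_range, nsmul_eq_mul,
    ENNReal.ofReal_inv_of_pos hN', ENNReal.ofReal_natCast,
    ENNReal.mul_inv_cancel (by simpa using hN) (by simp)]

theorem ringProfile_pow_le (hn : n ≠ 0) (N : ℕ) {r : ℝ} (hr : 0 < r) (v : ℝ) :
    ringProfile N r v ^ n ≤ ∑ k ∈ Finset.range N, (Ioc (2 ^ k * r) (2 ^ (k + 1) * r)).indicator
      (fun _ => ENNReal.ofReal ((N * (2 ^ k * r))⁻¹) ^ n) v := by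
  by_cases h : ∃ k ∈ Finset.range N, v ∈ Ioc (2 ^ k * r) (2 ^ (k + 1) * r)
  · obtain ⟨k, hk, hv⟩ := h
    have hmono : Monotone fun k : ℕ => 2 ^ k * r := fun a b hab => by
      have : (2 : ℝ) ^ a ≤ 2 ^ b := pow_le_pow_right₀ one_le_two hab
      exact mul_le_mul_of_nonneg_right this hr.le
    have hdisj := hmono.pairwise_disjoint_on_Ioc_succ
    have h1 : ringProfile N r v = ENNReal.ofReal ((N * (2 ^ k * r))⁻¹) := by
      rw [ringProfile, Finset.sum_eq_single k, indicator_of_mem hv]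
      · intro j _ hjk
        refine indicator_of_notMem (fun hj => ?_) _
        exact disjoint_left.1 (hdisj hjk) (by simpa using hj) (by simpa using hv)
      · exact fun h => absurd hk h
    rw [h1]
    refine le_trans ?_ (Finset.single_le_sum (fun _ _ => zero_le) hk)
    rw [indicator_of_mem hv]
  · push Not at h
    have h1 : ringProfile N r v = 0 :=
      Finset.sum_eq_zero fun k hk => indicator_of_notMem (h k hk) _
    rw [h1, zero_pow hn]
    exact zero_le

/-- Since the rings are disjoint, the `n`-th power passes into the sum. Each ring lies in a box of
side `2 * 2 ^ (k + 1) * r` and costs at most `(4 / N) ^ n`; the total `N * (4 / N) ^ n` is at most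
`4 ^ n / N` because `n ≥ 2`. -/
theorem lintegral_ringProfile_boxNorm_le (hn : 2 ≤ n) {N : ℕ} (hN : N ≠ 0) {r : ℝ} (hr : 0 < r)
    (c : EuclideanSpace ℝ (Fin n)) :
    ∫⁻ z, ringProfile N r (boxNorm (z - c)) ^ n ≤ ENNReal.ofReal (4 ^ n / N) := by
  have hN' : (0 : ℝ) < N := by positivity
  have hN1 : (1 : ℝ) ≤ N := by exact_mod_cast Nat.one_le_iff_ne_zero.2 hN
  have hmeas : ∀ k : ℕ, MeasurableSet ((fun z : EuclideanSpace ℝ (Fin n) => boxNorm (z - c)) ⁻¹'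
      Ioc (2 ^ k * r) (2 ^ (k + 1) * r)) := fun k =>
    (continuous_boxNorm_sub c).measurable measurableSet_Ioc
  calc ∫⁻ z, ringProfile N r (boxNorm (z - c)) ^ n
      ≤ ∫⁻ z, ∑ k ∈ Finset.range N, ((fun z : EuclideanSpace ℝ (Fin n) => boxNorm (z - c)) ⁻¹'
          Ioc (2 ^ k * r) (2 ^ (k + 1) * r)).indicator
          (fun _ => ENNReal.ofReal ((N * (2 ^ k * r))⁻¹) ^ n) z :=
        lintegral_mono fun z => ringProfile_pow_le (by omega) N hr _
    _ = ∑ k ∈ Finset.range N, ∫⁻ z, ((fun z : EuclideanSpace ℝ (Fin n) => boxNorm (z - c)) ⁻¹'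
          Ioc (2 ^ k * r) (2 ^ (k + 1) * r)).indicator
          (fun _ => ENNReal.ofReal ((N * (2 ^ k * r))⁻¹) ^ n) z :=
        lintegral_finsetSum _ fun k _ => measurable_const.indicator (hmeas k)
    _ ≤ ∑ k ∈ Finset.range N, ENNReal.ofReal ((4 / N) ^ n) := by
        refine Finset.sum_le_sum fun k _ => ?_
        rw [lintegral_indicator_const (hmeas k)]
        have hv : volume ((fun z : EuclideanSpace ℝ (Fin n) => boxNorm (z - c)) ⁻¹'
            Ioc (2 ^ k * r) (2 ^ (k + 1) * r)) ≤ ENNReal.ofReal (2 * (2 ^ (k + 1) * r)) ^ n := by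
          rw [← volume_boxNorm_sub_le c (by positivity)]
          exact measure_mono fun z hz => hz.2
        refine (mul_le_mul_right hv _).trans_eq ?_
        rw [← mul_pow, ← ENNReal.ofReal_mul (by positivity), ← ENNReal.ofReal_pow (by positivity)]
        congr 2
        field_simp
        ring
    _ = ENNReal.ofReal (N * (4 / N) ^ n) := by
        rw [Finset.sum_const, Finset.card_range, nsmul_eq_mul, ENNReal.ofReal_mul (by positivity),
          ENNReal.ofReal_natCast]
    _ ≤ _ := by
        refine ENNReal.ofReal_le_ofReal ?_
        obtain ⟨m, rfl⟩ := Nat.exists_eq_add_of_le' hn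
        rw [div_pow, ← mul_div_assoc, mul_comm, mul_div_assoc]
        rw [div_eq_mul_inv (4 ^ (m + 2) : ℝ) (N : ℝ)]
        gcongr
        rw [div_le_iff₀ (by positivity), pow_add, pow_two]
        have : (1 : ℝ) ≤ N ^ m := one_le_pow₀ hN1
        have h2 : (N : ℝ)⁻¹ * (N ^ m * (N * N)) = N ^ m * N := by field_simp
        rw [h2]
        nlinarith

/-- Crossing a thick ring is long for a weight of small energy. -/
theorem exists_ring_weight (hn : 2 ≤ n) {ε : ℝ≥0∞} (hε : ε ≠ 0) :
    ∃ N : ℕ, N ≠ 0 ∧ ∀ (c : EuclideanSpace ℝ (Fin n)) (r : ℝ), 0 < r →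
      ∃ ω : EuclideanSpace ℝ (Fin n) → ℝ≥0∞, Measurable ω ∧ ∫⁻ z, ω z ^ n ≤ ε ∧
        ∀ p q, boxNorm (p - c) ≤ r → 2 ^ N * r ≤ boxNorm (q - c) → 1 ≤ weightedDist ω p q := by
  obtain ⟨N, hN0, hN⟩ : ∃ N : ℕ, N ≠ 0 ∧ ENNReal.ofReal (4 ^ n / N) ≤ ε := by
    have h1 : Tendsto (fun N : ℕ => ENNReal.ofReal (4 ^ n / N)) atTop (𝓝 (ENNReal.ofReal 0)) :=
      (ENNReal.continuous_ofReal.tendsto 0).comp (tendsto_const_div_atTop_nhds_zero_nat _)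
    rw [ENNReal.ofReal_zero] at h1
    have h2 := h1.eventually (ge_mem_nhds (pos_iff_ne_zero.2 hε))
    obtain ⟨N, h3, h4⟩ := (h2.and (eventually_ne_atTop 0)).exists
    exact ⟨N, h4, h3⟩
  refine ⟨N, hN0, fun c r hr => ⟨fun z => ringProfile N r (boxNorm (z - c)), ?_, ?_, ?_⟩⟩
  · exact (measurable_ringProfile N r).comp (continuous_boxNorm_sub c).measurable
  · exact (lintegral_ringProfile_boxNorm_le hn hN0 hr c).trans hN
  · intro p q hp hq
    refine le_weightedDist_iff.2 fun L γ hL hγ h0 h1 => ?_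
    have hu : LipschitzWith 1 fun s => boxNorm (γ s - c) := by
      simpa [Function.comp_def] using (lipschitzWith_boxNorm_sub c).comp hγ
    refine le_trans ?_ (setLIntegral_uIcc_le hu hL (measurable_ringProfile N r))
    rw [h0, h1]
    exact one_le_lintegral_ringProfile hN0 hr hp hq

end

/-! ### A Morrey estimate: dimension `m`, exponent `m + 1`. -/

section

/-- Pointwise substitute for Hölder's inequality: either `x ≤ a`, or `x ≤ x ^ (m + 1) / a ^ m`. The
threshold `a` is free and is tuned to the situation. -/
theorem le_add_inv_pow_mul_pow {a : ℝ≥0∞} (ha : a ≠ 0) (ha' : a ≠ ∞) (m : ℕ) (x : ℝ≥0∞) :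
    x ≤ a + (a ^ m)⁻¹ * x ^ (m + 1) := by
  rcases le_total x a with h | h
  · exact h.trans le_self_add
  · refine le_trans ?_ le_add_self
    calc x = (a ^ m)⁻¹ * a ^ m * x := by
          rw [ENNReal.inv_mul_cancel (pow_ne_zero _ ha) (ENNReal.pow_ne_top ha'), one_mul]
      _ ≤ (a ^ m)⁻¹ * (x ^ m * x) := by rw [mul_assoc]; gcongr
      _ = _ := by rw [pow_succ]

theorem lintegral_comp_add_smul {V : Type*} [NormedAddCommGroup V] [NormedSpace ℝ V]
    [MeasurableSpace V] [BorelSpace V] [FiniteDimensional ℝ V] (μ : Measure V)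
    [μ.IsAddHaarMeasure] (f : V → ℝ≥0∞) (b : V) {r : ℝ} (hr : r ≠ 0) :
    ∫⁻ w, f (b + r • w) ∂μ =
      ENNReal.ofReal |(r ^ Module.finrank ℝ V)⁻¹| * ∫⁻ w, f w ∂μ := by
  have hemb : MeasurableEmbedding fun w : V => r • w :=
    (MeasurableEquiv.smul₀ r hr).measurableEmbedding
  have h1 : ∫⁻ w, f (b + r • w) ∂μ = ∫⁻ w, f (b + w) ∂(μ.map fun w => r • w) :=
    (hemb.lintegral_map fun w => f (b + w)).symm
  rw [h1, Measure.map_addHaar_smul μ hr, lintegral_smul_measure, smul_eq_mul,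
    lintegral_add_left_eq_self f b]

theorem lintegral_Icc_rpow_lt_top {a : ℝ} (ha : -1 < a) :
    ∫⁻ t in Icc (0 : ℝ) 1, ENNReal.ofReal (t ^ a) < ∞ := by
  have h1 : IntegrableOn (fun t : ℝ => t ^ a) (Ioo 0 1) :=
    (intervalIntegral.integrableOn_Ioo_rpow_iff one_pos).2 ha
  rw [restrict_Ioo_eq_restrict_Icc.symm]
  exact h1.lintegral_lt_top

section Morrey

variable {m : ℕ}

/-- The mean `f`-length of the segments from `p` to the points of a cube. -/
theorem lintegral_segments_le {f : (Fin m → ℝ) → ℝ≥0∞} (hf : Measurable f) (p : Fin m → ℝ)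
    (Q : Set (Fin m → ℝ)) {κ : ℝ≥0∞} (hκ : κ ≠ 0) (hκ' : κ ≠ ∞) :
    ∫⁻ w in Q, ∫⁻ t in Icc (0 : ℝ) 1, f (p + t • (w - p)) ≤
      (∫⁻ t in Icc (0 : ℝ) 1, ENNReal.ofReal (t ^ (-(m / (m + 1)) : ℝ))) *
        (κ * volume Q + (κ ^ m)⁻¹ * ∫⁻ z, f z ^ (m + 1)) := by
  rw [lintegral_lintegral_swap]
  swap
  · refine (hf.comp ?_).aemeasurable
    exact (Continuous.measurable (by fun_prop))
  have hmeas : Measurable fun t : ℝ => ENNReal.ofReal (t ^ (-(m / (m + 1)) : ℝ)) := by fun_prop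
  rw [← lintegral_mul_const _ hmeas, ← restrict_Ioc_eq_restrict_Icc]
  refine setLIntegral_mono' measurableSet_Ioc fun t ht => ?_
  have ht0 : 0 < t := ht.1
  -- Contracting toward `p` by `t` multiplies the energy by `t ^ (-m)`. Since `x ^ (m + 1) * t ^ m =
  -- 1`, the threshold `κ * x` makes both terms proportional to `x`, and `x` is integrable in `t` as
  -- its exponent exceeds `-1`.
  set x : ℝ := t ^ (-(m / (m + 1)) : ℝ) with hx
  have hx0 : 0 < x := Real.rpow_pos_of_pos ht0 _
  have hxt : x ^ (m + 1) * t ^ m = 1 := by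
    rw [hx, ← Real.rpow_natCast, ← Real.rpow_mul ht0.le, ← Real.rpow_natCast t m,
      ← Real.rpow_add ht0]
    have : (-(m / (m + 1)) : ℝ) * ((m + 1 : ℕ) : ℝ) + m = 0 := by
      push_cast
      field_simp
      ring
    rw [this, Real.rpow_zero]
  set l : ℝ≥0∞ := κ * ENNReal.ofReal x with hl
  have hl0 : l ≠ 0 := mul_ne_zero hκ (by simpa using hx0)
  have hlt : l ≠ ∞ := ENNReal.mul_ne_top hκ' ENNReal.ofReal_ne_top
  have hscale : ∫⁻ w, f (p + t • (w - p)) ^ (m + 1) =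
      ENNReal.ofReal ((t ^ m)⁻¹) * ∫⁻ z, f z ^ (m + 1) := by
    have h := lintegral_comp_add_smul (volume : Measure (Fin m → ℝ)) (fun z => f z ^ (m + 1))
      (p - t • p) ht0.ne'
    rw [Module.finrank_fin_fun, abs_of_pos (by positivity)] at h
    rw [← h]
    refine lintegral_congr fun w => ?_
    congr 2
    rw [smul_sub]; abel
  have hw : (l ^ m)⁻¹ * ENNReal.ofReal ((t ^ m)⁻¹) = ENNReal.ofReal x * (κ ^ m)⁻¹ := by
    rw [hl, mul_pow, ENNReal.mul_inv (Or.inl (pow_ne_zero _ hκ))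
      (Or.inl (ENNReal.pow_ne_top hκ')), ← ENNReal.ofReal_pow hx0.le,
      ← ENNReal.ofReal_inv_of_pos (by positivity), mul_assoc, ← ENNReal.ofReal_mul (by positivity),
      mul_comm]
    congr 2
    have : x * (x ^ m * t ^ m) = 1 := by rw [← hxt]; ring
    rw [← mul_inv]
    exact (eq_inv_of_mul_eq_one_left this).symm
  calc ∫⁻ w in Q, f (p + t • (w - p))
      ≤ ∫⁻ w in Q, (l + (l ^ m)⁻¹ * f (p + t • (w - p)) ^ (m + 1)) :=
        lintegral_mono fun w => le_add_inv_pow_mul_pow hl0 hlt m _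
    _ = l * volume Q + (l ^ m)⁻¹ * ∫⁻ w in Q, f (p + t • (w - p)) ^ (m + 1) := by
        rw [lintegral_add_left measurable_const, setLIntegral_const, lintegral_const_mul']
        exact ENNReal.inv_ne_top.2 (pow_ne_zero _ hl0)
    _ ≤ l * volume Q + (l ^ m)⁻¹ * ∫⁻ w, f (p + t • (w - p)) ^ (m + 1) := by
        gcongr
        exact Measure.restrict_le_self
    _ = _ := by
        rw [hscale, ← mul_assoc, hw, hl]
        ring

/-- Two points of a space of dimension `m` can be joined by a short curve if the weight has small
`(m + 1)`-energy. -/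
theorem exists_short_segments (m : ℕ) {ε : ℝ≥0∞} (hε : ε ≠ 0) :
    ∃ η : ℝ≥0∞, η ≠ 0 ∧ ∀ f : (Fin m → ℝ) → ℝ≥0∞, Measurable f → ∫⁻ z, f z ^ (m + 1) ≤ η →
      ∀ p q : Fin m → ℝ, ∃ w : Fin m → ℝ, ‖w‖ ≤ 1 ∧
        ∫⁻ t in Icc (0 : ℝ) 1, f (p + t • (w - p)) ≤ ε ∧
        ∫⁻ t in Icc (0 : ℝ) 1, f (q + t • (w - q)) ≤ ε := by
  wlog hε' : ε ≠ ∞ generalizing ε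
  · obtain ⟨η, h0, h⟩ := this one_ne_zero ENNReal.one_ne_top
    push Not at hε'
    subst hε'
    refine ⟨η, h0, fun f hf hi p q => ?_⟩
    obtain ⟨w, hw, -⟩ := h f hf hi p q
    exact ⟨w, hw, le_top, le_top⟩
  set B : ℝ≥0∞ := ∫⁻ t in Icc (0 : ℝ) 1, ENNReal.ofReal (t ^ (-(m / (m + 1)) : ℝ))
  have hB : B ≠ ∞ := (lintegral_Icc_rpow_lt_top (by
    rw [neg_lt_neg_iff, div_lt_one (by positivity)]; linarith)).ne
  set Q : Set (Fin m → ℝ) := Metric.closedBall 0 1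
  have hQ0 : volume Q ≠ 0 := (Metric.measure_closedBall_pos _ _ one_pos).ne'
  have hQt : volume Q ≠ ∞ := measure_closedBall_lt_top.ne
  -- With the bound `κ ^ m * (κ * volume Q)` on the energy, both terms of the estimate equal at most
  -- `κ * volume Q`. The mean over `w` of the two lengths together is then at most `4 * B * κ ≤ ε`,
  -- and some `w` does not exceed the mean. `B + 1` avoids a division by zero.
  set κ : ℝ≥0∞ := ε / (4 * (B + 1)) with hκdef
  have hden : 4 * (B + 1) ≠ ∞ := ENNReal.mul_ne_top (by simp) (by simpa using hB)
  have hden0 : 4 * (B + 1) ≠ 0 := by simp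
  have hκ0 : κ ≠ 0 := (ENNReal.div_pos hε hden).ne'
  have hκt : κ ≠ ∞ := (ENNReal.div_lt_top hε' hden0).ne
  refine ⟨κ ^ m * (κ * volume Q), ?_, fun f hf hi p q => ?_⟩
  · exact mul_ne_zero (pow_ne_zero _ hκ0) (mul_ne_zero hκ0 hQ0)
  have hbound : ∀ p : Fin m → ℝ, ∫⁻ w in Q, ∫⁻ t in Icc (0 : ℝ) 1, f (p + t • (w - p)) ≤
      B * (2 * (κ * volume Q)) := fun p => by
    refine (lintegral_segments_le hf p Q hκ0 hκt).trans ?_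
    refine mul_le_mul_right ?_ _
    rw [two_mul]
    refine add_le_add le_rfl ?_
    calc (κ ^ m)⁻¹ * ∫⁻ z, f z ^ (m + 1) ≤ (κ ^ m)⁻¹ * (κ ^ m * (κ * volume Q)) := by gcongr
      _ = _ := by
        rw [← mul_assoc, ENNReal.inv_mul_cancel (pow_ne_zero _ hκ0) (ENNReal.pow_ne_top hκt),
          one_mul]
  have hmeas : ∀ p : Fin m → ℝ, Measurable fun w : Fin m → ℝ =>
      ∫⁻ t in Icc (0 : ℝ) 1, f (p + t • (w - p)) := fun p => by
    refine Measurable.lintegral_prod_right' (f := fun x : (Fin m → ℝ) × ℝ =>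
      f (p + x.2 • (x.1 - p))) (hf.comp (Continuous.measurable (by fun_prop)))
  obtain ⟨w, hwQ, hw⟩ := exists_le_setLAverage (μ := volume) (s := Q) hQ0 hQt
    ((hmeas p).add (hmeas q)).aemeasurable
  rw [setLAverage_eq] at hw
  simp only [Pi.add_apply] at hw
  rw [lintegral_add_left (hmeas p)] at hw
  have hle := hw.trans (c := ε) <| by
    refine ENNReal.div_le_of_le_mul ((add_le_add (hbound p) (hbound q)).trans ?_)
    calc B * (2 * (κ * volume Q)) + B * (2 * (κ * volume Q))
        = (4 * B) * κ * volume Q := by ring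
      _ ≤ (4 * (B + 1)) * κ * volume Q := by gcongr; exact le_self_add
      _ = ε * volume Q := by rw [hκdef, ENNReal.mul_div_cancel hden0 hden]
  refine ⟨w, by simpa [Q] using hwQ, le_self_add.trans hle, le_add_self.trans hle⟩

end Morrey

end

/-! ### Coordinate slices and diagonal segments. -/

section

variable {m n : ℕ}

/-- The point with `i`-th coordinate `t` and remaining coordinates `y`. -/
def slicePoint (i : Fin (m + 1)) (t : ℝ) (y : Fin m → ℝ) : EuclideanSpace ℝ (Fin (m + 1)) :=
  WithLp.toLp 2 (i.insertNth t y)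

theorem measurePreserving_slicePoint (i : Fin (m + 1)) :
    MeasurePreserving (fun x : ℝ × (Fin m → ℝ) => slicePoint i x.1 x.2) := by
  have h1 := (volume_preserving_piFinSuccAbove (fun _ : Fin (m + 1) => ℝ) i).symm
  exact (PiLp.volume_preserving_toLp (Fin (m + 1))).comp h1

theorem slicePoint_removeNth (i : Fin (m + 1)) (p : EuclideanSpace ℝ (Fin (m + 1))) :
    slicePoint i (p i) (i.removeNth (WithLp.ofLp p)) = p := by
  simp [slicePoint]

theorem slicePoint_segment (i : Fin (m + 1)) (t s : ℝ) (y w : Fin m → ℝ) :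
    slicePoint i t y + s • (slicePoint i t w - slicePoint i t y) =
      slicePoint i t (y + s • (w - y)) := by
  ext j
  refine Fin.succAboveCases i ?_ (fun k => ?_) j <;> simp [slicePoint]

theorem boxNorm_slicePoint_sub_le (i : Fin (m + 1)) (t : ℝ) (y w : Fin m → ℝ) :
    boxNorm (slicePoint i t w - slicePoint i t y) ≤ ‖w - y‖ := by
  refine (boxNorm_le_iff (norm_nonneg _)).2 fun j => ?_
  refine Fin.succAboveCases i ?_ (fun k => ?_) j
  · simp [slicePoint]
  · simpa [slicePoint] using norm_le_pi_norm (w - y) k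

theorem norm_removeNth_le (i : Fin (m + 1)) (p : EuclideanSpace ℝ (Fin (m + 1))) :
    ‖i.removeNth (WithLp.ofLp p)‖ ≤ boxNorm p :=
  (pi_norm_le_iff_of_nonneg (boxNorm_nonneg p)).2 fun k => abs_apply_le_boxNorm p (i.succAbove k)

/-- A set of parameters that is not too small contains one whose slice has small energy. -/
theorem exists_slice_energy_le {ρ : EuclideanSpace ℝ (Fin (m + 1)) → ℝ≥0∞} (hρ : Measurable ρ)
    (i : Fin (m + 1)) {T : Set ℝ} {δ a : ℝ≥0∞} (hT : δ ≤ volume T)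
    (h : ∫⁻ z, ρ z ^ (m + 1) < a * δ) :
    ∃ t ∈ T, ∫⁻ y, ρ (slicePoint i t y) ^ (m + 1) ≤ a := by
  by_contra! hcon
  have hmp := measurePreserving_slicePoint i
  have hmeas : Measurable fun x : ℝ × (Fin m → ℝ) => ρ (slicePoint i x.1 x.2) ^ (m + 1) :=
    (hρ.comp hmp.measurable).pow_const _
  have h1 : ∫⁻ z, ρ z ^ (m + 1) = ∫⁻ t, ∫⁻ y, ρ (slicePoint i t y) ^ (m + 1) := by
    rw [← hmp.lintegral_comp (hρ.pow_const _)]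
    exact lintegral_prod _ hmeas.aemeasurable
  have h2 := mul_meas_ge_le_lintegral (μ := volume) (Measurable.lintegral_prod_right' (ν := volume) hmeas) a
  have h3 : T ⊆ {t | a ≤ ∫⁻ y, ρ (slicePoint i t y) ^ (m + 1)} := fun t ht => (hcon t ht).le
  rw [h1] at h
  exact absurd ((mul_le_mul_right (hT.trans (measure_mono h3)) a).trans h2) (not_le.2 h)

/-- Two points of one slice of small energy are joined by a short curve. -/
theorem exists_slice_weightedDist_le (m : ℕ) {ε : ℝ≥0∞} (hε : ε ≠ 0) {H : ℝ} (hH : 0 < H) :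
    ∃ η : ℝ≥0∞, η ≠ 0 ∧ ∀ ρ : EuclideanSpace ℝ (Fin (m + 1)) → ℝ≥0∞, Measurable ρ →
      ∀ (i : Fin (m + 1)) (t : ℝ), ∫⁻ y, ρ (slicePoint i t y) ^ (m + 1) ≤ η →
      ∀ p q : EuclideanSpace ℝ (Fin (m + 1)), p i = t → q i = t → boxNorm p ≤ H → boxNorm q ≤ H →
        weightedDist ρ p q ≤ ε := by
  set r : ℝ := (m + 1) * (1 + H)
  have hr : 0 < r := by positivity
  obtain ⟨η, hη, h⟩ := exists_short_segments m (ε := ε / (2 * ENNReal.ofReal r))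
    (ENNReal.div_pos hε (ENNReal.mul_ne_top (by simp) ENNReal.ofReal_ne_top)).ne'
  refine ⟨η, hη, fun ρ hρ i t hi p q hp hq hpH hqH => ?_⟩
  have hmeas : Measurable fun y => ρ (slicePoint i t y) :=
    (hρ.comp (measurePreserving_slicePoint i).measurable).comp measurable_prodMk_left
  obtain ⟨w, hw, h1, h2⟩ := h _ hmeas hi (i.removeNth (WithLp.ofLp p))
    (i.removeNth (WithLp.ofLp q))
  have key : ∀ p : EuclideanSpace ℝ (Fin (m + 1)), p i = t → boxNorm p ≤ H →
      ∫⁻ s in Icc (0 : ℝ) 1, ρ (slicePoint i t (i.removeNth (WithLp.ofLp p) +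
        s • (w - i.removeNth (WithLp.ofLp p)))) ≤ ε / (2 * ENNReal.ofReal r) →
      weightedDist ρ p (slicePoint i t w) ≤ ε / 2 := fun p hp hpH hi => by
    have hpe : p = slicePoint i t (i.removeNth (WithLp.ofLp p)) := by
      rw [← hp, slicePoint_removeNth]
    have hle : ‖slicePoint i t w - p‖ ≤ r := by
      refine (norm_le_mul_boxNorm _).trans ?_
      have h3 : boxNorm (slicePoint i t w - p) ≤ 1 + H := by
        conv_lhs => rw [hpe]
        refine (boxNorm_slicePoint_sub_le i t _ w).trans ((norm_sub_le _ _).trans ?_)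
        exact add_le_add hw ((norm_removeNth_le i p).trans hpH)
      push_cast
      exact mul_le_mul_of_nonneg_left h3 (by positivity)
    refine (weightedDist_segment_le hr hle).trans ?_
    have hsame : ∀ s : ℝ, p + s • (slicePoint i t w - p) = slicePoint i t
        (i.removeNth (WithLp.ofLp p) + s • (w - i.removeNth (WithLp.ofLp p))) := fun s => by
      conv_lhs => rw [hpe]
      exact slicePoint_segment i t s _ w
    simp only [hsame]
    refine (mul_le_mul_right hi _).trans_eq ?_
    have hr0 : ENNReal.ofReal r ≠ 0 := by simpa using hr
    rw [div_eq_mul_inv, ENNReal.mul_inv (Or.inl (by simp)) (Or.inl (by simp)), mul_comm,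
      mul_assoc, mul_assoc, ENNReal.inv_mul_cancel hr0 ENNReal.ofReal_ne_top, mul_one,
      div_eq_mul_inv]
  refine (weightedDist_triangle_right ρ p q (slicePoint i t w)).trans ?_
  exact (add_le_add (key p hp hpH h1) (key q hq hqH h2)).trans_eq (ENNReal.add_halves ε)

/-- The vector with all coordinates equal to `1`. -/
def diagonal (n : ℕ) : EuclideanSpace ℝ (Fin n) := WithLp.toLp 2 fun _ => 1

@[simp] theorem diagonal_apply (i : Fin n) : diagonal n i = 1 := rfl

theorem boxNorm_diagonal_le : boxNorm (diagonal n) ≤ 1 :=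
  (boxNorm_le_iff zero_le_one).2 fun i => by simp

theorem norm_diagonal_le : ‖diagonal n‖ ≤ n + 1 := by
  have h1 := norm_le_mul_boxNorm (diagonal n)
  have h2 := boxNorm_diagonal_le (n := n)
  have h3 : (0 : ℝ) ≤ n := by positivity
  nlinarith

/-- One integral over the whole segment controls all its points at once, which allows averaging over
`y`. The factor `n + 1` bounds the norm of the diagonal vector. -/
theorem weightedDist_diagonal_le (ρ : EuclideanSpace ℝ (Fin n) → ℝ≥0∞)
    (y : EuclideanSpace ℝ (Fin n)) {H s : ℝ} (hs : |s| ≤ H) :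
    weightedDist ρ y (y + s • diagonal n) ≤
      ENNReal.ofReal (n + 1) * ∫⁻ t in Icc (-H) H, ρ (y + t • diagonal n) := by
  have hpos : (0 : ℝ) < n + 1 := by positivity
  have hφ : ∀ a b : ℝ, dist (y + a • diagonal n) (y + b • diagonal n) ≤ (n + 1) * dist a b :=
    fun a b => by
      rw [dist_add_left, dist_eq_norm, ← sub_smul, norm_smul, mul_comm, dist_eq_norm a b]
      gcongr
      exact norm_diagonal_le
  have h1 := weightedDist_comp_le (ρ := ρ) (φ := fun t : ℝ => y + t • diagonal n) hpos hφ 0 s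
  simp only [zero_smul, add_zero] at h1
  refine h1.trans ?_
  obtain ⟨hs1, hs2⟩ := abs_le.1 hs
  rw [← lintegral_const_mul' _ _ ENNReal.ofReal_ne_top]
  rcases le_total 0 s with h | h
  · exact (weightedDist_le_setLIntegral (c := id) h LipschitzWith.id.lipschitzOnWith).trans
      (lintegral_mono_set (Icc_subset_Icc (by linarith) hs2))
  · rw [weightedDist_comm]
    exact (weightedDist_le_setLIntegral (c := id) h LipschitzWith.id.lipschitzOnWith).trans
      (lintegral_mono_set (Icc_subset_Icc hs1 (by linarith)))

/-- Some diagonal segment is short if the weight has small energy. -/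
theorem exists_short_diagonal (m : ℕ) {ε : ℝ≥0∞} (hε : ε ≠ 0) {H : ℝ} (hH : 0 < H) :
    ∃ η : ℝ≥0∞, η ≠ 0 ∧ ∀ ρ : EuclideanSpace ℝ (Fin (m + 1)) → ℝ≥0∞, Measurable ρ →
      ∫⁻ z, ρ z ^ (m + 1) ≤ η → ∃ y : EuclideanSpace ℝ (Fin (m + 1)), boxNorm y ≤ 1 ∧
        ∀ s : ℝ, |s| ≤ H → weightedDist ρ y (y + s • diagonal (m + 1)) ≤ ε := by
  wlog hε' : ε ≠ ∞ generalizing ε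
  · obtain ⟨η, h0, h⟩ := this one_ne_zero ENNReal.one_ne_top
    push Not at hε'
    subst hε'
    refine ⟨η, h0, fun ρ hρ hi => ?_⟩
    obtain ⟨y, hy, -⟩ := h ρ hρ hi
    exact ⟨y, hy, fun _ _ => le_top⟩
  set Q : Set (EuclideanSpace ℝ (Fin (m + 1))) := {z | boxNorm (z - 0) ≤ 1}
  have hvQ : volume Q = ENNReal.ofReal (2 * 1) ^ (m + 1) := volume_boxNorm_sub_le 0 zero_le_one
  have hQ0 : volume Q ≠ 0 := by rw [hvQ]; simp
  have hQt : volume Q ≠ ∞ := by rw [hvQ]; exact ENNReal.pow_ne_top ENNReal.ofReal_ne_top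
  -- `k` is the Lipschitz factor of the diagonal times the length of the parameter interval. The
  -- mean over the base points `y` of the bound for the segment is then at most `2 * k * κ = ε`.
  set k : ℝ≥0∞ := ENNReal.ofReal ((m + 1 : ℕ) + 1) * ENNReal.ofReal (2 * H)
  have hk0 : k ≠ 0 := mul_ne_zero (by simp; positivity) (by simpa using hH)
  have hkt : k ≠ ∞ := ENNReal.mul_ne_top ENNReal.ofReal_ne_top ENNReal.ofReal_ne_top
  have hkt2 : 2 * k ≠ ∞ := ENNReal.mul_ne_top (by simp) hkt
  have hk02 : 2 * k ≠ 0 := mul_ne_zero (by simp) hk0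
  set κ : ℝ≥0∞ := ε / (2 * k) with hκdef
  have hκ0 : κ ≠ 0 := (ENNReal.div_pos hε hkt2).ne'
  have hκt : κ ≠ ∞ := (ENNReal.div_lt_top hε' hk02).ne
  refine ⟨κ ^ m * (κ * volume Q), ?_, fun ρ hρ hi => ?_⟩
  · exact mul_ne_zero (pow_ne_zero _ hκ0) (mul_ne_zero hκ0 hQ0)
  have hjoint : Measurable fun x : EuclideanSpace ℝ (Fin (m + 1)) × ℝ =>
      ρ (x.1 + x.2 • diagonal (m + 1)) := hρ.comp (Continuous.measurable (by fun_prop))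
  have hmeas : Measurable fun y : EuclideanSpace ℝ (Fin (m + 1)) =>
      ∫⁻ t in Icc (-H) H, ρ (y + t • diagonal (m + 1)) := Measurable.lintegral_prod_right' hjoint
  obtain ⟨y, hyQ, hy⟩ := exists_le_setLAverage (μ := volume) (s := Q) hQ0 hQt hmeas.aemeasurable
  refine ⟨y, by simpa [Q] using hyQ, fun s hs => (weightedDist_diagonal_le ρ y hs).trans ?_⟩
  have hintegral : ∫⁻ y in Q, ∫⁻ t in Icc (-H) H, ρ (y + t • diagonal (m + 1)) ≤
      2 * (κ * volume Q) * ENNReal.ofReal (2 * H) := by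
    rw [lintegral_lintegral_swap hjoint.aemeasurable]
    have hone : ∀ t : ℝ, ∫⁻ y in Q, ρ (y + t • diagonal (m + 1)) ≤ 2 * (κ * volume Q) := fun t =>
      calc ∫⁻ y in Q, ρ (y + t • diagonal (m + 1))
          ≤ ∫⁻ y in Q, (κ + (κ ^ m)⁻¹ * ρ (y + t • diagonal (m + 1)) ^ (m + 1)) :=
            lintegral_mono fun w => le_add_inv_pow_mul_pow hκ0 hκt m _
        _ = κ * volume Q + (κ ^ m)⁻¹ * ∫⁻ y in Q, ρ (y + t • diagonal (m + 1)) ^ (m + 1) := by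
            rw [lintegral_add_left measurable_const, setLIntegral_const, lintegral_const_mul']
            exact ENNReal.inv_ne_top.2 (pow_ne_zero _ hκ0)
        _ ≤ κ * volume Q + (κ ^ m)⁻¹ * ∫⁻ y, ρ (y + t • diagonal (m + 1)) ^ (m + 1) := by
            gcongr
            exact Measure.restrict_le_self
        _ ≤ κ * volume Q + (κ ^ m)⁻¹ * (κ ^ m * (κ * volume Q)) := by
            rw [lintegral_add_right_eq_self fun z => ρ z ^ (m + 1)]
            gcongr
        _ = 2 * (κ * volume Q) := by
            rw [← mul_assoc, ENNReal.inv_mul_cancel (pow_ne_zero _ hκ0) (ENNReal.pow_ne_top hκt),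
              one_mul, two_mul]
    refine (lintegral_mono hone).trans_eq ?_
    rw [setLIntegral_const, Real.volume_Icc]
    congr 2
    ring
  rw [setLAverage_eq] at hy
  calc ENNReal.ofReal ((m + 1 : ℕ) + 1) * ∫⁻ t in Icc (-H) H, ρ (y + t • diagonal (m + 1))
      ≤ ENNReal.ofReal ((m + 1 : ℕ) + 1) *
          (2 * (κ * volume Q) * ENNReal.ofReal (2 * H) / volume Q) := by
        gcongr
        exact hy.trans (ENNReal.div_le_div_right hintegral _)
    _ = (2 * k) * κ * (volume Q / volume Q) := by
        simp only [k, div_eq_mul_inv]; ring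
    _ = ε := by
        rw [ENNReal.div_self hQ0 hQt, mul_one, hκdef, ENNReal.mul_div_cancel hk02 hkt2]

/-- If the weight has small energy, all large sets are close to some diagonal segment. -/
theorem exists_diagonal_near (m : ℕ) {ε δ : ℝ≥0∞} (hε : ε ≠ 0) (hδ : δ ≠ 0) {H : ℝ} (hH : 0 < H) :
    ∃ η : ℝ≥0∞, η ≠ 0 ∧ ∀ ρ : EuclideanSpace ℝ (Fin (m + 1)) → ℝ≥0∞, Measurable ρ →
      ∫⁻ z, ρ z ^ (m + 1) ≤ η → ∃ y : EuclideanSpace ℝ (Fin (m + 1)), boxNorm y ≤ 1 ∧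
        (∀ s : ℝ, |s| ≤ H + 1 → weightedDist ρ y (y + s • diagonal (m + 1)) < ε) ∧
        ∀ (A : Set (EuclideanSpace ℝ (Fin (m + 1)))) (i : Fin (m + 1)),
          δ ≤ volume {t : ℝ | ∃ p ∈ A, p i = t ∧ boxNorm p ≤ H} →
          ∃ p ∈ A, boxNorm p ≤ H ∧ weightedDist ρ y p < ε := by
  wlog hε' : ε ≠ ∞ generalizing ε
  · obtain ⟨η, h0, h⟩ := this one_ne_zero ENNReal.one_ne_top
    push Not at hε'
    subst hε'
    refine ⟨η, h0, fun ρ hρ hi => ?_⟩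
    obtain ⟨y, hy, h1, h2⟩ := h ρ hρ hi
    refine ⟨y, hy, fun s hs => (h1 s hs).trans_le le_top, fun A i hA => ?_⟩
    obtain ⟨p, hp, hpH, hlt⟩ := h2 A i hA
    exact ⟨p, hp, hpH, hlt.trans_le le_top⟩
  have hε3 : ε / 3 ≠ 0 := (ENNReal.div_pos hε (by simp)).ne'
  have hlt : ε / 3 + ε / 3 < ε := by
    have h1 : ε / 3 + ε / 3 + ε / 3 = ε := ENNReal.add_thirds ε
    conv_rhs => rw [← h1]
    refine ENNReal.lt_add_right ?_ hε3
    exact ((add_le_add le_rfl le_rfl |>.trans (le_self_add.trans_eq h1)).trans_lt hε'.lt_top).ne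
  obtain ⟨η₁, hη₁, hD⟩ := exists_short_diagonal m hε3 (H := H + 1) (by linarith)
  obtain ⟨η₂, hη₂, hS⟩ := exists_slice_weightedDist_le m hε3 (H := H + 2) (by linarith)
  -- Room for the strict inequality in the choice of a slice of energy at most `η₂` through a set of
  -- measure `δ`. The bound `H + 2` above is the largest box norm of a point of the diagonal segment
  -- over `|s| ≤ H + 1`.
  obtain ⟨η₃, hη₃, hlt₃⟩ := exists_between (pos_iff_ne_zero.2 (mul_ne_zero hη₂ hδ))
  refine ⟨min η₁ η₃, (lt_min (pos_iff_ne_zero.2 hη₁) hη₃).ne', fun ρ hρ hi => ?_⟩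
  obtain ⟨y, hy, hyD⟩ := hD ρ hρ (hi.trans (min_le_left _ _))
  refine ⟨y, hy, fun s hs => (hyD s hs).trans_lt (lt_of_le_of_lt le_self_add hlt),
    fun A i hA => ?_⟩
  obtain ⟨t, ⟨p, hpA, hpt, hpH⟩, hslice⟩ := exists_slice_energy_le hρ i hA
    ((hi.trans (min_le_right _ _)).trans_lt hlt₃)
  refine ⟨p, hpA, hpH, ?_⟩
  have hyi := (abs_apply_le_boxNorm y i).trans hy
  have hpi : |t| ≤ H := hpt ▸ (abs_apply_le_boxNorm p i).trans hpH
  -- The diagonal runs through every slice of every coordinate direction: its point with parameter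
  -- `t - y i` has `i`-th coordinate `t`, as `p` has.
  have hs : |t - y i| ≤ H + 1 := (abs_sub _ _).trans (add_le_add hpi hyi)
  have hq : boxNorm (y + (t - y i) • diagonal (m + 1)) ≤ H + 2 := by
    refine (boxNorm_add_le _ _).trans ?_
    rw [boxNorm_smul]
    have h1 := boxNorm_diagonal_le (n := m + 1)
    have h2 := boxNorm_nonneg (diagonal (m + 1))
    have h3 := abs_nonneg (t - y i)
    nlinarith
  have h2 := hS ρ hρ i t hslice (y + (t - y i) • diagonal (m + 1)) p (by simp) hpt hq
    (by linarith)
  exact (weightedDist_triangle ρ y _ p).trans_lt ((add_le_add (hyD _ hs) h2).trans_lt hlt)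

end

/-! ### Large sets in a ring and their common hub. -/

section

variable {n : ℕ}

/-- A closed ring for the maximum norm. -/
def boxRing (c : EuclideanSpace ℝ (Fin n)) (a b : ℝ) : Set (EuclideanSpace ℝ (Fin n)) :=
  {z | a ≤ boxNorm (z - c) ∧ boxNorm (z - c) ≤ b}

theorem isClosed_boxRing (c : EuclideanSpace ℝ (Fin n)) (a b : ℝ) : IsClosed (boxRing c a b) :=
  (isClosed_le continuous_const (continuous_boxNorm_sub c)).inter
    (isClosed_le (continuous_boxNorm_sub c) continuous_const)

/-- `A` is large at scale `r` around `c`: some coordinate takes many values on `A`. -/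
def IsLargeAt (c : EuclideanSpace ℝ (Fin n)) (r : ℝ) (A : Set (EuclideanSpace ℝ (Fin n))) : Prop :=
  ∃ i, ENNReal.ofReal (r / (2 * n)) ≤
    volume {t : ℝ | ∃ p ∈ A, p i = t ∧ p ∈ boxRing c (r / 10) (10 * r)}

/-- A point at distance `t` from `c` has some coordinate equal to `c i + t` or `c i - t`. So `[r,
2r]` is covered by translates and reflections of the `n` coordinate sets, two of each, and one of
these sets has measure at least `r / (2 * n)`. -/
theorem isLargeAt_of_sphere (hn : 0 < n) {c : EuclideanSpace ℝ (Fin n)} {r : ℝ} (hr : 0 < r)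
    {A : Set (EuclideanSpace ℝ (Fin n))} (h : ∀ t ∈ Icc r (2 * r), ∃ p ∈ A, boxNorm (p - c) = t) :
    IsLargeAt c r A := by
  set T : Fin n → Set ℝ := fun i => {t : ℝ | ∃ p ∈ A, p i = t ∧ p ∈ boxRing c (r / 10) (10 * r)}
  by_contra hcon
  simp only [IsLargeAt, not_exists, not_le] at hcon
  have hsub : Icc r (2 * r) ⊆ ⋃ i, ((fun t => c i + t) ⁻¹' T i ∪ (fun t => c i - t) ⁻¹' T i) := by
    intro t ht
    obtain ⟨p, hpA, hpt⟩ := h t ht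
    obtain ⟨i, hi⟩ := exists_abs_apply_eq_boxNorm hn (p - c)
    have hring : p ∈ boxRing c (r / 10) (10 * r) := ⟨by rw [hpt]; linarith [ht.1],
      by rw [hpt]; linarith [ht.2]⟩
    refine mem_iUnion.2 ⟨i, ?_⟩
    rw [hpt] at hi
    rcases abs_choice ((p - c) i) with h1 | h1
    · refine Or.inl ⟨p, hpA, ?_, hring⟩
      rw [← hi, h1]; simp
    · refine Or.inr ⟨p, hpA, ?_, hring⟩
      rw [← hi, h1]; simp
  have hv : ∀ i, volume ((fun t => c i + t) ⁻¹' T i ∪ (fun t => c i - t) ⁻¹' T i) ≤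
      2 * volume (T i) := fun i => by
    refine (measure_union_le _ _).trans ?_
    rw [measure_preimage_add, Measure.measurePreserving_sub_left volume (c i) |>.measure_preimage_emb
      (MeasurableEquiv.subLeft (c i)).measurableEmbedding, two_mul]
  have h1 : ENNReal.ofReal r ≤ ∑ i, 2 * volume (T i) := by
    calc ENNReal.ofReal r = volume (Icc r (2 * r)) := by rw [Real.volume_Icc]; congr 1; ring
      _ ≤ _ := (measure_mono hsub).trans (measure_iUnion_fintype_le _ _)
      _ ≤ _ := Finset.sum_le_sum fun i _ => hv i
  have hne : (Finset.univ : Finset (Fin n)).Nonempty := ⟨⟨0, hn⟩, Finset.mem_univ _⟩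
  have h2 : ∑ i, 2 * volume (T i) < ∑ _i : Fin n, 2 * ENNReal.ofReal (r / (2 * n)) :=
    ENNReal.sum_lt_sum_of_nonempty hne fun i _ =>
      ENNReal.mul_lt_mul_right (by simp) (by simp) (hcon i)
  have h3 : ∑ _i : Fin n, 2 * ENNReal.ofReal (r / (2 * n)) = ENNReal.ofReal r := by
    rw [Finset.sum_const, Finset.card_univ, Fintype.card_fin, nsmul_eq_mul, ← mul_assoc,
      ← ENNReal.ofReal_natCast, show (2 : ℝ≥0∞) = ENNReal.ofReal 2 by simp,
      ← ENNReal.ofReal_mul (by positivity), ← ENNReal.ofReal_mul (by positivity)]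
    congr 1
    field_simp
  rw [h3] at h2
  exact absurd h1 (not_le.2 h2)

/-- Conformal invariance: the `n`-energy in dimension `n` does not see dilations, once the density
is multiplied by `r`. This reduces every scale to the unit scale. -/
theorem lintegral_rescale_pow (ρ : EuclideanSpace ℝ (Fin n) → ℝ≥0∞)
    (c : EuclideanSpace ℝ (Fin n)) {r : ℝ} (hr : 0 < r) :
    ∫⁻ w, (ENNReal.ofReal r * ρ (c + r • w)) ^ n = ∫⁻ z, ρ z ^ n := by
  simp only [mul_pow]
  rw [lintegral_const_mul' _ _ (ENNReal.pow_ne_top ENNReal.ofReal_ne_top),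
    lintegral_comp_add_smul volume (fun z => ρ z ^ n) c hr.ne', finrank_euclideanSpace_fin,
    ← mul_assoc, ← ENNReal.ofReal_pow hr.le, abs_of_pos (by positivity),
    ← ENNReal.ofReal_mul (by positivity), mul_inv_cancel₀ (by positivity), ENNReal.ofReal_one,
    one_mul]

theorem weightedDist_rescale_le (ρ : EuclideanSpace ℝ (Fin n) → ℝ≥0∞)
    (c : EuclideanSpace ℝ (Fin n)) {r : ℝ} (hr : 0 < r) (u v : EuclideanSpace ℝ (Fin n)) :
    weightedDist ρ (c + r • u) (c + r • v) ≤
      weightedDist (fun w => ENNReal.ofReal r * ρ (c + r • w)) u v := by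
  refine weightedDist_comp_le (φ := fun w => c + r • w) hr (fun x y => ?_) u v
  rw [dist_add_left, dist_smul₀, Real.norm_eq_abs, abs_of_pos hr]

/-- If a weight has small energy in a thick ring, then all large sets are joined, inside that ring,
to a common point by short curves. -/
theorem exists_hub (hn : 2 ≤ n) {ε : ℝ≥0∞} (hε : ε ≠ 0) :
    ∃ (N : ℕ) (η : ℝ≥0∞), η ≠ 0 ∧ ∀ (c : EuclideanSpace ℝ (Fin n)) (r : ℝ), 0 < r →
      ∀ ρ : EuclideanSpace ℝ (Fin n) → ℝ≥0∞, Measurable ρ →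
      ∫⁻ z in boxRing c (r / 2 ^ N) (2 ^ N * r), ρ z ^ n ≤ η →
      ∃ d : EuclideanSpace ℝ (Fin n),
        (∀ r' ∈ Icc (r / 2) (2 * r), IsLargeAt c r' {z |
          JoinedIn {w | w ∈ boxRing c (r / 2 ^ N) (2 ^ N * r) ∧ weightedDist ρ d w < ε} d z}) ∧
        ∀ A, IsLargeAt c r A → ∃ p ∈ A,
          JoinedIn {w | w ∈ boxRing c (r / 2 ^ N) (2 ^ N * r) ∧ weightedDist ρ d w < ε} d p := by
  -- The barriers used below have height 1 and confine only balls of radius at most 1.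
  wlog hε1 : ε ≤ 1 generalizing ε
  · obtain ⟨N, η, hη, h⟩ := this one_ne_zero le_rfl
    refine ⟨N, η, hη, fun c r hr ρ hρ hi => ?_⟩
    obtain ⟨d, h1, h2⟩ := h c r hr ρ hρ hi
    have hsub : {w | w ∈ boxRing c (r / 2 ^ N) (2 ^ N * r) ∧ weightedDist ρ d w < 1} ⊆
        {w | w ∈ boxRing c (r / 2 ^ N) (2 ^ N * r) ∧ weightedDist ρ d w < ε} := fun w hw =>
      ⟨hw.1, hw.2.trans (not_le.1 hε1)⟩
    refine ⟨d, fun r' hr' => ?_, fun A hA => ?_⟩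
    · obtain ⟨i, hi⟩ := h1 r' hr'
      refine ⟨i, hi.trans (measure_mono ?_)⟩
      rintro t ⟨p, hp, hpt⟩
      exact ⟨p, JoinedIn.mono hp hsub, hpt⟩
    · obtain ⟨p, hp, hj⟩ := h2 A hA
      exact ⟨p, hp, hj.mono hsub⟩
  obtain ⟨m, rfl⟩ : ∃ m, n = m + 1 := ⟨n - 1, by omega⟩
  set δ : ℝ := 1 / (2 * (m + 1 : ℕ)) with hδ
  have hδ0 : 0 < δ := by positivity
  obtain ⟨η₀, hη₀, hL⟩ := exists_diagonal_near m (ε := ε / 2) (δ := ENNReal.ofReal δ) (H := 10)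
    (ENNReal.half_pos hε).ne' (by simpa using hδ0) (by norm_num)
  have hη3 : η₀ / 3 ≠ 0 := (ENNReal.div_pos hη₀ (by simp)).ne'
  obtain ⟨N, hN, hring⟩ := exists_ring_weight hn hη3
  refine ⟨N + 2, η₀ / 3, hη3, fun c r hr ρ hρ hi => ?_⟩
  set R := boxRing c (r / 2 ^ (N + 2)) (2 ^ (N + 2) * r) with hR
  have hRm : MeasurableSet R := (isClosed_boxRing _ _ _).measurableSet
  -- The hub will have distance between `2 * r` and `4 * r` from `c`. The first barrier prevents
  -- going inward from `2 * r` to `2 * r / 2 ^ N`, the second going outward from `4 * r` to `2 ^ N *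
  -- (4 * r)`. So short curves from the hub stay in the ring, where `ρ'` dominates `ρ`.
  obtain ⟨ω₁, hω₁, hi₁, hc₁⟩ := hring c (2 * r / 2 ^ N) (by positivity)
  obtain ⟨ω₂, hω₂, hi₂, hc₂⟩ := hring c (4 * r) (by positivity)
  set ρ' : EuclideanSpace ℝ (Fin (m + 1)) → ℝ≥0∞ :=
    fun z => max (R.indicator ρ z) (max (ω₁ z) (ω₂ z)) with hρ'
  have hρ'm : Measurable ρ' := (hρ.indicator hRm).max (hω₁.max hω₂)
  have henergy : ∫⁻ z, ρ' z ^ (m + 1) ≤ η₀ := by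
    refine (lintegral_max_pow_le (hρ.indicator hRm)).trans ?_
    refine (add_le_add le_rfl (lintegral_max_pow_le hω₁)).trans ?_
    have h1 : ∫⁻ z, R.indicator ρ z ^ (m + 1) = ∫⁻ z in R, ρ z ^ (m + 1) := by
      rw [← lintegral_indicator hRm]
      refine lintegral_congr fun z => ?_
      by_cases hz : z ∈ R <;> simp [hz]
    rw [h1, ← add_assoc]
    exact (add_le_add (add_le_add hi hi₁) hi₂).trans_eq (ENNReal.add_thirds η₀)
  obtain ⟨y, hy, hdiag, hnear⟩ := hL (fun w => ENNReal.ofReal r * ρ' (c + r • w))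
    ((hρ'm.comp (Continuous.measurable (by fun_prop))).const_mul _)
    ((lintegral_rescale_pow ρ' c hr).trans_le henergy)
  -- As `boxNorm y ≤ 1`, the shift by 3 puts `u₀` at box norm between 2 and 4.
  set u₀ := y + (3 : ℝ) • diagonal (m + 1)
  set d := c + r • u₀ with hd
  have hu₀ : ∀ s : ℝ, 0 ≤ s → s - 1 ≤ boxNorm (y + s • diagonal (m + 1)) ∧
      boxNorm (y + s • diagonal (m + 1)) ≤ s + 1 := fun s hs => by
    have h1 := boxNorm_add_le y (s • diagonal (m + 1))
    rw [boxNorm_smul, abs_of_nonneg hs] at h1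
    have h2 := boxNorm_diagonal_le (n := m + 1)
    have h3 := abs_apply_le_boxNorm (y + s • diagonal (m + 1)) 0
    have h4 := (abs_apply_le_boxNorm y 0).trans hy
    simp only [PiLp.add_apply, PiLp.smul_apply, diagonal_apply, smul_eq_mul, mul_one] at h3
    constructor
    · linarith [(abs_le.1 h4).1, le_abs_self (y 0 + s)]
    · nlinarith
  have hbox : ∀ u : EuclideanSpace ℝ (Fin (m + 1)), boxNorm (c + r • u - c) = r * boxNorm u :=
    fun u => by rw [add_sub_cancel_left, boxNorm_smul, abs_of_pos hr]
  have hdbox : 2 * r ≤ boxNorm (d - c) ∧ boxNorm (d - c) ≤ 4 * r := by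
    rw [hd, hbox]
    have := hu₀ 3 (by norm_num)
    constructor <;> nlinarith [this.1, this.2]
  have hmem : ∀ z, weightedDist ρ' d z < ε → z ∈ R := fun z hz => by
    have hz1 : weightedDist ρ' d z < 1 := hz.trans_le hε1
    constructor
    · by_contra! hlt
      have h1 : boxNorm (z - c) ≤ 2 * r / 2 ^ N := by
        refine hlt.le.trans ?_
        rw [pow_add]
        gcongr
        · linarith
        · exact le_mul_of_one_le_right (by positivity) (by norm_num)
      have h2 := hc₁ z d h1 (by rw [mul_div_cancel₀ _ (by positivity)]; exact hdbox.1)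
      rw [weightedDist_comm] at h2
      refine absurd (h2.trans (weightedDist_mono (fun w => ?_) d z)) (not_le.2 hz1)
      exact (le_max_left _ _).trans (le_max_right _ _)
    · by_contra! hlt
      have h1 : 2 ^ N * (4 * r) ≤ boxNorm (z - c) := by
        refine le_trans (le_of_eq ?_) hlt.le
        rw [pow_add]; ring
      have h2 := hc₂ d z hdbox.2 h1
      refine absurd (h2.trans (weightedDist_mono (fun w => ?_) d z)) (not_le.2 hz1)
      exact (le_max_right _ _).trans (le_max_right _ _)
  have hjoin : ∀ z, weightedDist ρ' d z < ε →
      JoinedIn {w | w ∈ R ∧ weightedDist ρ d w < ε} d z := fun z hz => by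
    refine (joinedIn_of_weightedDist_lt hz).mono fun w hw => ⟨hmem w hw, ?_⟩
    refine weightedDist_lt_of_le_on (fun x hx => ?_) hw
    have : ρ x = R.indicator ρ x := (indicator_of_mem (hmem x hx) ρ).symm
    rw [this]
    exact le_max_left _ _
  have hdist : ∀ u, weightedDist (fun w => ENNReal.ofReal r * ρ' (c + r • w)) y u < ε / 2 →
      weightedDist ρ' d (c + r • u) < ε := fun u hu => by
    refine (weightedDist_rescale_le ρ' c hr u₀ u).trans_lt ?_
    refine (weightedDist_triangle_left _ _ _ y).trans_lt ?_
    have h1 := hdiag 3 (by norm_num)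
    refine (ENNReal.add_lt_add h1 hu).trans_eq (ENNReal.add_halves ε)
  refine ⟨d, fun r' hr' => ⟨0, ?_⟩, fun A hA => ?_⟩
  · have hsub : Icc (c 0 + r) (c 0 + 2 * r) ⊆ {t : ℝ | ∃ p ∈ {z |
        JoinedIn {w | w ∈ R ∧ weightedDist ρ d w < ε} d z}, p 0 = t ∧
          p ∈ boxRing c (r' / 10) (10 * r')} := by
      intro t ht
      set s : ℝ := (t - c 0) / r - y 0 with hs
      have hy0 := abs_le.1 ((abs_apply_le_boxNorm y 0).trans hy)
      have ht1 : 1 ≤ (t - c 0) / r := by rw [le_div_iff₀ hr]; linarith [ht.1]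
      have ht2 : (t - c 0) / r ≤ 2 := by rw [div_le_iff₀ hr]; linarith [ht.2]
      have hs0 : 0 ≤ s := by linarith
      have hs3 : s ≤ 3 := by linarith
      refine ⟨c + r • (y + s • diagonal (m + 1)), hjoin _ (hdist _ (hdiag s ?_)), ?_, ?_⟩
      · rw [abs_of_nonneg hs0]; linarith
      · simp [hs]
        field_simp
        ring
      · have hb := (hu₀ s hs0).2
        have hlow : 1 ≤ boxNorm (y + s • diagonal (m + 1)) := by
          have h3 := abs_apply_le_boxNorm (y + s • diagonal (m + 1)) 0
          simp only [PiLp.add_apply, PiLp.smul_apply, diagonal_apply, smul_eq_mul, mul_one] at h3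
          have h4 := le_abs_self (y 0 + s)
          linarith
        constructor
        · rw [hbox]; nlinarith [hr'.2]
        · rw [hbox]; nlinarith [hr'.1]
    refine le_trans ?_ (measure_mono hsub)
    rw [Real.volume_Icc]
    refine ENNReal.ofReal_le_ofReal ?_
    have hm : (1 : ℝ) ≤ (m + 1 : ℕ) := by exact_mod_cast Nat.succ_le_succ (Nat.zero_le m)
    rw [div_le_iff₀ (by positivity)]
    nlinarith [hr'.2]
  · obtain ⟨i, hi⟩ := hA
    set A₁ : Set (EuclideanSpace ℝ (Fin (m + 1))) := {u | c + r • u ∈ A ∧ 1 / 10 ≤ boxNorm u}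
    have hT : {t : ℝ | ∃ p ∈ A₁, p i = t ∧ boxNorm p ≤ 10} = (fun t => r * t) ⁻¹'
        ((fun t => c i + t) ⁻¹' {t : ℝ | ∃ p ∈ A, p i = t ∧ p ∈ boxRing c (r / 10) (10 * r)}) := by
      ext t
      constructor
      · rintro ⟨p, ⟨hp, hp1⟩, rfl, hp2⟩
        refine ⟨_, hp, by simp, ?_, ?_⟩
        · rw [hbox]; nlinarith
        · rw [hbox]; nlinarith
      · rintro ⟨p, hp, hpi, hp1, hp2⟩
        have hpe : c + r • (r⁻¹ • (p - c)) = p := by rw [smul_inv_smul₀ hr.ne']; abel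
        have hb : boxNorm (r⁻¹ • (p - c)) = r⁻¹ * boxNorm (p - c) := by
          rw [boxNorm_smul, abs_of_pos (by positivity)]
        refine ⟨r⁻¹ • (p - c), ⟨by rw [hpe]; exact hp, ?_⟩, ?_, ?_⟩
        · rw [hb, inv_mul_eq_div, le_div_iff₀ hr]; linarith
        · simp [hpi, hr.ne']
        · rw [hb, inv_mul_eq_div, div_le_iff₀ hr]; linarith
    have hvol : ENNReal.ofReal δ ≤ volume {t : ℝ | ∃ p ∈ A₁, p i = t ∧ boxNorm p ≤ 10} := by
      rw [hT, Real.volume_preimage_mul_left hr.ne', measure_preimage_add]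
      refine le_trans ?_ (mul_le_mul_right hi _)
      rw [← ENNReal.ofReal_mul (abs_nonneg _), abs_of_pos (by positivity)]
      refine ENNReal.ofReal_le_ofReal (le_of_eq ?_)
      rw [hδ]
      field_simp
    obtain ⟨p, hp, -, hlt⟩ := hnear A₁ i hvol
    exact ⟨_, hp.1, hjoin _ (hdist p hlt)⟩

end

/-! ### Neighborhoods and scales in the Möbius space, treating finite points and `∞` alike. -/

section

variable {n : ℕ}

section Neighborhoods

theorem mem_nhds_coe_iff {c : EuclideanSpace ℝ (Fin n)} {U : Set (MobiusSpace n)} :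
    U ∈ 𝓝 (c : MobiusSpace n) ↔ ∃ a > 0, ∀ z : EuclideanSpace ℝ (Fin n),
      boxNorm (z - c) < a → (z : MobiusSpace n) ∈ U := by
  rw [OnePoint.nhds_coe_eq, mem_map]
  constructor
  · intro h
    obtain ⟨a, ha, hsub⟩ := Metric.mem_nhds_iff.1 h
    refine ⟨a / (n + 1), by positivity, fun z hz => hsub ?_⟩
    rw [Metric.mem_ball, dist_eq_norm]
    rw [lt_div_iff₀ (by positivity)] at hz
    have h1 := norm_le_mul_boxNorm (z - c)
    have h2 := norm_nonneg (z - c)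
    have h3 := boxNorm_nonneg (z - c)
    rcases h3.eq_or_lt with h4 | h4
    · rw [← h4] at h1; linarith
    · nlinarith
  · rintro ⟨a, ha, h⟩
    refine Metric.mem_nhds_iff.2 ⟨a, ha, fun z hz => h z ?_⟩
    rw [Metric.mem_ball, dist_eq_norm] at hz
    exact (boxNorm_le_norm _).trans_lt hz

theorem mem_nhds_infty_iff {U : Set (MobiusSpace n)} :
    U ∈ 𝓝 (OnePoint.infty : MobiusSpace n) ↔ OnePoint.infty ∈ U ∧
      ∃ a > 0, ∀ z : EuclideanSpace ℝ (Fin n), a < boxNorm z → (z : MobiusSpace n) ∈ U := by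
  rw [OnePoint.nhds_infty_eq, mem_sup, mem_map, mem_pure, coclosedCompact_eq_cocompact,
    and_comm]
  refine and_congr_right fun _ => ?_
  constructor
  · intro h
    obtain ⟨K, hK, hKU⟩ := mem_cocompact.1 h
    obtain ⟨a, hKa⟩ := hK.isBounded.subset_closedBall 0
    refine ⟨max a 1, by positivity, fun z hz => hKU fun hzK => ?_⟩
    have h1 := hKa hzK
    rw [mem_closedBall_zero_iff] at h1
    exact absurd (h1.trans (le_max_left a 1)) (not_le.2 (hz.trans_le (boxNorm_le_norm z)))
  · rintro ⟨a, ha, h⟩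
    refine mem_of_superset (isCompact_closedBall 0 (n * a)).compl_mem_cocompact fun z hz => h z ?_
    simp only [mem_compl_iff, Metric.mem_closedBall, dist_zero_right, not_le] at hz
    have := hz.trans_le (norm_le_mul_boxNorm z)
    exact lt_of_mul_lt_mul_left this (by positivity)

/-- The distance to `c` in the maximum norm, cut off at `M`, on the Möbius space. -/
def boxLevel (c : EuclideanSpace ℝ (Fin n)) (M : ℝ) : MobiusSpace n → ℝ :=
  fun x => OnePoint.elim x M fun z => min (boxNorm (z - c)) M

theorem boxLevel_coe (c z : EuclideanSpace ℝ (Fin n)) (M : ℝ) :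
    boxLevel c M z = min (boxNorm (z - c)) M := rfl

theorem boxLevel_infty (c : EuclideanSpace ℝ (Fin n)) (M : ℝ) :
    boxLevel c M OnePoint.infty = M := rfl

theorem continuous_boxLevel (c : EuclideanSpace ℝ (Fin n)) (M : ℝ) :
    Continuous (boxLevel c M) := by
  rw [OnePoint.continuous_iff]
  constructor
  · refine tendsto_const_nhds.congr' ?_
    rw [coclosedCompact_eq_cocompact]
    have h := (isCompact_closedBall c (n * |M|)).compl_mem_cocompact
    filter_upwards [h] with z hz
    simp only [mem_compl_iff, Metric.mem_closedBall, dist_eq_norm, not_le] at hz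
    have h1 := lt_of_mul_lt_mul_left (hz.trans_le (norm_le_mul_boxNorm (z - c))) (by positivity)
    rw [boxLevel_infty, boxLevel_coe, min_eq_right ((le_abs_self M).trans h1.le)]
  · exact (continuous_boxNorm_sub c).min continuous_const

theorem exists_coe_of_boxLevel_lt {c : EuclideanSpace ℝ (Fin n)} {M : ℝ} {x : MobiusSpace n}
    (h : boxLevel c M x < M) :
    ∃ z : EuclideanSpace ℝ (Fin n), (z : MobiusSpace n) = x ∧ boxNorm (z - c) = boxLevel c M x := by
  induction x using OnePoint.rec with
  | infty => simp [boxLevel_infty] at h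
  | coe z =>
    refine ⟨z, rfl, ?_⟩
    rw [boxLevel_coe] at h ⊢
    rcases min_lt_iff.1 h with h1 | h1
    · exact (min_eq_left h1.le).symm
    · exact absurd h1 (lt_irrefl _)

/-- The scales `s ^ k` around `c` shrink to the point `x` of the Möbius space. -/
structure IsScaleAt (x : MobiusSpace n) (c : EuclideanSpace ℝ (Fin n)) (s : ℝ) : Prop where
  eq_or : s = 1 / 2 ∨ s = 2
  ring_subset : ∀ U ∈ 𝓝 x, ∀ N : ℕ, ∃ k₀ : ℕ, ∀ k ≥ k₀,
    ∀ z ∈ boxRing c (s ^ k / 2 ^ N) (2 ^ N * s ^ k), (z : MobiusSpace n) ∈ U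
  ring_disjoint : ∀ k N : ℕ, ∃ V ∈ 𝓝 x,
    ∀ z ∈ boxRing c (s ^ k / 2 ^ N) (2 ^ N * s ^ k), (z : MobiusSpace n) ∉ V
  crosses : ∀ U ∈ 𝓝 x, ∃ k₀ : ℕ, ∀ k ≥ k₀, ∃ V ∈ 𝓝 x, ∀ A : Set (MobiusSpace n),
    IsPreconnected A → (A ∩ Uᶜ).Nonempty → (A ∩ V).Nonempty → IsLargeAt c (s ^ k) (finitePart A)

theorem IsScaleAt.pos {x : MobiusSpace n} {c : EuclideanSpace ℝ (Fin n)} {s : ℝ}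
    (h : IsScaleAt x c s) : 0 < s := by
  rcases h.eq_or with rfl | rfl <;> norm_num

/-- By the intermediate value theorem a connected set attains all levels in `[r, 2r]`. The cut-off
`4 * r` lies above them, so they are attained at finite points even if the set contains `∞`. -/
theorem isLargeAt_of_boxLevel (hn : 0 < n) {c : EuclideanSpace ℝ (Fin n)} {r : ℝ} (hr : 0 < r)
    {A : Set (MobiusSpace n)} (hA : IsPreconnected A) {u v : MobiusSpace n} (hu : u ∈ A)
    (hv : v ∈ A) (h1 : boxLevel c (4 * r) u ≤ r) (h2 : 2 * r ≤ boxLevel c (4 * r) v) :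
    IsLargeAt c r (finitePart A) := by
  refine isLargeAt_of_sphere hn hr fun t ht => ?_
  obtain ⟨w, hw, hwt⟩ := hA.intermediate_value hu hv (continuous_boxLevel c (4 * r)).continuousOn
    ⟨h1.trans ht.1, ht.2.trans h2⟩
  obtain ⟨z, rfl, hz⟩ := exists_coe_of_boxLevel_lt (c := c) (M := 4 * r) (x := w)
    (by rw [hwt]; linarith [ht.2])
  exact ⟨z, hw, hz.trans hwt⟩

theorem isScaleAt_coe (hn : 0 < n) (c : EuclideanSpace ℝ (Fin n)) : IsScaleAt (c : MobiusSpace n) c (1 / 2) where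
  eq_or := Or.inl rfl
  ring_subset U hU N := by
    obtain ⟨a, ha, h⟩ := mem_nhds_coe_iff.1 hU
    obtain ⟨k₀, hk₀⟩ := exists_pow_lt_of_lt_one (show 0 < a / 2 ^ N by positivity)
      (show (1 / 2 : ℝ) < 1 by norm_num)
    refine ⟨k₀, fun k hk z hz => h z (hz.2.trans_lt ?_)⟩
    have h1 : (1 / 2 : ℝ) ^ k ≤ (1 / 2) ^ k₀ :=
      pow_le_pow_of_le_one (by norm_num) (by norm_num) hk
    have h2 := h1.trans_lt hk₀
    rw [lt_div_iff₀ (by positivity)] at h2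
    linarith
  ring_disjoint k N := by
    refine ⟨_, mem_nhds_coe_iff.2 ⟨(1 / 2) ^ k / 2 ^ N, by positivity, fun z hz => mem_image_of_mem _
      (show z ∈ {z | boxNorm (z - c) < (1 / 2) ^ k / 2 ^ N} from hz)⟩, ?_⟩
    rintro z hz ⟨w, hw, hwz⟩
    rw [OnePoint.coe_eq_coe] at hwz
    subst hwz
    exact absurd hz.1 (not_le.2 hw)
  crosses U hU := by
    obtain ⟨a, ha, h⟩ := mem_nhds_coe_iff.1 hU
    obtain ⟨k₀, hk₀⟩ := exists_pow_lt_of_lt_one (show 0 < a / 2 by positivity)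
      (show (1 / 2 : ℝ) < 1 by norm_num)
    refine ⟨k₀, fun k hk => ?_⟩
    have hr : (0 : ℝ) < (1 / 2) ^ k := by positivity
    have hka : (1 / 2 : ℝ) ^ k ≤ (1 / 2) ^ k₀ :=
      pow_le_pow_of_le_one (by norm_num) (by norm_num) hk
    refine ⟨_, mem_nhds_coe_iff.2 ⟨(1 / 2) ^ k, hr, fun z hz => mem_image_of_mem _
      (show z ∈ {z | boxNorm (z - c) < (1 / 2) ^ k} from hz)⟩, fun A hA hAU hAV => ?_⟩
    obtain ⟨v, hvA, hvU⟩ := hAU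
    obtain ⟨_, huA, ⟨u, hu, rfl⟩⟩ := hAV
    refine isLargeAt_of_boxLevel hn hr hA huA hvA ((min_le_left _ _).trans (le_of_lt hu)) ?_
    induction v using OnePoint.rec with
    | infty => rw [boxLevel_infty]; linarith
    | coe z =>
      have hz : a ≤ boxNorm (z - c) := by
        by_contra! hlt
        exact hvU (h z hlt)
      rw [boxLevel_coe]
      refine le_min ?_ (by linarith)
      linarith

theorem isScaleAt_infty (hn : 0 < n) : IsScaleAt (OnePoint.infty : MobiusSpace n) 0 2 where
  eq_or := Or.inr rfl
  ring_subset U hU N := by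
    obtain ⟨-, a, ha, h⟩ := mem_nhds_infty_iff.1 hU
    obtain ⟨k₀, hk₀⟩ := pow_unbounded_of_one_lt (a * 2 ^ N) (one_lt_two (α := ℝ))
    refine ⟨k₀, fun k hk z hz => h z ?_⟩
    have h1 : (2 : ℝ) ^ k₀ ≤ 2 ^ k := pow_le_pow_right₀ one_le_two hk
    have h2 := hz.1
    rw [sub_zero, div_le_iff₀ (by positivity)] at h2
    exact lt_of_mul_lt_mul_right (hk₀.trans_le (h1.trans h2)) (by positivity)
  ring_disjoint k N := by
    refine ⟨{x | ∀ z : EuclideanSpace ℝ (Fin n), x = z → 2 ^ N * 2 ^ k < boxNorm z},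
      mem_nhds_infty_iff.2 ⟨fun z hz => absurd hz.symm (OnePoint.coe_ne_infty z),
        2 ^ N * 2 ^ k, by positivity, fun z hz w hw => ?_⟩, fun z hz hV => ?_⟩
    · rw [OnePoint.coe_eq_coe] at hw
      exact hw ▸ hz
    · have := hV z rfl
      have h2 := hz.2
      rw [sub_zero] at h2
      linarith
  crosses U hU := by
    obtain ⟨hUi, a, ha, h⟩ := mem_nhds_infty_iff.1 hU
    obtain ⟨k₀, hk₀⟩ := pow_unbounded_of_one_lt a (one_lt_two (α := ℝ))
    refine ⟨k₀, fun k hk => ?_⟩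
    have hr : (0 : ℝ) < 2 ^ k := by positivity
    have hka : (2 : ℝ) ^ k₀ ≤ 2 ^ k := pow_le_pow_right₀ one_le_two hk
    refine ⟨{x | 2 * 2 ^ k < boxLevel 0 (4 * 2 ^ k) x},
      (isOpen_lt continuous_const (continuous_boxLevel _ _)).mem_nhds ?_, fun A hA hAU hAV => ?_⟩
    · simp only [mem_ofPred_eq, boxLevel_infty]; linarith
    obtain ⟨v, hvA, hvU⟩ := hAU
    obtain ⟨u, huA, hu⟩ := hAV
    refine isLargeAt_of_boxLevel hn hr hA hvA huA ?_ (le_of_lt hu)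
    induction v using OnePoint.rec with
    | infty => exact absurd hUi hvU
    | coe z =>
      have hz : boxNorm z ≤ a := by
        by_contra! hlt
        exact hvU (h z hlt)
      rw [boxLevel_coe, sub_zero]
      exact (min_le_left _ _).trans (by linarith)

theorem exists_isScaleAt (hn : 0 < n) (x : MobiusSpace n) : ∃ c s, IsScaleAt x c s := by
  induction x using OnePoint.rec with
  | infty => exact ⟨0, 2, isScaleAt_infty hn⟩
  | coe c => exact ⟨c, 1 / 2, isScaleAt_coe hn c⟩

/-- It is long to leave a neighborhood from a much smaller one, for a weight of small energy. -/
theorem exists_barrier (hn : 2 ≤ n) {x : MobiusSpace n} {U : Set (MobiusSpace n)} (hU : U ∈ 𝓝 x)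
    {ε : ℝ≥0∞} (hε : ε ≠ 0) :
    ∃ V ∈ 𝓝 x, ∃ ω : EuclideanSpace ℝ (Fin n) → ℝ≥0∞, Measurable ω ∧ ∫⁻ z, ω z ^ n ≤ ε ∧
      ∀ p q : EuclideanSpace ℝ (Fin n), (p : MobiusSpace n) ∈ V → (q : MobiusSpace n) ∉ U →
        1 ≤ weightedDist ω p q := by
  obtain ⟨N, hN, h⟩ := exists_ring_weight hn hε
  induction x using OnePoint.rec with
  | infty =>
    obtain ⟨hUi, a, ha, hUa⟩ := mem_nhds_infty_iff.1 hU
    obtain ⟨ω, hω, hi, hc⟩ := h 0 a ha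
    refine ⟨{x | ∀ z : EuclideanSpace ℝ (Fin n), x = z → 2 ^ N * a < boxNorm z},
      mem_nhds_infty_iff.2 ⟨fun z hz => absurd hz.symm (OnePoint.coe_ne_infty z),
        2 ^ N * a, by positivity, fun z hz w hw => ?_⟩, ω, hω, hi, fun p q hp hq => ?_⟩
    · rw [OnePoint.coe_eq_coe] at hw
      exact hw ▸ hz
    · rw [weightedDist_comm]
      refine hc q p ?_ ?_
      · rw [sub_zero]
        by_contra! hlt
        exact hq (hUa q hlt)
      · rw [sub_zero]
        exact (hp p rfl).le
  | coe c =>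
    obtain ⟨a, ha, hUa⟩ := mem_nhds_coe_iff.1 hU
    obtain ⟨ω, hω, hi, hc⟩ := h c (a / 2 ^ N) (by positivity)
    refine ⟨_, mem_nhds_coe_iff.2 ⟨a / 2 ^ N, by positivity, fun z hz => mem_image_of_mem _
      (show z ∈ {z | boxNorm (z - c) < a / 2 ^ N} from hz)⟩, ω, hω, hi, fun p q hp hq => ?_⟩
    obtain ⟨w, hw, hwp⟩ := hp
    rw [OnePoint.coe_eq_coe] at hwp
    subst hwp
    refine hc w q (le_of_lt hw) ?_
    rw [mul_div_cancel₀ _ (by positivity)]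
    by_contra! hlt
    exact hq (hUa q hlt)

/-- Every point has arbitrarily small neighborhoods all of whose points are joined to it. -/
theorem exists_nhds_joinedIn {x : MobiusSpace n} {U : Set (MobiusSpace n)} (hU : U ∈ 𝓝 x) :
    ∃ V ∈ 𝓝 x, ∀ y ∈ V, JoinedIn U x y := by
  induction x using OnePoint.rec with
  | infty =>
    obtain ⟨hUi, a, ha, hUa⟩ := mem_nhds_infty_iff.1 hU
    refine ⟨{x | ∀ z : EuclideanSpace ℝ (Fin n), x = z → a < boxNorm z},
      mem_nhds_infty_iff.2 ⟨fun z hz => absurd hz.symm (OnePoint.coe_ne_infty z),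
        a, ha, fun z hz w hw => ?_⟩, fun y hy => ?_⟩
    · rw [OnePoint.coe_eq_coe] at hw
      exact hw ▸ hz
    induction y using OnePoint.rec with
    | infty => exact JoinedIn.refl hUi
    | coe z =>
      have hz : a < boxNorm z := hy z rfl
      -- The radial ray from `z` to `∞`, along which the norm only grows.
      set f : ℝ → MobiusSpace n := fun t => if t ≤ 0 then OnePoint.infty else (t⁻¹ • z : _) with hf
      refine JoinedIn.ofLine (f := f) (fun t ht => ?_) (by simp [hf]) (by simp [hf]) ?_
      · rcases ht.1.eq_or_lt with h0 | h0
        · subst h0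
          intro W hW
          have hf0 : f 0 = OnePoint.infty := by simp [hf]
          rw [hf0] at hW
          obtain ⟨hWi, b, hb, hWb⟩ := mem_nhds_infty_iff.1 hW
          have hev : ∀ᶠ t in 𝓝[I] (0 : ℝ), t < boxNorm z / b :=
            mem_nhdsWithin_of_mem_nhds (Iio_mem_nhds (div_pos (ha.trans hz) hb))
          rw [mem_map]
          filter_upwards [hev] with t ht
          by_cases h : t ≤ 0
          · simpa [hf, h] using hWi
          · push Not at h
            have : f t = ((t⁻¹ • z : EuclideanSpace ℝ (Fin n)) : MobiusSpace n) := by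
              simp [hf, not_le.2 h]
            rw [mem_preimage, this]
            refine hWb _ ?_
            rw [boxNorm_smul, abs_of_pos (by positivity), inv_mul_eq_div, lt_div_iff₀ h]
            rw [lt_div_iff₀ hb] at ht
            linarith
        · have h1 : ContinuousAt (fun t : ℝ =>
              ((t⁻¹ • z : EuclideanSpace ℝ (Fin n)) : MobiusSpace n)) t := by
            refine OnePoint.continuous_coe.continuousAt.comp ?_
            exact (continuousAt_inv₀ h0.ne').smul continuousAt_const
          refine (h1.congr ?_).continuousWithinAt
          filter_upwards [Ioi_mem_nhds h0] with u hu
          simp [hf, not_le.2 (mem_Ioi.1 hu)]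
      · rintro _ ⟨t, ht, rfl⟩
        by_cases h : t ≤ 0
        · simpa [hf, h] using hUi
        · have h' := not_le.1 h
          have : f t = ((t⁻¹ • z : EuclideanSpace ℝ (Fin n)) : MobiusSpace n) := by simp [hf, h]
          rw [this]
          refine hUa _ ?_
          rw [boxNorm_smul, abs_of_pos (by positivity), inv_mul_eq_div, lt_div_iff₀ h']
          have := ht.2
          nlinarith
  | coe c =>
    obtain ⟨a, ha, hUa⟩ := mem_nhds_coe_iff.1 hU
    refine ⟨_, mem_nhds_coe_iff.2 ⟨a, ha, fun z hz => mem_image_of_mem _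
      (show z ∈ {z | boxNorm (z - c) < a} from hz)⟩, ?_⟩
    rintro _ ⟨z, hz, rfl⟩
    refine JoinedIn.ofLine (f := fun t : ℝ =>
      ((c + t • (z - c) : EuclideanSpace ℝ (Fin n)) : MobiusSpace n)) ?_ (by simp) (by simp) ?_
    · exact (OnePoint.continuous_coe.comp (by fun_prop)).continuousOn
    · rintro _ ⟨t, ht, rfl⟩
      refine hUa _ ?_
      rw [add_sub_cancel_left, boxNorm_smul, abs_of_nonneg ht.1]
      have h1 : boxNorm (z - c) < a := hz
      have h2 := boxNorm_nonneg (z - c)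
      nlinarith [ht.1, ht.2]

end Neighborhoods

end

/-! ### Connectors between crossing sets, and absolute continuity of the energy. -/

section

variable {n : ℕ}

theorem disjoint_boxRing_of_lt {c : EuclideanSpace ℝ (Fin n)} {a b a' b' : ℝ} (h : b < a') :
    Disjoint (boxRing c a b) (boxRing c a' b') :=
  disjoint_left.2 fun _ h1 h2 => absurd (h2.1.trans h1.2) (not_le.2 h)

/-- Each ring spans a factor `2 ^ (2 * N)` of radii, so taking every `(2 * N + 1)`-th scale leaves a
gap of factor 2. -/
theorem pairwise_disjoint_boxRing (c : EuclideanSpace ℝ (Fin n)) {s : ℝ} (hs : s = 1 / 2 ∨ s = 2)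
    (N k₀ : ℕ) : Pairwise (Function.onFun Disjoint fun l : ℕ =>
      boxRing c (s ^ (k₀ + (2 * N + 1) * l) / 2 ^ N) (2 ^ N * s ^ (k₀ + (2 * N + 1) * l))) := by
  rw [pairwise_disjoint_on]
  intro l l' hl
  obtain ⟨j, rfl⟩ : ∃ j, l' = l + 1 + j := ⟨l' - (l + 1), by omega⟩
  have hpow : (2 : ℝ) ^ (2 * N + 1) ≤ 2 ^ ((2 * N + 1) * (1 + j)) :=
    pow_le_pow_right₀ one_le_two (Nat.le_mul_of_pos_right _ (by omega))
  have h2N : (2 : ℝ) ^ (2 * N + 1) = 2 ^ N * 2 ^ N * 2 := by ring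
  have hNpos : (0 : ℝ) < 2 ^ N := by positivity
  have hexp : k₀ + (2 * N + 1) * (l + 1 + j) = (k₀ + (2 * N + 1) * l) + (2 * N + 1) * (1 + j) := by
    ring
  rcases hs with rfl | rfl
  · refine (disjoint_boxRing_of_lt ?_).symm
    rw [hexp, pow_add (1 / 2 : ℝ) (k₀ + (2 * N + 1) * l)]
    set x : ℝ := (1 / 2) ^ (k₀ + (2 * N + 1) * l)
    have hx : 0 < x := by positivity
    rw [lt_div_iff₀ hNpos, one_div_pow ]
    calc 2 ^ N * (x * (1 / 2 ^ ((2 * N + 1) * (1 + j)))) * 2 ^ N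
        ≤ 2 ^ N * (x * (1 / 2 ^ (2 * N + 1))) * 2 ^ N := by gcongr
      _ = x / 2 := by rw [h2N]; field_simp
      _ < x := by linarith
  · refine disjoint_boxRing_of_lt ?_
    rw [hexp, pow_add (2 : ℝ) (k₀ + (2 * N + 1) * l)]
    set x : ℝ := 2 ^ (k₀ + (2 * N + 1) * l)
    have hx : 0 < x := by positivity
    rw [lt_div_iff₀ hNpos]
    calc 2 ^ N * x * 2 ^ N < x * 2 ^ (2 * N + 1) := by rw [h2N]; nlinarith [mul_pos hNpos hNpos]
      _ ≤ _ := by gcongr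

/-- Two connected sets that cross a very thick ring around `x` are joined, inside this ring, by a
curve that is short for a weight of bounded energy. -/
theorem exists_connector (hn : 2 ≤ n) {x : MobiusSpace n} {U : Set (MobiusSpace n)} (hU : U ∈ 𝓝 x)
    {R ε : ℝ≥0∞} (hR : R ≠ ∞) (hε : ε ≠ 0) :
    ∃ V ∈ 𝓝 x, ∀ ρ : EuclideanSpace ℝ (Fin n) → ℝ≥0∞, Measurable ρ → ∫⁻ z, ρ z ^ n ≤ R →
      ∀ A B : Set (MobiusSpace n), IsPreconnected A → IsPreconnected B → (A ∩ Uᶜ).Nonempty →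
      (A ∩ V).Nonempty → (B ∩ Uᶜ).Nonempty → (B ∩ V).Nonempty →
      ∃ p q : EuclideanSpace ℝ (Fin n), (p : MobiusSpace n) ∈ A ∧ (q : MobiusSpace n) ∈ B ∧
        JoinedIn {w : EuclideanSpace ℝ (Fin n) | (w : MobiusSpace n) ∈ U ∧
          (w : MobiusSpace n) ∉ V ∧ weightedDist ρ p w < ε} p q := by
  obtain ⟨c, s, hs⟩ := exists_isScaleAt (by omega) x
  obtain ⟨N, η, hη, hhub⟩ := exists_hub hn (ENNReal.half_pos hε).ne'
  obtain ⟨k₁, hk₁⟩ := hs.ring_subset U hU N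
  obtain ⟨k₂, hk₂⟩ := hs.crosses U hU
  -- Among `M` disjoint rings one must have energy at most `η`, as the total is at most `R`. `V`
  -- depends on `R` only, since the good ring is chosen after `V`.
  obtain ⟨M, hM⟩ : ∃ M : ℕ, R < M * η := by
    rcases eq_or_ne η ∞ with rfl | hη'
    · exact ⟨1, by simpa using hR.lt_top⟩
    · obtain ⟨M, hM⟩ := ENNReal.exists_nat_gt (ENNReal.div_lt_top hR hη).ne
      exact ⟨M, (ENNReal.div_lt_iff (Or.inl hη) (Or.inl hη')).1 hM⟩
  set κ : ℕ → ℕ := fun l => max k₁ k₂ + (2 * N + 1) * l with hκ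
  have hκ1 : ∀ l, k₁ ≤ κ l := fun l => (le_max_left _ _).trans (Nat.le_add_right _ _)
  have hκ2 : ∀ l, k₂ ≤ κ l := fun l => (le_max_right _ _).trans (Nat.le_add_right _ _)
  choose V₁ hV₁ hV₁d using fun l => hs.ring_disjoint (κ l) N
  choose V₂ hV₂ hV₂c using fun l => hk₂ (κ l) (hκ2 l)
  set Rg : ℕ → Set (EuclideanSpace ℝ (Fin n)) :=
    fun l => boxRing c (s ^ κ l / 2 ^ N) (2 ^ N * s ^ κ l) with hRg
  refine ⟨⋂ l ∈ Finset.range M, V₁ l ∩ V₂ l,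
    (biInter_finset_mem _).2 fun l _ => inter_mem (hV₁ l) (hV₂ l), ?_⟩
  intro ρ hρ hi A B hA hB hAU hAV hBU hBV
  obtain ⟨l, hl, hle⟩ : ∃ l ∈ Finset.range M, ∫⁻ z in Rg l, ρ z ^ n ≤ η := by
    by_contra! hcon
    have h1 : ∑ l ∈ Finset.range M, ∫⁻ z in Rg l, ρ z ^ n =
        ∫⁻ z in ⋃ l ∈ Finset.range M, Rg l, ρ z ^ n :=
      (lintegral_biUnion_finset
        (fun i _ j _ hij => pairwise_disjoint_boxRing c hs.eq_or N (max k₁ k₂) hij)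
        (fun l _ => (isClosed_boxRing _ _ _).measurableSet) _).symm
    have h2 : ∑ _l ∈ Finset.range M, η ≤ ∑ l ∈ Finset.range M, ∫⁻ z in Rg l, ρ z ^ n :=
      Finset.sum_le_sum fun l hl => (hcon l hl).le
    rw [h1, Finset.sum_const, Finset.card_range, nsmul_eq_mul] at h2
    exact absurd ((h2.trans (setLIntegral_le_lintegral _ _)).trans hi) (not_le.2 hM)
  obtain ⟨d, -, hd⟩ := hhub c (s ^ κ l) (pow_pos hs.pos _) ρ hρ hle
  have hVl : (⋂ l ∈ Finset.range M, V₁ l ∩ V₂ l) ⊆ V₁ l ∩ V₂ l := biInter_subset_of_mem hl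
  obtain ⟨p, hpA, hp⟩ := hd (finitePart A) (hV₂c l A hA hAU
    (hAV.mono (inter_subset_inter_right _ (hVl.trans inter_subset_right))))
  obtain ⟨q, hqB, hq⟩ := hd (finitePart B) (hV₂c l B hB hBU
    (hBV.mono (inter_subset_inter_right _ (hVl.trans inter_subset_right))))
  refine ⟨p, q, hpA, hqB, (hp.symm.trans hq).mono fun w hw => ⟨?_, ?_, ?_⟩⟩
  · exact hk₁ _ (hκ1 l) w hw.1
  · exact fun hwV => hV₁d l w hw.1 (hVl hwV).1
  · exact (weightedDist_triangle_left ρ p w d).trans_lt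
      ((ENNReal.add_lt_add hp.target_mem.2 hw.2).trans_eq (ENNReal.add_halves ε))

/-- Continuity from above of the finite measure with density `f`. -/
theorem exists_setLIntegral_le_of_antitone {X : Type*} [MeasurableSpace X] {μ : Measure X}
    {f : X → ℝ≥0∞} (hf : ∫⁻ x, f x ∂μ ≠ ∞) {S : ℕ → Set X} (hS : Antitone S)
    (hSm : ∀ k, MeasurableSet (S k)) (h0 : μ (⋂ k, S k) = 0) {ε : ℝ≥0∞} (hε : ε ≠ 0) :
    ∃ k, ∫⁻ x in S k, f x ∂μ ≤ ε := by
  have hfin : IsFiniteMeasure (μ.withDensity f) := isFiniteMeasure_withDensity hf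
  have h1 := tendsto_measure_iInter_atTop (μ := μ.withDensity f)
    (fun k => (hSm k).nullMeasurableSet) hS ⟨0, measure_ne_top _ _⟩
  rw [withDensity_absolutelyContinuous μ f h0] at h1
  obtain ⟨k, hk⟩ := (h1.eventually (ge_mem_nhds (pos_iff_ne_zero.2 hε))).exists
  exact ⟨k, by rwa [Function.comp_apply, withDensity_apply _ (hSm k)] at hk⟩

/-- A weight of finite energy has small energy near every point. -/
theorem exists_nhds_energy_le (hn : 0 < n) (x : MobiusSpace n)
    {ρ : EuclideanSpace ℝ (Fin n) → ℝ≥0∞} (hi : ∫⁻ z, ρ z ^ n ≠ ∞) {ε : ℝ≥0∞}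
    (hε : ε ≠ 0) : ∃ U ∈ 𝓝 x, ∫⁻ z in finitePart U, ρ z ^ n ≤ ε := by
  induction x using OnePoint.rec with
  | infty =>
    obtain ⟨k, hk⟩ := exists_setLIntegral_le_of_antitone hi
      (S := fun k : ℕ => {z : EuclideanSpace ℝ (Fin n) | (k : ℝ) < boxNorm (z - 0)})
      (fun k l hkl z hz => by
        have hz' : (l : ℝ) < boxNorm (z - 0) := hz
        exact lt_of_le_of_lt (Nat.cast_le.2 hkl) hz')
      (fun k => (isOpen_lt continuous_const (continuous_boxNorm_sub 0)).measurableSet) (by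
        have : (⋂ k : ℕ, {z : EuclideanSpace ℝ (Fin n) | (k : ℝ) < boxNorm (z - 0)}) = ∅ := by
          refine eq_empty_of_forall_notMem fun z hz => ?_
          obtain ⟨k, hk⟩ := exists_nat_gt (boxNorm (z - 0))
          exact lt_asymm hk (mem_iInter.1 hz k)
        rw [this, measure_empty]) hε
    refine ⟨{x | ∀ z : EuclideanSpace ℝ (Fin n), x = z → (k : ℝ) < boxNorm z},
      mem_nhds_infty_iff.2 ⟨fun z hz => absurd hz.symm (OnePoint.coe_ne_infty z),
        k + 1, by positivity, fun z hz w hw => ?_⟩, (lintegral_mono_set fun z hz => ?_).trans hk⟩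
    · rw [OnePoint.coe_eq_coe] at hw
      rw [← hw]
      linarith
    · have := hz z rfl
      rwa [← sub_zero z] at this
  | coe c =>
    have : Nonempty (Fin n) := ⟨⟨0, hn⟩⟩
    obtain ⟨k, hk⟩ := exists_setLIntegral_le_of_antitone hi
      (S := fun k : ℕ => {z : EuclideanSpace ℝ (Fin n) | boxNorm (z - c) < 1 / ((k : ℝ) + 1)})
      (fun k l hkl z hz => by
        have hz' : boxNorm (z - c) < 1 / ((l : ℝ) + 1) := hz
        exact lt_of_lt_of_le hz' (Nat.one_div_le_one_div hkl))
      (fun k => (isOpen_lt (continuous_boxNorm_sub c) continuous_const).measurableSet) (by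
        refine measure_mono_null (t := {c}) (fun z hz => ?_) (measure_singleton c)
        have h1 : boxNorm (z - c) ≤ 0 := by
          by_contra! hlt
          obtain ⟨k, hk⟩ := exists_nat_one_div_lt hlt
          exact lt_asymm hk (mem_iInter.1 hz k)
        have h2 := norm_le_mul_boxNorm (z - c)
        have h3 : ‖z - c‖ ≤ 0 := h2.trans (mul_nonpos_of_nonneg_of_nonpos (by positivity) h1)
        exact sub_eq_zero.1 (norm_le_zero_iff.1 h3)) hε
    refine ⟨_, mem_nhds_coe_iff.2 ⟨1 / ((k : ℝ) + 1), by positivity, fun z hz => mem_image_of_mem _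
      (show z ∈ {z | boxNorm (z - c) < 1 / ((k : ℝ) + 1)} from hz)⟩, ?_⟩
    rwa [finitePart, preimage_image_eq _ OnePoint.coe_injective]

/-- Every neighborhood, even of `∞`, contains a Euclidean box, so its first coordinate fills an
interval; this makes it visible to the slicing argument. -/
theorem exists_box_subset_of_mem_nhds (hn : 0 < n) {y : MobiusSpace n} {V : Set (MobiusSpace n)}
    (hV : V ∈ 𝓝 y) : ∃ (b : EuclideanSpace ℝ (Fin n)) (a : ℝ), 0 < a ∧
      ∀ z : EuclideanSpace ℝ (Fin n), boxNorm (z - b) < a → (z : MobiusSpace n) ∈ V := by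
  induction y using OnePoint.rec with
  | infty =>
    obtain ⟨-, a, ha, h⟩ := mem_nhds_infty_iff.1 hV
    refine ⟨(a + 1) • diagonal n, 1, one_pos, fun z hz => h z ?_⟩
    have h1 := (abs_apply_le_boxNorm (z - (a + 1) • diagonal n) ⟨0, hn⟩).trans_lt hz
    have h2 := abs_apply_le_boxNorm z ⟨0, hn⟩
    simp only [PiLp.sub_apply, PiLp.smul_apply, diagonal_apply, smul_eq_mul, mul_one] at h1
    linarith [(abs_lt.1 h1).1, le_abs_self (z ⟨0, hn⟩)]
  | coe c =>
    obtain ⟨a, ha, h⟩ := mem_nhds_coe_iff.1 hV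
    exact ⟨c, a, ha, h⟩

/-! ### Basic properties of the modulus metric, and prolongation of cheap curves. -/

section ModulusDist

variable {G : Set (MobiusSpace n)}

/-- Any set in which the points are joined may replace the curve. Upper bounds can thus be proved
for convenient unions without following the curve itself. -/
theorem modulusDist_le (hG : IsOpen G) {S : Set (MobiusSpace n)} (hS : S ⊆ G) {x y : G}
    (h : JoinedIn S (x : MobiusSpace n) y) :
    modulusDist G x y ≤ capacity (finitePart S) (finitePart Gᶜ) := by
  obtain ⟨γ, hγ⟩ := h
  refine iInf₂_le_of_le (γ : C(I, MobiusSpace n)) ⟨by simp, by simp, fun t => hS (hγ t)⟩ ?_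
  rw [modulus_curvesJoining hG (by rintro _ ⟨t, rfl⟩; exact hS (hγ t)) subset_rfl
    (frontier_subset_compl hG)]
  exact capacity_mono (preimage_mono (by rintro _ ⟨t, rfl⟩; exact hγ t))

theorem exists_of_modulusDist_lt (hG : IsOpen G) {x y : G} {a : ℝ≥0∞}
    (h : modulusDist G x y < a) :
    ∃ γ : Path (x : MobiusSpace n) y, range γ ⊆ G ∧
      capacity (finitePart (range γ)) (finitePart Gᶜ) < a := by
  simp only [modulusDist, iInf_lt_iff] at h
  obtain ⟨c, ⟨h0, h1, hc⟩, hlt⟩ := h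
  have hsub : range c ⊆ G := by rintro _ ⟨t, rfl⟩; exact hc t
  rw [modulus_curvesJoining hG hsub subset_rfl (frontier_subset_compl hG)] at hlt
  exact ⟨⟨c, h0, h1⟩, hsub, hlt⟩

theorem joinedIn_range {X : Type*} [TopologicalSpace X] {x y : X} (γ : Path x y) (s t : I) :
    JoinedIn (range γ) (γ s) (γ t) := by
  have : PathConnectedSpace I := isPathConnected_iff_pathConnectedSpace.1
    ((convex_Icc (0 : ℝ) 1).isPathConnected ⟨0, left_mem_Icc.2 zero_le_one⟩)
  have h := (isPathConnected_range γ.continuous).joinedIn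
  exact h _ ⟨s, rfl⟩ _ ⟨t, rfl⟩

theorem joinedIn_range_source_target {X : Type*} [TopologicalSpace X] {x y : X} (γ : Path x y) :
    JoinedIn (range γ) x y := by
  simpa using joinedIn_range γ 0 1

theorem modulusDist_comm (hG : IsOpen G) (x y : G) : modulusDist G x y = modulusDist G y x := by
  suffices H : ∀ x y, modulusDist G x y ≤ modulusDist G y x from le_antisymm (H _ _) (H _ _)
  refine fun x y => le_of_forall_gt fun a ha => ?_
  obtain ⟨γ, hγ, hlt⟩ := exists_of_modulusDist_lt hG ha
  exact (modulusDist_le hG hγ (joinedIn_range_source_target γ).symm).trans_lt hlt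

theorem modulusDist_triangle (hG : IsOpen G) (x y z : G) :
    modulusDist G x z ≤ modulusDist G x y + modulusDist G y z := by
  refine ENNReal.le_of_forall_pos_le_add fun ε hε hfin => ?_
  have hε2 : (ε : ℝ≥0∞) / 2 ≠ 0 := by simpa using hε.ne'
  obtain ⟨h1, h2⟩ := ENNReal.add_lt_top.1 hfin
  obtain ⟨γ₁, hs₁, hi₁⟩ := exists_of_modulusDist_lt hG (ENNReal.lt_add_right h1.ne hε2)
  obtain ⟨γ₂, hs₂, hi₂⟩ := exists_of_modulusDist_lt hG (ENNReal.lt_add_right h2.ne hε2)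
  have hj : JoinedIn (range γ₁ ∪ range γ₂) (x : MobiusSpace n) z :=
    ((joinedIn_range_source_target γ₁).mono subset_union_left).trans
      ((joinedIn_range_source_target γ₂).mono subset_union_right)
  refine (modulusDist_le hG (union_subset hs₁ hs₂) hj).trans ?_
  rw [finitePart, preimage_union]
  refine capacity_union_le.trans ((add_le_add hi₁.le hi₂.le).trans_eq ?_)
  rw [add_add_add_comm, ENNReal.add_halves]

/-- Points that are close in the Möbius space are close in the modulus metric. -/
theorem exists_nhds_modulusDist_le (hn : 2 ≤ n) (hG : IsOpen G) (p : G) {ε : ℝ≥0∞} (hε : ε ≠ 0) :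
    ∃ V ∈ 𝓝 (p : MobiusSpace n), ∀ q : G, (q : MobiusSpace n) ∈ V → modulusDist G p q ≤ ε := by
  have hGp : G ∈ 𝓝 (p : MobiusSpace n) := hG.mem_nhds p.2
  obtain ⟨V₁, hV₁, ω, hω, hi, hsep⟩ := exists_barrier hn hGp hε
  obtain ⟨V, hV, hj⟩ := exists_nhds_joinedIn (inter_mem hGp hV₁)
  refine ⟨V, hV, fun q hq => (modulusDist_le hG inter_subset_left (hj q hq)).trans ?_⟩
  exact (capacity_le hω fun u hu v hv => hsep u v hu.2 hv).trans hi

/-- Not automatic: even a constant curve has a family of curves to the boundary. It has modulus zero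
since rings around the point are cheap to block, which needs `n ≥ 2`. -/
theorem modulusDist_self (hn : 2 ≤ n) (hG : IsOpen G) (p : G) : modulusDist G p p = 0 := by
  by_contra h
  obtain ⟨ε, hε, hlt⟩ := exists_between (pos_iff_ne_zero.2 h)
  obtain ⟨V, hV, hle⟩ := exists_nhds_modulusDist_le hn hG p hε.ne'
  exact absurd (hle p (mem_of_mem_nhds hV)) (not_le.2 hlt)

/-- The points at finite distance from `x` form a nonempty clopen subset of the connected set `G`.
-/
theorem modulusDist_lt_top (hn : 2 ≤ n) (hG : IsOpen G) (hGc : IsConnected G) (x y : G) :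
    modulusDist G x y < ∞ := by
  have : PreconnectedSpace G := isPreconnected_iff_preconnectedSpace.1 hGc.isPreconnected
  have hclopen : IsClopen {y : G | modulusDist G x y < ∞} := by
    have key : ∀ y : G, ∀ᶠ z in 𝓝 y, modulusDist G y z < ∞ := fun y => by
      obtain ⟨V, hV, hle⟩ := exists_nhds_modulusDist_le hn hG y one_ne_zero
      filter_upwards [continuous_subtype_val.continuousAt.preimage_mem_nhds hV] with z hz
      exact (hle z hz).trans_lt ENNReal.one_lt_top
    constructor
    · refine ⟨isOpen_iff_mem_nhds.2 fun y hy => ?_⟩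
      filter_upwards [key y] with z hz hxz
      refine hy ((modulusDist_triangle hG x z y).trans_lt (ENNReal.add_lt_top.2 ⟨hxz, ?_⟩))
      rwa [modulusDist_comm hG]
    · refine isOpen_iff_mem_nhds.2 fun y hy => ?_
      filter_upwards [key y] with z hz
      exact (modulusDist_triangle hG x y z).trans_lt (ENNReal.add_lt_top.2 ⟨hy, hz⟩)
  have huniv := hclopen.eq_univ ⟨x, by
    change modulusDist G x x < ∞
    rw [modulusDist_self hn hG]; exact ENNReal.zero_lt_top⟩
  exact huniv.ge (mem_univ y)

/-- If `p` is joined to points outside a fixed neighborhood by curves of small modulus, then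
it is also joined to points near any given point by such curves. -/
theorem exists_modulusDist_le_of_escape (hn : 2 ≤ n) (hG : IsOpen G) {p : G}
    {W : Set (MobiusSpace n)} (hW : W ∈ 𝓝 (p : MobiusSpace n))
    (h : ∀ ε : ℝ≥0∞, ε ≠ 0 → ∃ q : G, (q : MobiusSpace n) ∉ W ∧ modulusDist G p q < ε)
    {y : MobiusSpace n} {V : Set (MobiusSpace n)} (hV : V ∈ 𝓝 y) {ε : ℝ≥0∞} (hε : ε ≠ 0) :
    ∃ z : G, (z : MobiusSpace n) ∈ V ∧ modulusDist G p z ≤ ε := by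
  have hn0 : 0 < n := by omega
  obtain ⟨c, s, hs⟩ := exists_isScaleAt hn0 (p : MobiusSpace n)
  obtain ⟨k, hk⟩ := hs.crosses W hW
  obtain ⟨V₀, hV₀, hlarge⟩ := hk k le_rfl
  set r := s ^ k
  have hr : 0 < r := pow_pos hs.pos k
  obtain ⟨b, a, ha, hb⟩ := exists_box_subset_of_mem_nhds hn0 hV
  set δ : ℝ≥0∞ := min (ENNReal.ofReal (r / (2 * n))) (ENNReal.ofReal (2 * a))
  have hδ : δ ≠ 0 := by
    refine (lt_min ?_ ?_).ne' <;> simp only [ENNReal.ofReal_pos] <;> positivity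
  set H : ℝ := boxNorm c + 10 * r + (boxNorm b + a)
  have hHpos : 0 < H := by
    have := boxNorm_nonneg c; have := boxNorm_nonneg b; positivity
  obtain ⟨m, rfl⟩ : ∃ m, n = m + 1 := ⟨n - 1, by omega⟩
  -- The curve from `p` out of `W` is large at a scale fixed by `W`, and `V` contains a box. For
  -- energy below `η` both come within 1/4 of one point, hence within 1/2 of each other. The bound
  -- `ε / 2 ^ (m + 1)` below pays for doubling the density.
  obtain ⟨η, hη, hnear⟩ := exists_diagonal_near m (ε := 1 / 4) (by simp) hδ hHpos
  have hε2 : ε / 2 ^ (m + 1) ≠ 0 := (ENNReal.div_pos hε (by simp)).ne'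
  obtain ⟨q, hqW, hq⟩ := h (min η (ε / 2 ^ (m + 1)))
    (lt_min (pos_iff_ne_zero.2 hη) (pos_iff_ne_zero.2 hε2)).ne'
  obtain ⟨γ, hγ, hcap⟩ := exists_of_modulusDist_lt hG hq
  obtain ⟨ρ, hρ, hsep, hi⟩ := exists_of_capacity_lt hcap
  obtain ⟨d, -, -, hd⟩ := hnear ρ hρ (hi.le.trans (min_le_left _ _))
  have hA : IsLargeAt c r (finitePart (range γ)) := by
    refine hlarge _ (isPreconnected_range γ.continuous) ⟨q, ⟨1, by simp⟩, hqW⟩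
      ⟨p, ⟨0, by simp⟩, mem_of_mem_nhds hV₀⟩
  obtain ⟨i, hAi⟩ := hA
  obtain ⟨p₁, hp₁, -, hdp⟩ := hd (finitePart (range γ)) i <| by
    refine (min_le_left _ _).trans (hAi.trans (measure_mono ?_))
    rintro t ⟨u, hu, hut, hur⟩
    refine ⟨u, hu, hut, ?_⟩
    have h1 := boxNorm_add_le (u - c) c
    rw [sub_add_cancel] at h1
    have := boxNorm_nonneg b
    linarith [hur.2]
  obtain ⟨q₁, hq₁, -, hdq⟩ := hd (finitePart V) 0 <| by
    have hsub : Ioo (b 0 - a) (b 0 + a) ⊆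
        {t : ℝ | ∃ u ∈ finitePart V, u 0 = t ∧ boxNorm u ≤ H} := by
      intro t ht
      have hbx : boxNorm ((t - b 0) • diagonal (m + 1)) < a := by
        rw [boxNorm_smul]
        have h1 := boxNorm_diagonal_le (n := m + 1)
        have h2 : |t - b 0| < a := abs_lt.2 ⟨by linarith [ht.1], by linarith [ht.2]⟩
        nlinarith [abs_nonneg (t - b 0)]
      refine ⟨b + (t - b 0) • diagonal (m + 1), hb _ ?_, by simp, ?_⟩
      · rwa [add_sub_cancel_left]
      · have h3 := boxNorm_add_le b ((t - b 0) • diagonal (m + 1))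
        have := boxNorm_nonneg c
        linarith
    refine (min_le_right _ _).trans (le_trans (le_of_eq ?_) (measure_mono hsub))
    rw [Real.volume_Ioo]
    congr 1
    ring
  have hpq : weightedDist ρ p₁ q₁ < 1 / 2 := by
    refine (weightedDist_triangle_left ρ p₁ q₁ d).trans_lt ((ENNReal.add_lt_add hdp hdq).trans_eq ?_)
    rw [← two_mul, one_div, one_div, show (4 : ℝ≥0∞) = 2 * 2 by norm_num,
      ENNReal.mul_inv (by simp) (by simp), ← mul_assoc, ENNReal.mul_inv_cancel (by simp) (by simp),
      one_mul]
  -- The curve together with the ball of radius 1/2 around `p₁`. All of it is at distance at least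
  -- 1/2 from the complement, so it lies in `G` and `2ρ` is admissible for it.
  set S : Set (MobiusSpace (m + 1)) :=
    range γ ∪ ((↑) : EuclideanSpace ℝ (Fin (m + 1)) → _) '' {w | weightedDist ρ p₁ w < 1 / 2}
  have hfar : ∀ w ∈ finitePart S, ∀ v ∈ finitePart Gᶜ, 1 / 2 ≤ weightedDist ρ w v := by
    rintro w (hw | ⟨w', hw, hww⟩) v hv
    · exact le_trans (by simp) (hsep w hw v hv)
    · rw [OnePoint.coe_eq_coe] at hww
      subst hww
      exact half_le_weightedDist hsep hp₁ (le_of_lt hw) hv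
  have hSG : S ⊆ G := by
    rintro x (hx | ⟨w, hw, rfl⟩)
    · exact hγ hx
    · by_contra hwG
      exact notMem_of_half_le (C := finitePart Gᶜ) (hfar w (Or.inr ⟨w, hw, rfl⟩)) hwG
  have hj₂ : JoinedIn S (p₁ : MobiusSpace (m + 1)) (q₁ : MobiusSpace (m + 1)) :=
    ((joinedIn_of_weightedDist_lt hpq).map OnePoint.continuous_coe).mono subset_union_right
  have hj₁ : JoinedIn S (p : MobiusSpace (m + 1)) (p₁ : MobiusSpace (m + 1)) := by
    obtain ⟨t, ht⟩ := hp₁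
    have := joinedIn_range γ 0 t
    rw [ht, γ.source] at this
    exact this.mono subset_union_left
  refine ⟨⟨q₁, hSG hj₂.target_mem⟩, hq₁, (modulusDist_le hG hSG (hj₁.trans hj₂)).trans ?_⟩
  refine (capacity_le (hρ.const_mul 2) (separates_two_mul hfar)).trans ?_
  simp only [mul_pow]
  rw [lintegral_const_mul' _ _ (ENNReal.pow_ne_top (by simp))]
  calc (2 : ℝ≥0∞) ^ (m + 1) * ∫⁻ z, ρ z ^ (m + 1) ≤ 2 ^ (m + 1) * (ε / 2 ^ (m + 1)) := by
        gcongr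
        exact hi.le.trans (min_le_right _ _)
    _ = ε := ENNReal.mul_div_cancel (by simp) (ENNReal.pow_ne_top (by simp))

end ModulusDist

end

/-! ### Localization of densities; complete metrics force the M-condition. -/

section

variable {n : ℕ}

section Localization

variable {A C : Set (EuclideanSpace ℝ (Fin n))} {ρ ω : EuclideanSpace ℝ (Fin n) → ℝ≥0∞}

/-- A weight may be cut off outside a set that cannot be left cheaply. -/
theorem Separates.localize (hsep : Separates ρ A C) {F : Set (EuclideanSpace ℝ (Fin n))}
    (hbar : ∀ p ∈ A, ∀ z ∉ F, 1 ≤ weightedDist ω p z) :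
    Separates (fun z => max (F.indicator ρ z) (ω z)) A C := by
  intro p hp q hq
  by_contra! hlt
  refine absurd (hsep p hp q hq) (not_le.2 (weightedDist_lt_of_le_on (fun z hz => ?_) hlt))
  have hzF : z ∈ F := by
    by_contra hzF
    exact absurd ((hbar p hp z hzF).trans (weightedDist_mono (fun w => le_max_right _ _) p z))
      (not_le.2 hz)
  rw [indicator_of_mem hzF]
  exact le_max_left _ _

theorem lintegral_localize_pow_le {F : Set (EuclideanSpace ℝ (Fin n))} (hn : n ≠ 0)
    (hF : MeasurableSet F) (hρ : Measurable ρ) :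
    ∫⁻ z, (max (F.indicator (fun z => 2 * ρ z) z) (ω z)) ^ n ≤
      2 ^ n * (∫⁻ z in F, ρ z ^ n) + ∫⁻ z, ω z ^ n := by
  refine (lintegral_max_pow_le ((hρ.const_mul 2).indicator hF)).trans
    (add_le_add (le_of_eq ?_) le_rfl)
  rw [← lintegral_const_mul' _ _ (ENNReal.pow_ne_top ENNReal.ofNat_ne_top),
    ← lintegral_indicator hF]
  refine lintegral_congr fun z => ?_
  by_cases hz : z ∈ F <;> simp [hz, mul_pow, hn]

/-- Countably many weights are dominated by one whose energy is at most the sum of theirs. -/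
theorem exists_weight_ge (hn : n ≠ 0) {τ : ℕ → EuclideanSpace ℝ (Fin n) → ℝ≥0∞}
    (hτ : ∀ i, Measurable (τ i)) :
    ∃ ρ : EuclideanSpace ℝ (Fin n) → ℝ≥0∞, Measurable ρ ∧ (∀ i, τ i ≤ ρ) ∧
      ∫⁻ z, ρ z ^ n = ∑' i, ∫⁻ z, τ i z ^ n := by
  have hpow : ∀ y : ℝ≥0∞, (y ^ ((n : ℝ)⁻¹)) ^ n = y := fun y => by
    rw [← ENNReal.rpow_natCast, ← ENNReal.rpow_mul, inv_mul_cancel₀ (by exact_mod_cast hn),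
      ENNReal.rpow_one]
  refine ⟨fun z => (∑' i, τ i z ^ n) ^ ((n : ℝ)⁻¹), ?_, fun i z => ?_, ?_⟩
  · exact (Measurable.tsum fun i => (hτ i).pow_const n).pow_const _
  · rw [← ENNReal.pow_le_pow_left_iff hn, hpow]
    exact ENNReal.le_tsum (f := fun i => τ i z ^ n) i
  · simp only [hpow]
    exact lintegral_tsum fun i => ((hτ i).pow_const n).aemeasurable

end Localization

variable {G : Set (MobiusSpace n)}

/-- The continuum of the criterion contains the point `x` outside `G`. Discarding it shrinks the
family and gives a set to which the capacity description applies. -/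
theorem capacity_le_modulus (hG : IsOpen G) (K : Set (MobiusSpace n)) :
    capacity (finitePart (K ∩ G)) (finitePart Gᶜ) ≤ modulus (curvesJoining K Gᶜ G) := by
  rw [← modulus_curvesJoining hG inter_subset_right (frontier_subset_compl hG) subset_rfl]
  refine le_iInf₂ fun ρ hρ => iInf₂_le_of_le ρ ⟨hρ.1, fun γ hγ => hρ.2 γ ?_⟩ le_rfl
  exact ⟨hγ.1.1, hγ.2⟩

/-- The part of `A` near a point has small capacity. -/
theorem exists_nhds_capacity_le (hn : 2 ≤ n) (x : MobiusSpace n)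
    {ρ : EuclideanSpace ℝ (Fin n) → ℝ≥0∞} (hρ : Measurable ρ) (hi : ∫⁻ z, ρ z ^ n ≠ ∞)
    {A C : Set (EuclideanSpace ℝ (Fin n))} (hA : ∀ p ∈ A, ∀ q ∈ C, 1 / 2 ≤ weightedDist ρ p q)
    {ε : ℝ≥0∞} (hε : ε ≠ 0) : ∃ V ∈ 𝓝 x, capacity (A ∩ finitePart V) C ≤ ε := by
  have hε2 : ε / 2 / 2 ^ n ≠ 0 :=
    (ENNReal.div_pos (ENNReal.half_pos hε).ne' (ENNReal.pow_ne_top (by simp))).ne'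
  obtain ⟨U, hU, hUi⟩ := exists_nhds_energy_le (by omega) x hi hε2
  obtain ⟨V, hV, ω, hω, hωi, hbar⟩ := exists_barrier hn (interior_mem_nhds.2 hU)
    (ENNReal.half_pos hε).ne'
  refine ⟨V, hV, ?_⟩
  have hF : MeasurableSet (finitePart (interior U)) :=
    (isOpen_interior.preimage OnePoint.continuous_coe).measurableSet
  have hsep : Separates (fun z => 2 * ρ z) (A ∩ finitePart V) C :=
    separates_two_mul fun p hp => hA p hp.1
  refine (capacity_le (((hρ.const_mul 2).indicator hF).max hω) (hsep.localize (ω := ω)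
    (F := finitePart (interior U)) fun p hp z hz => hbar p z hp.2 hz)).trans ?_
  refine (lintegral_localize_pow_le (by omega) hF hρ).trans ?_
  calc _ ≤ 2 ^ n * (ε / 2 / 2 ^ n) + ε / 2 := by
        refine add_le_add (mul_le_mul_right ((lintegral_mono_set ?_).trans hUi) _) hωi
        exact preimage_mono interior_subset
    _ = ε := by
        rw [ENNReal.mul_div_cancel (by simp) (ENNReal.pow_ne_top (by simp)), ENNReal.add_halves]

theorem IsScaleAt.pow_mem_Icc {x : MobiusSpace n} {c : EuclideanSpace ℝ (Fin n)} {s : ℝ}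
    (hs : IsScaleAt x c s) (k : ℕ) : s ^ k ∈ Icc (s ^ (k + 1) / 2) (2 * s ^ (k + 1)) := by
  have hpos := pow_pos hs.pos k
  rw [pow_succ]
  rcases hs.eq_or with rfl | rfl <;> constructor <;> linarith

/-- If the continuum criterion holds at `x`, there is a sequence of points of `G` that converges
to `x` and is a Cauchy sequence for the modulus metric. -/
theorem exists_cauchy_of_continuumCriterion (hn : 2 ≤ n) (hG : IsOpen G) {x : MobiusSpace n}
    (h : ContinuumCriterion Gᶜ x) :
    ∃ u : ℕ → G, Tendsto (fun k => (u k : MobiusSpace n)) atTop (𝓝 x) ∧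
      ∀ ε : ℝ≥0∞, ε ≠ 0 → ∃ k₀, ∀ k ≥ k₀, ∀ l ≥ k₀, modulusDist G (u k) (u l) ≤ ε := by
  obtain ⟨K, ⟨-, hKconn, hKnt⟩, hxK, hKsub, hmod⟩ := h
  rw [compl_compl] at hKsub hmod
  obtain ⟨ρ, hρ, hsep, hi⟩ := exists_of_capacity_lt ((capacity_le_modulus hG K).trans_lt hmod)
  obtain ⟨c, s, hs⟩ := exists_isScaleAt (by omega) x
  obtain ⟨N, η, hη, hhub⟩ := exists_hub hn (ε := 1 / 4) (by simp)
  obtain ⟨U, hU, hUi⟩ := exists_nhds_energy_le (by omega) x hi.ne hη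
  obtain ⟨k₁, hk₁⟩ := hs.ring_subset U hU N
  obtain ⟨y, hyK, hyx⟩ := hKnt.exists_ne x
  -- `K` contains both `x` and a point `y` outside this neighborhood, so it is large at every small
  -- scale.
  obtain ⟨k₂, hk₂⟩ := hs.crosses {y}ᶜ (isOpen_compl_singleton.mem_nhds hyx.symm)
  set k₀ := max k₁ k₂
  set Rg : ℕ → Set (EuclideanSpace ℝ (Fin n)) := fun k =>
    boxRing c (s ^ k / 2 ^ N) (2 ^ N * s ^ k) with hRg
  have hhub' : ∀ j : ℕ, ∃ d : EuclideanSpace ℝ (Fin n),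
      (∀ r' ∈ Icc (s ^ (k₀ + j) / 2) (2 * s ^ (k₀ + j)), IsLargeAt c r'
        {z | JoinedIn {w | w ∈ Rg (k₀ + j) ∧ weightedDist ρ d w < 1 / 4} d z}) ∧
      ∀ A, IsLargeAt c (s ^ (k₀ + j)) A → ∃ p ∈ A,
        JoinedIn {w | w ∈ Rg (k₀ + j) ∧ weightedDist ρ d w < 1 / 4} d p := fun j => by
    refine hhub c (s ^ (k₀ + j)) (pow_pos hs.pos _) ρ hρ ((lintegral_mono_set ?_).trans hUi)
    exact hk₁ _ ((le_max_left _ _).trans (Nat.le_add_right _ _))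
  choose d hd₁ hd₂ using hhub'
  have hfar : ∀ j, ∀ w ∈ {w | w ∈ Rg (k₀ + j) ∧ weightedDist ρ (d j) w < 1 / 4},
      ∀ v ∈ finitePart Gᶜ, 1 / 2 ≤ weightedDist ρ w v := by
    intro j w hw v hv
    obtain ⟨V, hV, hlarge⟩ := hk₂ (k₀ + j) ((le_max_right _ _).trans (Nat.le_add_right _ _))
    obtain ⟨p, hpK, hp⟩ := hd₂ j (finitePart K) (hlarge K hKconn.isPreconnected
      ⟨y, hyK, by simp⟩ ⟨x, hxK, mem_of_mem_nhds hV⟩)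
    have hpx : (p : MobiusSpace n) ≠ x := by
      obtain ⟨V', hV', hdisj⟩ := hs.ring_disjoint (k₀ + j) N
      intro hpx
      exact hdisj p hp.target_mem.1 (hpx ▸ mem_of_mem_nhds hV')
    have hpG : (p : MobiusSpace n) ∈ G := (hKsub hpK).resolve_left hpx
    refine half_le_weightedDist hsep (p := p) ⟨hpK, hpG⟩ ?_ hv
    refine (weightedDist_triangle_left ρ p w (d j)).trans
      ((add_le_add hp.target_mem.2.le hw.2.le).trans_eq ?_)
    rw [← two_mul, one_div, one_div, show (4 : ℝ≥0∞) = 2 * 2 by norm_num,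
      ENNReal.mul_inv (by simp) (by simp), ← mul_assoc, ENNReal.mul_inv_cancel (by simp) (by simp),
      one_mul]
  -- The part of the rings from the `j`-th on that is far from the complement; it contains the paths
  -- between all later hubs and shrinks to `x`.
  set S : ℕ → Set (EuclideanSpace ℝ (Fin n)) := fun j =>
    {w | (∃ l ≥ j, w ∈ Rg (k₀ + l)) ∧ ∀ v ∈ finitePart Gᶜ, 1 / 2 ≤ weightedDist ρ w v}
  have hstep : ∀ j l, j ≤ l → JoinedIn (S j) (d l) (d (l + 1)) := by
    intro j l hjl
    -- The ball around hub `l + 1` is large at scale `l` too, so hub `l` reaches it.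
    obtain ⟨p, hp₁, hp₂⟩ := hd₂ l _ (hd₁ (l + 1) (s ^ (k₀ + l)) (hs.pow_mem_Icc (k₀ + l)))
    have h1 : JoinedIn (S j) (d l) p := hp₂.mono fun w hw => ⟨⟨l, hjl, hw.1⟩, hfar l w hw⟩
    have h2 : JoinedIn (S j) (d (l + 1)) p := JoinedIn.mono hp₁ fun w hw =>
      ⟨⟨l + 1, hjl.trans (Nat.le_succ l), hw.1⟩, hfar (l + 1) w hw⟩
    exact h1.trans h2.symm
  have hjoin : ∀ j l, j ≤ l → JoinedIn (S j) (d j) (d l) := by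
    intro j l hjl
    induction l, hjl using Nat.le_induction with
    | base => exact JoinedIn.refl (hstep j j le_rfl).source_mem
    | succ l hjl ih => exact ih.trans (hstep j l hjl)
  have hdG : ∀ j, (d j : MobiusSpace n) ∈ G := fun j => by
    by_contra hdG
    exact notMem_of_half_le (C := finitePart Gᶜ) (hjoin j j le_rfl).source_mem.2 hdG
  have hSnear : ∀ V ∈ 𝓝 x, ∃ j₀, ∀ j ≥ j₀, S j ⊆ finitePart V := by
    intro V hV
    obtain ⟨k₃, hk₃⟩ := hs.ring_subset V hV N
    refine ⟨k₃, fun j hj w hw => ?_⟩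
    obtain ⟨⟨l, hl, hwl⟩, -⟩ := hw
    exact hk₃ _ (by omega) w hwl
  refine ⟨fun j => ⟨d j, hdG j⟩, fun V hV => ?_, fun ε hε => ?_⟩
  · obtain ⟨j₀, hj₀⟩ := hSnear V hV
    exact mem_map.2 (mem_atTop_sets.2 ⟨j₀, fun j hj => hj₀ j hj (hjoin j j le_rfl).source_mem⟩)
  · obtain ⟨V, hV, hcap⟩ := exists_nhds_capacity_le hn x hρ hi.ne
      (A := {w | ∀ v ∈ finitePart Gᶜ, 1 / 2 ≤ weightedDist ρ w v}) (C := finitePart Gᶜ)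
      (fun p hp => hp) hε
    obtain ⟨j₀, hj₀⟩ := hSnear V hV
    refine ⟨j₀, fun k hk l hl => ?_⟩
    have hj : JoinedIn (S j₀) (d k) (d l) := (hjoin j₀ k hk).symm.trans (hjoin j₀ l hl)
    have hSG : ((↑) : EuclideanSpace ℝ (Fin n) → MobiusSpace n) '' S j₀ ⊆ G := by
      rintro _ ⟨w, hw, rfl⟩
      by_contra hwG
      exact notMem_of_half_le (C := finitePart Gᶜ) hw.2 hwG
    refine (modulusDist_le hG hSG (hj.map OnePoint.continuous_coe)).trans
      (le_trans (capacity_mono ?_) hcap)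
    rw [finitePart, preimage_image_eq _ OnePoint.coe_injective]
    exact fun w hw => ⟨hw.2, hj₀ j₀ le_rfl hw⟩

theorem IsCompleteMetric.eq_and_exists_limit {X : Type*} {d : X → X → ℝ≥0∞}
    (h : IsCompleteMetric d) : (∀ x y, d x y = 0 → x = y) ∧ ∀ u : ℕ → X,
      (∀ ε : ℝ≥0∞, ε ≠ 0 → ∃ k₀, ∀ k ≥ k₀, ∀ l ≥ k₀, d (u k) (u l) ≤ ε) →
      ∃ p, ∀ ε : ℝ≥0∞, ε ≠ 0 → ∃ k₀, ∀ k ≥ k₀, d p (u k) < ε := by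
  obtain ⟨inst, hd, hc⟩ := h
  refine ⟨fun x y hxy => edist_eq_zero.1 ((hd x y).trans hxy), fun u hu => ?_⟩
  have hcauchy : CauchySeq u := EMetric.cauchySeq_iff.2 fun ε hε => by
    obtain ⟨δ, hδ, hlt⟩ := exists_between hε
    obtain ⟨k₀, hk₀⟩ := hu δ hδ.ne'
    exact ⟨k₀, fun k hk l hl => ((hd _ _).trans_le (hk₀ k hk l hl)).trans_lt hlt⟩
  obtain ⟨p, hp⟩ := cauchySeq_tendsto_of_complete hcauchy
  refine ⟨p, fun ε hε => ?_⟩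
  obtain ⟨k₀, hk₀⟩ := EMetric.tendsto_atTop.1 hp ε (pos_iff_ne_zero.2 hε)
  exact ⟨k₀, fun k hk => by rw [← hd, edist_comm]; exact hk₀ k hk⟩

/-- A domain with a complete modulus metric is an M-domain. -/
theorem isMDomain_of_isCompleteMetric (hn : 2 ≤ n) (hG : IsOpen G)
    (h : IsCompleteMetric (modulusDist G)) : IsMDomain G := by
  intro x hx hcrit
  obtain ⟨u, hux, hu⟩ := exists_cauchy_of_continuumCriterion hn hG hcrit
  obtain ⟨hsep, hlim⟩ := h.eq_and_exists_limit
  obtain ⟨p, hp⟩ := hlim u hu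
  have hpx : (p : MobiusSpace n) ≠ x := fun hpx => frontier_subset_compl hG hx (hpx ▸ p.2)
  obtain ⟨W, V, hW, hV, hpW, hxV, hWV⟩ := t2_separation hpx
  obtain ⟨k₁, hk₁⟩ := mem_atTop_sets.1 (mem_map.1 (hux (hV.mem_nhds hxV)))
  have hout : ∀ k ≥ k₁, (u k : MobiusSpace n) ∉ W := fun k hk hkW =>
    disjoint_left.1 hWV hkW (hk₁ k hk)
  -- The sequence tends to `p` in the metric but to `x ≠ p` in the Möbius space, so `p` has cheap
  -- curves out of `W`. By prolongation `p` then has distance zero from `u k₁`, a point outside `W`.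
  have hesc : ∀ ε : ℝ≥0∞, ε ≠ 0 → ∃ q : G, (q : MobiusSpace n) ∉ W ∧ modulusDist G p q < ε :=
    fun ε hε => by
      obtain ⟨k₂, hk₂⟩ := hp ε hε
      exact ⟨u (max k₁ k₂), hout _ (le_max_left _ _), hk₂ _ (le_max_right _ _)⟩
  have hzero : modulusDist G p (u k₁) = 0 := by
    refine le_antisymm (le_of_forall_gt fun ε hε => ?_) zero_le
    obtain ⟨δ, hδ, hδε⟩ := exists_between hε
    obtain ⟨V', hV', hnear⟩ := exists_nhds_modulusDist_le hn hG (u k₁)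
      (ENNReal.half_pos hδ.ne').ne'
    obtain ⟨z, hzV, hz⟩ := exists_modulusDist_le_of_escape hn hG (hW.mem_nhds hpW) hesc hV'
      (ENNReal.half_pos hδ.ne').ne'
    have h1 := hnear z hzV
    rw [modulusDist_comm hG] at h1
    exact ((modulusDist_triangle hG p z (u k₁)).trans
      ((add_le_add hz h1).trans_eq (ENNReal.add_halves δ))).trans_lt hδε
  exact hout k₁ le_rfl (hsep _ _ hzero ▸ hpW)

end

/-! ### Chains of neighborhoods, and continua built scale by scale. -/

section

variable {n : ℕ}

theorem isCountablyGenerated_nhds (x : MobiusSpace n) : (𝓝 x).IsCountablyGenerated := by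
  induction x using OnePoint.rec with
  | infty =>
    rw [OnePoint.nhds_infty_eq, coclosedCompact_eq_cocompact, ← Metric.cobounded_eq_cocompact,
      ← comap_norm_atTop]
    infer_instance
  | coe c =>
    rw [OnePoint.nhds_coe_eq]
    infer_instance

/-- Connected sets that reach from outside `U` into `V` are joined by a curve in `U \ V` that is
short with respect to any weight of energy at most `R`. -/
def Connects (R : ℝ≥0∞) (U V : Set (MobiusSpace n)) : Prop :=
  ∀ ρ : EuclideanSpace ℝ (Fin n) → ℝ≥0∞, Measurable ρ → ∫⁻ z, ρ z ^ n ≤ R →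
    ∀ A B : Set (MobiusSpace n), IsPreconnected A → IsPreconnected B →
      (A ∩ Uᶜ).Nonempty → (A ∩ V).Nonempty → (B ∩ Uᶜ).Nonempty → (B ∩ V).Nonempty →
      ∃ p q : EuclideanSpace ℝ (Fin n), (p : MobiusSpace n) ∈ A ∧ (q : MobiusSpace n) ∈ B ∧
        JoinedIn {w : EuclideanSpace ℝ (Fin n) | (w : MobiusSpace n) ∈ U ∧
          (w : MobiusSpace n) ∉ V ∧ weightedDist ρ p w < 1 / 2} p q

theorem Connects.anti {R : ℝ≥0∞} {U V V' : Set (MobiusSpace n)} (h : Connects R U V)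
    (hV : V' ⊆ V) : Connects R U V' := by
  intro ρ hρ hi A B hA hB hAU hAV hBU hBV
  obtain ⟨p, q, hp, hq, hpq⟩ := h ρ hρ hi A B hA hB hAU
    (hAV.mono (inter_subset_inter_right _ hV)) hBU (hBV.mono (inter_subset_inter_right _ hV))
  exact ⟨p, q, hp, hq, hpq.mono fun w hw => ⟨hw.1, fun hwV => hw.2.1 (hV hwV), hw.2.2⟩⟩

/-- A shrinking sequence of neighbourhoods of `x`, such that passing from one to the next is
expensive, and connected sets that cross from one to the next are close to each other. -/
structure NhdsChain (x : MobiusSpace n) (R : ℝ≥0∞) (U : ℕ → Set (MobiusSpace n))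
    (ω : ℕ → EuclideanSpace ℝ (Fin n) → ℝ≥0∞) : Prop where
  isOpen : ∀ i, IsOpen (U i)
  mem : ∀ i, x ∈ U i
  closure_subset : ∀ i, closure (U (i + 1)) ⊆ U i
  exists_subset : ∀ W ∈ 𝓝 x, ∃ i, U i ⊆ W
  measurable : ∀ i, Measurable (ω i)
  energy_le : ∀ i, ∫⁻ z, ω i z ^ n ≤ (1 / 2) ^ i
  barrier : ∀ i, ∀ p q : EuclideanSpace ℝ (Fin n), (p : MobiusSpace n) ∈ U (i + 1) →
    (q : MobiusSpace n) ∉ U i → 1 ≤ weightedDist (ω i) p q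
  connects : ∀ i, Connects R (U i) (U (i + 1))

theorem exists_nhdsChain (hn : 2 ≤ n) {x : MobiusSpace n} {W : Set (MobiusSpace n)} (hW : W ∈ 𝓝 x)
    {R : ℝ≥0∞} (hR : R ≠ ∞) : ∃ U ω, NhdsChain x R U ω ∧ U 0 ⊆ W := by
  have := isCountablyGenerated_nhds x
  obtain ⟨B, hB⟩ := (𝓝 x).exists_antitone_basis
  have step : ∀ (i : ℕ) (S : {S : Set (MobiusSpace n) // S ∈ 𝓝 x}),
      ∃ (V : {S : Set (MobiusSpace n) // S ∈ 𝓝 x}) (ω : EuclideanSpace ℝ (Fin n) → ℝ≥0∞),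
        IsOpen V.1 ∧ closure V.1 ⊆ S.1 ∧ V.1 ⊆ B i ∧ Measurable ω ∧
        ∫⁻ z, ω z ^ n ≤ (1 / 2) ^ i ∧
        (∀ p q : EuclideanSpace ℝ (Fin n), (p : MobiusSpace n) ∈ V.1 →
          (q : MobiusSpace n) ∉ S.1 → 1 ≤ weightedDist ω p q) ∧ Connects R S.1 V.1 := by
    rintro i ⟨S, hS⟩
    obtain ⟨V₁, hV₁, ω, hω, hωi, hbar⟩ := exists_barrier hn hS
      (ε := (1 / 2) ^ i) (pow_ne_zero _ (by simp))
    obtain ⟨V₂, hV₂, hcon⟩ := exists_connector hn hS hR (ε := 1 / 2) (by simp)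
    have hall : V₁ ∩ V₂ ∩ S ∩ B i ∈ 𝓝 x :=
      inter_mem (inter_mem (inter_mem hV₁ hV₂) hS) (hB.1.mem_of_mem trivial)
    obtain ⟨F, hF, hFc, hFsub⟩ := exists_mem_nhds_isClosed_subset hall
    have hsub : interior F ⊆ V₁ ∩ V₂ ∩ S ∩ B i := interior_subset.trans hFsub
    refine ⟨⟨interior F, interior_mem_nhds.2 hF⟩, ω, isOpen_interior,
      ((closure_minimal interior_subset hFc).trans hFsub).trans fun z hz => hz.1.2,
      fun z hz => (hsub hz).2, hω, hωi, fun p q hp hq => hbar p q (hsub hp).1.1.1 hq, ?_⟩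
    exact Connects.anti (V := V₂) hcon fun z hz => (hsub hz).1.1.2
  choose next ω hopen hclos hbas hmeas hen hbar hcon using step
  let U : ℕ → {S : Set (MobiusSpace n) // S ∈ 𝓝 x} := fun i =>
    Nat.rec ⟨interior W, interior_mem_nhds.2 hW⟩ (fun i S => next i S) i
  refine ⟨fun i => (U i).1, fun i => ω i (U i), ⟨fun i => ?_, fun i => mem_of_mem_nhds (U i).2,
    fun i => hclos i (U i), fun S hS => ?_, fun i => hmeas i (U i), fun i => hen i (U i),
    fun i => hbar i (U i), fun i => hcon i (U i)⟩, interior_subset⟩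
  · cases i with
    | zero => exact isOpen_interior
    | succ i => exact hopen i (U i)
  · obtain ⟨i, -, hi⟩ := hB.1.mem_iff.1 hS
    exact ⟨i + 1, (hbas i (U i)).trans hi⟩

section Chain

variable {x : MobiusSpace n} {R : ℝ≥0∞} {U : ℕ → Set (MobiusSpace n)}
  {ω : ℕ → EuclideanSpace ℝ (Fin n) → ℝ≥0∞}

theorem NhdsChain.antitone (h : NhdsChain x R U ω) : Antitone U :=
  antitone_nat_of_succ_le fun i => subset_closure.trans (h.closure_subset i)

theorem tsum_geometric_two_ennreal : ∑' i : ℕ, (1 / 2 : ℝ≥0∞) ^ i = 2 := by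
  rw [ENNReal.tsum_geometric, one_div, ENNReal.one_sub_inv_two, inv_inv]

theorem NhdsChain.tsum_energy_ne_top (h : NhdsChain x R U ω) : ∑' i, ∫⁻ z, ω i z ^ n ≠ ∞ :=
  ((ENNReal.tsum_le_tsum h.energy_le).trans_lt
    (tsum_geometric_two_ennreal.trans_lt (by simp))).ne

/-- A chain of continua shrinking to `x`, separated from the complement of `G` by weights of
summable energy, exhibits the continuum criterion at `x`. -/
theorem NhdsChain.continuumCriterion (h : NhdsChain x R U ω) (hn : n ≠ 0) {G : Set (MobiusSpace n)}
    (hx : x ∉ G) {Q : ℕ → Set (MobiusSpace n)} (hQc : ∀ i, IsCompact (Q i))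
    (hQp : ∀ i, IsConnected (Q i)) (hQG : ∀ i, Q i ⊆ G) (hQU : ∀ i, Q i ⊆ U i)
    (hQQ : ∀ i, (Q i ∩ Q (i + 1)).Nonempty) {τ : ℕ → EuclideanSpace ℝ (Fin n) → ℝ≥0∞}
    (hτ : ∀ i, Measurable (τ i)) (hτi : ∑' i, ∫⁻ z, τ i z ^ n ≠ ∞)
    (hsep : ∀ i, Separates (τ i) (finitePart (Q i)) (finitePart Gᶜ)) :
    ContinuumCriterion Gᶜ x := by
  obtain ⟨ρ₁, hρ₁, hle₁, hi₁⟩ := exists_weight_ge hn hτ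
  obtain ⟨ρ₂, hρ₂, hle₂, hi₂⟩ := exists_weight_ge hn h.measurable
  refine ⟨insert x (⋃ i, Q i), ⟨?_, ?_, ?_⟩, mem_insert _ _, ?_, ?_⟩
  · rw [isCompact_iff_ultrafilter_le_nhds']
    intro f hf
    -- An ultrafilter that contains no `Q i` contains no finite union of them, so it is concentrated
    -- in every `U i` and tends to `x`.
    by_cases hex : ∃ i, Q i ∈ f
    · obtain ⟨i, hi⟩ := hex
      obtain ⟨z, hz, hfz⟩ := isCompact_iff_ultrafilter_le_nhds'.1 (hQc i) f hi
      exact ⟨z, Or.inr (mem_iUnion.2 ⟨i, hz⟩), hfz⟩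
    · push Not at hex
      refine ⟨x, mem_insert _ _, fun W hW => ?_⟩
      obtain ⟨i, hi⟩ := h.exists_subset W hW
      have hcov : insert x (⋃ i, Q i) ⊆ W ∪ ⋃ k ∈ Iio i, Q k := by
        rintro z (rfl | hz)
        · exact Or.inl (mem_of_mem_nhds hW)
        · obtain ⟨k, hk⟩ := mem_iUnion.1 hz
          rcases lt_or_ge k i with hki | hki
          · exact Or.inr (mem_biUnion hki hk)
          · exact Or.inl (hi (h.antitone hki (hQU k hk)))
      rcases Ultrafilter.union_mem_iff.1 (mem_of_superset hf hcov) with h1 | h1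
      · exact h1
      · obtain ⟨k, -, hk⟩ := (Ultrafilter.finite_biUnion_mem_iff (finite_Iio i)).1 h1
        exact absurd hk (hex k)
  · refine (IsConnected.iUnion_of_chain hQp hQQ).subset_closure (subset_insert _ _)
      (insert_subset ?_ subset_closure)
    refine mem_closure_iff_nhds.2 fun W hW => ?_
    obtain ⟨i, hi⟩ := h.exists_subset W hW
    obtain ⟨z, hz⟩ := (hQp i).nonempty
    exact ⟨z, hi (hQU i hz), mem_iUnion.2 ⟨i, hz⟩⟩
  · obtain ⟨z, hz⟩ := (hQp 0).nonempty
    exact ⟨x, mem_insert _ _, z, Or.inr (mem_iUnion.2 ⟨0, hz⟩), fun hxz => hx (hxz ▸ hQG 0 hz)⟩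
  · rw [compl_compl]
    exact insert_subset (Or.inl rfl) (iUnion_subset fun i => (hQG i).trans subset_union_right)
  · rw [compl_compl]
    refine lt_of_le_of_lt (iInf₂_le (fun z => max (ρ₁ z) (ρ₂ z)) ⟨hρ₁.max hρ₂, ?_⟩)
      ((lintegral_max_pow_le hρ₁).trans_lt
        (ENNReal.add_lt_top.2 ⟨hi₁ ▸ hτi.lt_top, hi₂ ▸ h.tsum_energy_ne_top.lt_top⟩))
    rintro γ ⟨h0, h1, hin⟩ g hg hvar
    have hline : ∀ s t, weightedDist (fun z => max (ρ₁ z) (ρ₂ z)) (g s) (g t) ≤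
        lineIntegral (fun z => max (ρ₁ z) (ρ₂ z)) g := fun s t =>
      weightedDist_le_lineIntegral (continuous_of_coe_eq hg) hvar s t
    rcases h0 with h0 | h0
    · set t : I := ⟨1 / 2, by norm_num, by norm_num⟩
      have ht : γ t ∈ G := hin t ⟨Subtype.mk_lt_mk.2 (by norm_num), Subtype.mk_lt_mk.2 (by norm_num)⟩
      have hne : x ≠ γ t := fun hxt => hx (hxt ▸ ht)
      obtain ⟨i, hi⟩ := h.exists_subset _ (isOpen_compl_singleton.mem_nhds hne)
      refine ((h.barrier i (g 0) (g t) ?_ fun hmem => ?_).trans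
        (weightedDist_mono (fun z => (hle₂ i z).trans (le_max_right _ _)) _ _)).trans (hline 0 t)
      · rw [← hg, h0]
        exact h.mem _
      · exact hi hmem (hg t).symm
    · obtain ⟨i, hi⟩ := mem_iUnion.1 h0
      refine ((hsep i (g 0) ?_ (g 1) ?_).trans
        (weightedDist_mono (fun z => (hle₁ i z).trans (le_max_left _ _)) _ _)).trans (hline 0 1)
      · rw [hg] at hi
        exact hi
      · rw [hg] at h1
        exact h1

end Chain

/-- A curve from `A` to `B` contains a subcurve that runs between `A` and `B`. -/
theorem exists_subcurve {X : Type*} [TopologicalSpace X] {γ : I → X} (hγ : Continuous γ)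
    {A B : Set X} (hA : IsClosed A) (hB : IsClosed B) (hAB : Disjoint A B) (h0 : γ 0 ∈ A)
    (h1 : γ 1 ∈ B) : ∃ P ⊆ range γ, IsCompact P ∧ IsConnected P ∧ (P ∩ A).Nonempty ∧
      (P ∩ B).Nonempty ∧ P ⊆ closure Aᶜ ∧ P ⊆ closure Bᶜ := by
  -- Cut at the last time in `A` and then at the first later time in `B`.
  obtain ⟨s, hsA, hs⟩ := (hA.preimage hγ).isCompact.exists_isGreatest ⟨0, h0⟩
  obtain ⟨t, ⟨htB, hst⟩, ht⟩ := ((hB.preimage hγ).inter isClosed_Ici).isCompact.exists_isLeast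
    (⟨1, h1, unitInterval.le_one'⟩ : (γ ⁻¹' B ∩ Ici s).Nonempty)
  have hst : s < t := lt_of_le_of_ne hst fun h => disjoint_left.1 hAB hsA (h ▸ htB)
  have himg : γ '' Icc s t ⊆ closure (γ '' Ioo s t) := by
    rw [← closure_Ioo hst.ne]
    exact image_closure_subset_closure_image hγ
  refine ⟨γ '' Icc s t, image_subset_range _ _, isCompact_Icc.image hγ,
    ⟨⟨γ s, s, left_mem_Icc.2 hst.le, rfl⟩, isPreconnected_Icc.image γ hγ.continuousOn⟩,
    ⟨γ s, ⟨s, left_mem_Icc.2 hst.le, rfl⟩, hsA⟩, ⟨γ t, ⟨t, right_mem_Icc.2 hst.le, rfl⟩, htB⟩,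
    himg.trans (closure_mono ?_), himg.trans (closure_mono ?_)⟩
  · rintro _ ⟨u, hu, rfl⟩ huA
    exact not_le.2 hu.1 (hs huA)
  · rintro _ ⟨u, hu, rfl⟩ huB
    exact not_le.2 hu.2 (ht ⟨huB, hu.1.le⟩)

/-- For each `i` let `L i` be the limit of `f i j` in `j` along a fixed free ultrafilter. The
uniform bound on partial sums passes to the limit, so the sum of the `L i` is at most `M`. Then `J
i` is taken with `f i (J i) ≤ L i + (1 / 2) ^ i`. A different curve may thus be used at each scale,
and no limit density is needed. -/
theorem exists_diagonal_tsum_le {f : ℕ → ℕ → ℝ≥0∞} {M : ℝ≥0∞}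
    (hf : ∀ j m, ∑ i ∈ Finset.range m, f i j ≤ M) (k : ℕ) :
    ∃ J : ℕ → ℕ, (∀ i, i + k ≤ J i) ∧ ∑' i, f i (J i) ≤ M + 2 := by
  by_cases hM : M = ∞
  · exact ⟨fun i => i + k, fun i => le_rfl, by simp [hM]⟩
  have hlim : ∀ i, ∃ L, Tendsto (f i) (hyperfilter ℕ : Filter ℕ) (𝓝 L) := fun i => by
    obtain ⟨L, -, hL⟩ := isCompact_iff_ultrafilter_le_nhds'.1 (isCompact_univ (X := ℝ≥0∞))
      ((hyperfilter ℕ).map (f i)) univ_mem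
    exact ⟨L, hL⟩
  choose L hL using hlim
  have hsum : ∀ m, ∑ i ∈ Finset.range m, L i ≤ M := fun m =>
    le_of_tendsto' (tendsto_finsetSum _ fun i _ => hL i) fun j => hf j m
  have hLtop : ∀ i, L i ≠ ∞ := fun i => ne_top_of_le_ne_top hM
    ((Finset.single_le_sum (fun _ _ => zero_le) (Finset.self_mem_range_succ i)).trans (hsum (i + 1)))
  have hJ : ∀ i, ∃ j, i + k ≤ j ∧ f i j ≤ L i + (1 / 2) ^ i := fun i => by
    have h1 : ∀ᶠ j in (hyperfilter ℕ : Filter ℕ), f i j < L i + (1 / 2) ^ i :=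
      (hL i).eventually_lt_const (ENNReal.lt_add_right (hLtop i) (pow_ne_zero _ (by simp)))
    have h2 : ∀ᶠ j in (hyperfilter ℕ : Filter ℕ), i + k ≤ j :=
      Nat.hyperfilter_le_atTop (eventually_ge_atTop _)
    obtain ⟨j, hj1, hj2⟩ := (h1.and h2).exists
    exact ⟨j, hj2, hj1.le⟩
  choose J hJk hJ using hJ
  refine ⟨J, hJk, (ENNReal.tsum_le_tsum hJ).trans ?_⟩
  rw [ENNReal.tsum_add, tsum_geometric_two_ennreal]
  exact add_le_add (ENNReal.tsum_le_of_sum_range_le hsum) le_rfl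

/-- The sum telescopes: a point lies in at most `k` of the sets `S i \ S (i + k)`. -/
theorem sum_setLIntegral_diff_le {X : Type*} [MeasurableSpace X] {μ : Measure X} {S : ℕ → Set X}
    (hS : ∀ i, MeasurableSet (S i)) (hanti : Antitone S) (h : X → ℝ≥0∞) (k m : ℕ) :
    ∑ i ∈ Finset.range m, ∫⁻ z in S i \ S (i + k), h z ∂μ ≤ k * ∫⁻ z, h z ∂μ := by
  have hstep : ∀ i, (∫⁻ z in S i \ S (i + k), h z ∂μ) + ∫⁻ z in S (i + k), h z ∂μ =
      ∫⁻ z in S i, h z ∂μ := fun i => by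
    rw [add_comm, ← lintegral_inter_add_sdiff h (S i) (hS (i + k)),
      inter_eq_self_of_subset_right (hanti (Nat.le_add_right i k))]
  have htel : ∑ i ∈ Finset.range m, (∫⁻ z in S i \ S (i + k), h z ∂μ) +
      ∑ i ∈ Finset.range k, ∫⁻ z in S (m + i), h z ∂μ =
      ∑ i ∈ Finset.range k, ∫⁻ z in S i, h z ∂μ := by
    induction m with
    | zero => simp
    | succ m ih =>
      rw [← ih, Finset.sum_range_succ, add_assoc]
      congr 1
      rcases k with _ | k
      · simp
      · rw [Finset.sum_range_succ' (fun i => ∫⁻ z in S (m + i), h z ∂μ), add_zero, ← hstep m,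
          Finset.sum_range_succ]
        simp only [add_assoc, add_comm 1]
        rw [add_left_comm]
  calc _ ≤ _ := le_self_add
    _ = _ := htel
    _ ≤ ∑ i ∈ Finset.range k, ∫⁻ z, h z ∂μ := Finset.sum_le_sum fun i _ => setLIntegral_le_lintegral _ _
    _ = _ := by simp

end

/-! ### Blow-up at the boundary of an M-domain, and properness. -/

section

variable {n : ℕ} {G : Set (MobiusSpace n)}

/-- At a boundary point that satisfies the M-condition, the modulus metric tends to infinity. -/
theorem exists_nhds_lt_modulusDist (hn : 2 ≤ n) (hG : IsOpen G) {x : MobiusSpace n} (hx : x ∉ G)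
    (hM : MCondition G x) (a : G) {R : ℝ≥0∞} (hR : R ≠ ∞) :
    ∃ V ∈ 𝓝 x, ∀ q : G, (q : MobiusSpace n) ∈ V → R < modulusDist G a q := by
  by_contra! hcon
  refine hM ?_
  have hR1 : R < R + 1 := ENNReal.lt_add_right hR one_ne_zero
  have hR1' : R + 1 ≠ ∞ := ENNReal.add_ne_top.2 ⟨hR, ENNReal.one_ne_top⟩
  have hax : x ≠ a := fun h => hx (h ▸ a.2)
  -- The connectors are used for the maximum of two densities, each of energy at most `R + 1`.
  obtain ⟨U, ω, hU, hUa⟩ := exists_nhdsChain hn (isOpen_compl_singleton.mem_nhds hax)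
    (R := (R + 1) + (R + 1)) (ENNReal.add_ne_top.2 ⟨hR1', hR1'⟩)
  have haU : ∀ i, (a : MobiusSpace n) ∉ U i := fun i hi => hUa (hU.antitone (Nat.zero_le i) hi) rfl
  have hdata : ∀ j, ∃ (q : G) (γ : Path (a : MobiusSpace n) q)
      (ρ : EuclideanSpace ℝ (Fin n) → ℝ≥0∞), (q : MobiusSpace n) ∈ U j ∧ range γ ⊆ G ∧
      Measurable ρ ∧ Separates ρ (finitePart (range γ)) (finitePart Gᶜ) ∧
      ∫⁻ z, ρ z ^ n ≤ R + 1 := fun j => by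
    obtain ⟨q, hqU, hq⟩ := hcon (U j) ((hU.isOpen j).mem_nhds (hU.mem j))
    obtain ⟨γ, hγ, hcap⟩ := exists_of_modulusDist_lt hG (hq.trans_lt hR1)
    obtain ⟨ρ, hρ, hsep, hi⟩ := exists_of_capacity_lt hcap
    exact ⟨q, γ, ρ, hqU, hγ, hρ, hsep, hi.le⟩
  choose q γ ρ hqU hγG hρ hsep hρi using hdata
  have hmeas : ∀ i, MeasurableSet (finitePart (U i)) := fun i =>
    ((hU.isOpen i).preimage OnePoint.continuous_coe).measurableSet
  -- Scale `i` uses the curve with index `J i ≥ i + 6`, which ends deep enough to cross the layer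
  -- between `U i` and `U (i + 6)`. The layers have overlap at most 6, whence the bound `6 * (R +
  -- 1)` for each single density.
  obtain ⟨J, hJ6, hJsum⟩ := exists_diagonal_tsum_le
    (f := fun i j => ∫⁻ z in finitePart (U i) \ finitePart (U (i + 6)), ρ j z ^ n)
    (M := (6 : ℕ) * (R + 1)) (fun j m => (sum_setLIntegral_diff_le hmeas
      (fun i k hik => preimage_mono (hU.antitone hik)) _ 6 m).trans
        (mul_le_mul_right (hρi j) _)) 6
  -- `P i` stays between `U (i + 1)` and `U (i + 5)` but crosses from outside `U (i + 2)` into `U (i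
  -- + 4)`. So `P i` and `P (i + 1)` both cross from outside `U (i + 3)` into `U (i + 4)`, where a
  -- connector joins them.
  have hsub : ∀ i, ∃ P ⊆ range (γ (J i)), IsCompact P ∧ IsConnected P ∧
      (P ∩ (U (i + 2))ᶜ).Nonempty ∧ (P ∩ U (i + 4)).Nonempty ∧ P ⊆ U (i + 1) ∧
      P ⊆ (U (i + 5))ᶜ := fun i => by
    obtain ⟨P, hP, hPc, hPp, hPA, hPB, hPA', hPB'⟩ := exists_subcurve (γ (J i)).continuous
      (hU.isOpen (i + 2)).isClosed_compl (isClosed_closure (s := U (i + 5)))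
      (disjoint_compl_left_iff_subset.2 ((hU.closure_subset (i + 4)).trans
        (hU.antitone (by omega)))) (by simpa using haU (i + 2))
      (by simpa using subset_closure (hU.antitone (by have := hJ6 i; omega) (hqU (J i))))
    refine ⟨P, hP, hPc, hPp, hPA, hPB.mono (inter_subset_inter_right _ (hU.closure_subset _)),
      hPA'.trans ?_, hPB'.trans ?_⟩
    · rw [compl_compl]
      exact hU.closure_subset _
    · exact closure_minimal (compl_subset_compl.2 subset_closure) (hU.isOpen _).isClosed_compl
  choose P hPγ hPc hPp hP2 hP4 hP1 hP5 using hsub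
  have hhalf : ∀ i, ∀ p ∈ finitePart (P i), ∀ w, weightedDist (ρ (J i)) p w ≤ 1 / 2 →
      ∀ v ∈ finitePart Gᶜ, 1 / 2 ≤ weightedDist (ρ (J i)) w v := fun i p hp w hw v hv =>
    half_le_weightedDist (hsep (J i)) (hPγ i hp) hw hv
  have hlink : ∀ i, ∃ T : Set (EuclideanSpace ℝ (Fin n)), IsCompact T ∧ IsConnected T ∧
      (finitePart (P i) ∩ T).Nonempty ∧ (T ∩ finitePart (P (i + 1))).Nonempty ∧
      T ⊆ finitePart (U (i + 1)) ∧ T ⊆ finitePart (U (i + 5))ᶜ ∧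
      ∀ w ∈ T, ∀ v ∈ finitePart Gᶜ, 1 / 2 ≤ weightedDist (ρ (J i)) w v := fun i => by
    have hle : U (i + 3) ⊆ U (i + 2) := hU.antitone (by omega)
    obtain ⟨p, r, hp, hr, hpr⟩ := hU.connects (i + 3)
      (fun z => max (ρ (J i) z) (ρ (J (i + 1)) z)) ((hρ _).max (hρ _))
      ((lintegral_max_pow_le (hρ _)).trans (add_le_add (hρi _) (hρi _))) (P i) (P (i + 1))
      (hPp i).isPreconnected (hPp (i + 1)).isPreconnected
      ((hP2 i).mono (inter_subset_inter_right _ (compl_subset_compl.2 hle))) (hP4 i)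
      (hP2 (i + 1)) ((hP4 (i + 1)).mono (inter_subset_inter_right _ (hU.antitone (by omega))))
    obtain ⟨η, hη⟩ := hpr
    have hη' := range_subset_iff.2 hη
    refine ⟨range η, isCompact_range η.continuous, isConnected_range η.continuous,
      ⟨p, hp, 0, η.source⟩, ⟨r, ⟨1, η.target⟩, hr⟩,
      fun w hw => hU.antitone (by omega) (hη' hw).1,
      fun w hw hw5 => (hη' hw).2.1 (hU.antitone (by omega) hw5), fun w hw => hhalf i p hp w ?_⟩
    exact (weightedDist_mono (fun z => le_max_left _ _) _ _).trans (hη' hw).2.2.le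
  choose T hTc hTp hPT hTP hT1 hT5 hThalf using hlink
  set Q : ℕ → Set (MobiusSpace n) := fun i => P i ∪ (↑) '' T i with hQ
  have hfin : ∀ i, finitePart (Q i) = finitePart (P i) ∪ T i := fun i => by
    rw [hQ, finitePart, preimage_union, preimage_image_eq _ OnePoint.coe_injective]
  have hQhalf : ∀ i, ∀ p ∈ finitePart (Q i), ∀ v ∈ finitePart Gᶜ,
      1 / 2 ≤ weightedDist (ρ (J i)) p v := fun i p hp => by
    rw [hfin] at hp
    rcases hp with hp | hp
    · exact hhalf i p hp p (by rw [weightedDist_self]; exact zero_le)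
    · exact hThalf i p hp
  have hQ1 : ∀ i, Q i ⊆ U (i + 1) := fun i => union_subset (hP1 i) (image_subset_iff.2 (hT1 i))
  have hQ5 : ∀ i, Q i ⊆ (U (i + 5))ᶜ := fun i =>
    union_subset (hP5 i) (image_subset_iff.2 (hT5 i))
  set F : ℕ → Set (EuclideanSpace ℝ (Fin n)) := fun i =>
    finitePart (U i) \ finitePart (U (i + 6))
  have hF : ∀ i, MeasurableSet (F i) := fun i => (hmeas i).diff (hmeas (i + 6))
  -- `Q i` lies between `U (i + 1)` and `U (i + 5)`. The barriers `ω i` and `ω (i + 5)` make it long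
  -- to leave the layer `F i`, so `2 * ρ (J i)` is needed only on that layer, and the energies
  -- become summable.
  set τ : ℕ → EuclideanSpace ℝ (Fin n) → ℝ≥0∞ := fun i z =>
    max ((F i).indicator (fun z => 2 * ρ (J i) z) z) (max (ω i z) (ω (i + 5) z)) with hτdef
  have hτ : ∀ i, Measurable (τ i) := fun i =>
    (((hρ _).const_mul 2).indicator (hF i)).max ((hU.measurable i).max (hU.measurable (i + 5)))
  have hτi : ∀ i, ∫⁻ z, τ i z ^ n ≤
      2 ^ n * (∫⁻ z in F i, ρ (J i) z ^ n) + ((1 / 2) ^ i + (1 / 2) ^ i) := fun i => by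
    refine (lintegral_localize_pow_le (by omega) (hF i) (hρ _)).trans (add_le_add le_rfl ?_)
    refine (lintegral_max_pow_le (hU.measurable i)).trans (add_le_add (hU.energy_le i) ?_)
    exact (hU.energy_le (i + 5)).trans (pow_le_pow_right_of_le_one' (by simp) (by omega))
  refine hU.continuumCriterion (by omega) hx (Q := Q) (τ := τ)
    (fun i => (hPc i).union ((hTc i).image OnePoint.continuous_coe)) (fun i => ?_) (fun i => ?_)
    (fun i => (hQ1 i).trans (hU.antitone (by omega))) (fun i => ?_) hτ ?_ (fun i => ?_)
  · obtain ⟨p, hp, hpT⟩ := hPT i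
    exact IsConnected.union ⟨(p : MobiusSpace n), hp, p, hpT, rfl⟩ (hPp i)
      ((hTp i).image _ OnePoint.continuous_coe.continuousOn)
  · refine union_subset ((hPγ i).trans (hγG _)) ?_
    rintro _ ⟨w, hw, rfl⟩
    by_contra hwG
    exact notMem_of_half_le (C := finitePart Gᶜ) (hThalf i w hw) hwG
  · obtain ⟨p, hpT, hp⟩ := hTP i
    exact ⟨p, Or.inr ⟨p, hpT, rfl⟩, Or.inl hp⟩
  · refine ne_top_of_le_ne_top ?_ (ENNReal.tsum_le_tsum hτi)
    rw [ENNReal.tsum_add, ENNReal.tsum_add, ENNReal.tsum_mul_left, tsum_geometric_two_ennreal]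
    refine ENNReal.add_ne_top.2 ⟨ENNReal.mul_ne_top (ENNReal.pow_ne_top (by simp))
      (ne_top_of_le_ne_top ?_ hJsum), by simp⟩
    exact ENNReal.add_ne_top.2 ⟨ENNReal.mul_ne_top (by simp) hR1', by simp⟩
  · refine (separates_two_mul (hQhalf i)).localize fun p hp z hz => ?_
    by_cases hzi : z ∈ finitePart (U i)
    · have hz6 : z ∈ finitePart (U (i + 6)) := by
        by_contra hz6
        exact hz ⟨hzi, hz6⟩
      have := hU.barrier (i + 5) z p hz6 (hQ5 i hp)
      rw [weightedDist_comm] at this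
      exact this.trans (weightedDist_mono (fun w => le_max_right _ _) _ _)
    · exact (hU.barrier i p z (hQ1 i hp) hzi).trans
        (weightedDist_mono (fun w => le_max_left _ _) _ _)

/-- An extended distance function is a proper metric if it is finite, vanishes only on the
diagonal, and every ultrafilter that contains a ball converges. -/
theorem isProperMetric_of_ultrafilter {X : Type*} {d : X → X → ℝ≥0∞} (hself : ∀ x, d x x = 0)
    (hcomm : ∀ x y, d x y = d y x) (htri : ∀ x y z, d x z ≤ d x y + d y z)
    (hfin : ∀ x y, d x y ≠ ∞) (heq : ∀ x y, d x y = 0 → x = y)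
    (hlim : ∀ (a : X) (R : ℝ≥0∞), R ≠ ∞ → ∀ f : Ultrafilter X, {y | d a y ≤ R} ∈ f →
      ∃ p, ∀ ε : ℝ≥0∞, ε ≠ 0 → {y | d p y ≤ ε} ∈ f) : IsProperMetric d := by
  let _ : EMetricSpace X :=
    { edist := d, edist_self := hself, edist_comm := hcomm, edist_triangle := htri,
      eq_of_edist_eq_zero := fun {x y} h => heq x y h }
  let _ : MetricSpace X := EMetricSpace.toMetricSpace hfin
  refine ⟨inferInstance, fun x y => rfl, ⟨fun a r => ?_⟩⟩
  rw [isCompact_iff_ultrafilter_le_nhds']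
  intro f hf
  obtain ⟨p, hp⟩ := hlim a (ENNReal.ofReal r) ENNReal.ofReal_ne_top f
    (mem_of_superset hf fun y hy => by
      rw [Metric.mem_closedBall, dist_comm] at hy
      change edist a y ≤ _
      rw [edist_dist]
      exact ENNReal.ofReal_le_ofReal hy)
  have hfp : (f : Filter X) ≤ 𝓝 p := by
    refine Metric.nhds_basis_closedEBall.ge_iff.2 fun ε hε => ?_
    refine mem_of_superset (hp ε hε.ne') fun y hy => ?_
    change edist y p ≤ ε
    rw [edist_comm]
    exact hy
  exact ⟨p, isClosed_iff_ultrafilter.1 Metric.isClosed_closedBall p f hfp hf, hfp⟩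

/-- If `p ≠ q` were at distance zero, `p` would have cheap curves out of the neighborhood `{q}ᶜ`.
Prolonged toward a boundary point, they would contradict the blow-up there. -/
theorem eq_of_modulusDist_eq_zero (hn : 2 ≤ n) (hG : IsOpen G) (hne : (frontier G).Nonempty)
    (hM : IsMDomain G) (p q : G) (h : modulusDist G p q = 0) : p = q := by
  by_contra hpq
  obtain ⟨y, hy⟩ := hne
  have hpq' : (p : MobiusSpace n) ≠ q := fun h => hpq (Subtype.ext h)
  obtain ⟨V, hV, hbig⟩ := exists_nhds_lt_modulusDist hn hG (frontier_subset_compl hG hy) (hM y hy) p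
    ENNReal.one_ne_top
  obtain ⟨z, hzV, hz⟩ := exists_modulusDist_le_of_escape hn hG
    (isOpen_compl_singleton.mem_nhds hpq')
    (fun ε hε => ⟨q, by simp, h.trans_lt (pos_iff_ne_zero.2 hε)⟩) hV one_ne_zero
  exact absurd hz (not_le.2 (hbig z hzV))

/-- The modulus metric of an M-domain is proper. -/
theorem isProperMetric_of_isMDomain (hn : 2 ≤ n) (hG : IsOpen G) (hGc : IsConnected G)
    (hne : (frontier G).Nonempty) (hM : IsMDomain G) : IsProperMetric (modulusDist G) := by
  refine isProperMetric_of_ultrafilter (modulusDist_self hn hG) (modulusDist_comm hG)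
    (modulusDist_triangle hG) (fun x y => (modulusDist_lt_top hn hG hGc x y).ne)
    (eq_of_modulusDist_eq_zero hn hG hne hM) fun a R hR f hf => ?_
  -- A limit exists in the compact Möbius space. It lies in `G` by the blow-up at the boundary, and
  -- near a point of `G` closeness there implies closeness in the modulus metric.
  obtain ⟨p, -, hp⟩ := isCompact_iff_ultrafilter_le_nhds'.1 (isCompact_univ (X := MobiusSpace n))
    (f.map Subtype.val) univ_mem
  have hpG : p ∈ G := by
    by_contra hpG
    have hpcl : p ∈ closure G := mem_closure_iff_ultrafilter.2
      ⟨f.map Subtype.val, Ultrafilter.mem_map.2 (mem_of_superset univ_mem fun z _ => z.2), hp⟩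
    have hpf : p ∈ frontier G := ⟨hpcl, fun h => hpG (interior_subset h)⟩
    obtain ⟨V, hV, hbig⟩ := exists_nhds_lt_modulusDist hn hG hpG (hM p hpf) a hR
    obtain ⟨z, hz, hzV⟩ := f.nonempty_of_mem (inter_mem hf (hp hV))
    exact absurd hz (not_le.2 (hbig z hzV))
  refine ⟨⟨p, hpG⟩, fun ε hε => ?_⟩
  obtain ⟨V, hV, hnear⟩ := exists_nhds_modulusDist_le hn hG ⟨p, hpG⟩ hε
  exact mem_of_superset (hp hV) fun z hz => hnear z hz

theorem IsProperMetric.isCompleteMetric {X : Type*} {d : X → X → ℝ≥0∞} (h : IsProperMetric d) :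
    IsCompleteMetric d := by
  obtain ⟨inst, hd, hp⟩ := h
  exact ⟨inst, hd, inferInstance⟩

end

end ModulusMetric

end

theorem mainTheorem1 (n : ℕ) (hn : 2 ≤ n) (G : Set (ModulusMetric.MobiusSpace n))
    (hGo : IsOpen G) (hGc : IsConnected G) (hG : (frontier G).Nonempty) :
    List.TFAE [
      ModulusMetric.IsProperMetric (ModulusMetric.modulusDist G),
      ModulusMetric.IsCompleteMetric (ModulusMetric.modulusDist G),
      ModulusMetric.IsMDomain G] := by
  tfae_have 1 → 2 := ModulusMetric.IsProperMetric.isCompleteMetric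
  tfae_have 2 → 3 := ModulusMetric.isMDomain_of_isCompleteMetric hn hGo
  tfae_have 3 → 1 := ModulusMetric.isProperMetric_of_isMDomain hn hGo hGc hG
  tfae_finish
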